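/- Let $2\le b_1<b_2<b_3$ be pairwise coprime integers, $p=b_1b_2b_3$, and let $\Sigma=\Sigma(b_1,b_2,b_3)$ be the Brieskorn homology sphere. It is the boundary of a negative definite plumbing along a star-shaped tree with one central vertex, of weight $m$, and three legs, where the weights $m_{i1},\dots,m_{ir_i}$ of the $i$-th leg, read outwards, satisfy $m_{i1}-\cfrac{1}{m_{i2}-\cdots}=-b_i/w_i$ with integers $w_i>0$, and $m+\sum_i w_i/b_i=-1/p$. Such a tree exists; fix any one. Let $s$ be its number of vertices, $m_v$ its weights, $\delta_v$ its valencies, $M$ its plumbing matrix, $u=(1,\dots,1)$, $\langle x,y\rangle=x^TMy$, and $h_i$ the order of $H_1$ of the plumbed manifold obtained by deleting the terminal vertex of the $i$-th leg. For $k\in(m_v)_v+2\mathbb Z^s$ put $\chi_k(x)=-\tfrac12(k\cdot x+\langle x,x\rangle)$, $\Theta_k=\tfrac12(k\cdot u-\langle u,u\rangle)$, $$\varepsilon_k(x)=-\tfrac14\Big((k-Mu)^TM^{-1}(k-Mu)+3s+\sum_v m_v\Big)+2\chi_k(x)+\langle x,u\rangle .$$ Let $\widehat F_n(r)$ be the coefficient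 of $z^{-r}$ in $(z-z^{-1})^{2-n}$, where for $n\ge3$ the average of the expansions at $z=0$ and at $z=\infty$ is taken. With $q^r=e^{2\pi i r\tau}$, $\tau\in\mathbb H$, the Akhmechet–Johnson–Krushkal series is $$\widehat{\widehat Z}_\Sigma(t,q)=\sum_{x\in\mathbb Z^s}\ \prod_v\widehat F_{\delta_v}\big((2Mx+k-Mu)_v\big)\;q^{\varepsilon_k(x)}\,t^{\Theta_k+\langle x,u\rangle}.$$ Put $\Delta=\tfrac14\big(\sum_i h_i-3s-\sum_v m_v-\tfrac{b_2b_3}{b_1}-\tfrac{b_1b_3}{b_2}-\tfrac{b_1b_2}{b_3}\big)$; $C=q^{1/120}(\zeta+\zeta^{-1})$ if $(b_1,b_2,b_3)=(2,3,5)$, and $C=0$ otherwise. Put $\alpha_1=p-b_1b_2-b_1b_3-b_2b_3$, $\alpha_2=p+b_1b_2-b_1b_3-b_2b_3$, $\alpha_3=p-b_1b_2+b_1b_3-b_2b_3$, $\alpha_4=p+b_1b_2+b_1b_3-b_2b_3$, $(c_1,c_2,c_3,c_4)=(\alpha_1+2p,\alpha_2,\alpha_3,\alpha_4-2p)$, $(\sigma_1,\sigma_2,\sigma_3,\sigma_4)=(-1,1,1,-1)$,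 and let $\varphi(n;t)=\pm\tfrac{\sigma_k}{2}\big(t^{(\mp n+c_k)/2p}+t^{(\pm n-c_k)/2p}\big)$ if $n\equiv\pm\alpha_k \pmod{2p}$ for some $k$, and $\varphi(n;t)=0$ otherwise. **Theorem.** Let $j\ge1$, $\zeta^j=1$, and $A_\zeta(\tau)=\sum_{n\ge0}\varphi(n;\zeta)\,q^{n^2/4p}$. For every such tree, every $k$ and every $\tau\in\mathbb H$ both series converge absolutely, and $$\widehat{\widehat Z}_\Sigma(\zeta,q)=q^{\Delta}\big(C-A_\zeta(\tau)\big).$$ Moreover $A_\zeta$ is a (strong) quantum modular form of weight $1/2$ for $\Gamma(4pj^2)$ with quantum set $\mathbb Q$, in the following sense. (1) For every $x\in\mathbb Q$ the limit $f(x)=\lim_{t\to0^+}A_\zeta(x+it)$ exists, and for every $\gamma=\begin{pmatrix}a&b\\c&d\end{pmatrix}\in\Gamma(4pj^2)$ the function $$h_\gamma(x)=f(x)-\varepsilon_d\Big(\frac cd\Big)(cx+d)^{-1/2}f(\gamma x)\qquad(x\in\mathbb Q,\ cx+d\ne0)$$ extends to a $C^\infty$ function on $\mathbb R$ that is real analytic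 on $\mathbb R\setminus\{\gamma^{-1}(i\infty)\}$. (The multiplier is trivial.) Here $\varepsilon_d=1$ or $i$ as $d\equiv1$ or $3$ mod $4$; $\big(\frac cd\big)$ is the Jacobi symbol $\big(\frac c{|d|}\big)$, multiplied by $-1$ if $c<0$ and $d<0$; and $(cx+d)^{1/2}$ is the boundary value at $x$ of the principal branch of $\sqrt{c\tau+d}$ on the lower half-plane. (2) For every $x\in\mathbb Q$ there is a formal power series $a_x(\epsilon)=\sum_{r\ge0}a_{x,r}\epsilon^r$ with $a_{x,0}=f(x)$ that is the asymptotic expansion of $A_\zeta(x+\epsilon)$ as $\epsilon=it$, $t\to0^+$; and for every $\gamma\in\Gamma(4pj^2)$ there is a function $h_\gamma$ as in (1) such that, for all $x\in\mathbb Q$ with $cx+d\ne0$, $$a_x(\epsilon)-\varepsilon_d\Big(\frac cd\Big)(c(x+\epsilon)+d)^{-1/2}\,a_{\gamma x}\big(\gamma(x+\epsilon)-\gamma x\big)=h_\gamma(x+\epsilon)$$ as formal power series in $\epsilon$, with $h_\gamma$ replaced by its Taylor series at $x$. -/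

import Mathlib

open Filter Topology Asymptotics
open scoped BigOperators MatrixGroups ContDiff

noncomputable section

/-! ### Plumbing graphs and the two-variable series -/

/-- A graph with integer weights on its vertices. -/
structure PlumbingGraph (V : Type) where
  graph : SimpleGraph V
  weight : V → ℤ

namespace PlumbingGraph

variable {V : Type} (Γ : PlumbingGraph V)

open Classical in
/-- The plumbing (linking) matrix `M`. -/
def matrix : Matrix V V ℤ :=
  Matrix.of fun v w => if v = w then Γ.weight v else if Γ.graph.Adj v w then 1 else 0

/-- The valency of a vertex. -/
def deg (v : V) : ℕ := (Γ.graph.neighborSet v).ncard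

/-- The weighted graph that remains after all vertices outside `s` have been removed. -/
def restrict (s : Set V) : PlumbingGraph s where
  graph := Γ.graph.induce s
  weight := fun v => Γ.weight v

variable [Fintype V]

/-- The plumbing matrix is negative definite. -/
def IsNegDef : Prop := (-(Γ.matrix.map (Int.cast : ℤ → ℝ))).PosDef

/-- The cardinality of the first homology group of the plumbed manifold: this group is the
cokernel of the plumbing matrix. -/
def cardH1 : ℕ := Nat.card ((V → ℤ) ⧸ LinearMap.range Γ.matrix.mulVecLin)

/-- The bilinear form `⟨x, y⟩ = xᵀ M y`. -/
def form (x y : V → ℤ) : ℤ := x ⬝ᵥ (Γ.matrix.mulVec y)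

/-- `k` represents a spin-c structure: `k ∈ m + 2 ℤ^s`. -/
def IsSpinc (k : V → ℤ) : Prop := ∀ v, k v ≡ Γ.weight v [ZMOD 2]

/-- `χ_k(x) = -(k·x + ⟨x, x⟩)/2`. -/
def chi (k x : V → ℤ) : ℚ := -((k ⬝ᵥ x + Γ.form x x : ℤ) : ℚ) / 2

/-- `Θ_k = (k·u - ⟨u, u⟩)/2` with `u = (1, 1, …)`. For a spin-c representative `k` the division
is exact, since `⟨u, u⟩` is the sum of the weights plus twice the number of edges. -/
def theta (k : V → ℤ) : ℤ := (k ⬝ᵥ 1 - Γ.form 1 1) / 2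

open Classical in
/-- The rational number `aᵀ M⁻¹ a`. -/
def invSq (a : V → ℤ) : ℚ :=
  (fun v => (a v : ℚ)) ⬝ᵥ
    ((Γ.matrix.map (Int.cast : ℤ → ℚ))⁻¹.mulVec fun v => (a v : ℚ))

/-- `ε_k(x) = -((k - M u)² + 3 s + ∑ m_v)/4 + 2 χ_k(x) + ⟨x, u⟩`,
where `a²` stands for `aᵀ M⁻¹ a`. -/
def eps (k x : V → ℤ) : ℚ :=
  -(Γ.invSq (k - Γ.matrix.mulVec 1) + 3 * Fintype.card V + ((∑ v, Γ.weight v : ℤ) : ℚ)) / 4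
    + 2 * Γ.chi k x + (Γ.form x 1 : ℚ)

end PlumbingGraph

/-- `F̂_n(r)`: the coefficient of `z^{-r}` in `(z - z⁻¹)^{2-n}`; for `n ≥ 3` this means the average
of the expansions at `z = 0` and at `z = ∞`, which gives
`½ sgn(r)ⁿ binom((n + |r|)/2 - 2, n - 3)` when `|r| ≥ n - 2` and `r ≡ n mod 2`, and `0` otherwise. -/
def Fhat : ℕ → ℤ → ℚ
  | 0, r => if r = 2 ∨ r = -2 then 1 else if r = 0 then -2 else 0
  | 1, r => if r = 1 then -1 else if r = -1 then 1 else 0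
  | 2, r => if r = 0 then 1 else 0
  | n + 3, r =>
      if n + 1 ≤ r.natAbs ∧ r ≡ ((n + 3 : ℕ) : ℤ) [ZMOD 2] then
        1 / 2 * (r.sign : ℚ) ^ (n + 3) * (((n + 3 + r.natAbs) / 2 - 2).choose n : ℚ)
      else 0

/-- The rational power `q^r` of `q = e^{2πiτ}`, that is `e^{2πi r τ}`. -/
def qpow (r : ℚ) (τ : ℂ) : ℂ := Complex.exp (2 * Real.pi * Complex.I * (r : ℂ) * τ)

namespace PlumbingGraph

variable {V : Type} [Fintype V] (Γ : PlumbingGraph V)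

/-- The summand `F̂_{Γ,k}(x) q^{ε_k(x)} t^{Θ_k + ⟨x, u⟩}`, with
`F̂_{Γ,k}(x) = ∏_v F̂_{δ_v}((2 M x + k - M u)_v)`. -/
def zhhTerm (k : V → ℤ) (t τ : ℂ) (x : V → ℤ) : ℂ :=
  ((∏ v, Fhat (Γ.deg v)
      ((2 • Γ.matrix.mulVec x + k - Γ.matrix.mulVec 1) v) : ℚ) : ℂ)
    * qpow (Γ.eps k x) τ * t ^ (Γ.theta k + Γ.form x 1)

/-- The two-variable series at `(t, q)` with `q = e^{2πiτ}`. -/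
def zhh (k : V → ℤ) (t τ : ℂ) : ℂ := ∑' x : V → ℤ, Γ.zhhTerm k t τ x

end PlumbingGraph

/-! ### Star-shaped plumbing graphs with three legs -/

/-- A central weight and three legs, each given by its list of weights, read outwards from the
central vertex. -/
structure StarPlumbing where
  center : ℤ
  leg : Fin 3 → List ℤ

/-- The continued fraction `m₁ - 1/(m₂ - 1/(m₃ - ⋯))`. The empty list gets the value `0`, so that
a list with one entry `m` has the value `m - 0⁻¹ = m`. -/
def negContFrac : List ℤ → ℚ
  | [] => 0
  | m :: l => m - (negContFrac l)⁻¹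

namespace StarPlumbing

variable (P : StarPlumbing)

/-- The vertices: the central one, and `⟨i, a⟩` for the `a`-th vertex of the `i`-th leg. -/
abbrev Vertex : Type := Option (Σ i : Fin 3, Fin (P.leg i).length)

/-- The central vertex is joined to the first vertex of each leg, and consecutive vertices of
a leg are joined. -/
def Adj : P.Vertex → P.Vertex → Prop
  | none, none => False
  | none, some v => (v.2 : ℕ) = 0
  | some v, none => (v.2 : ℕ) = 0
  | some v, some w => v.1 = w.1 ∧ ((v.2 : ℕ) + 1 = w.2 ∨ (w.2 : ℕ) + 1 = v.2)

/-- The weighted star graph. -/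
def toGraph : PlumbingGraph P.Vertex where
  graph :=
    { Adj := P.Adj
      symm := ⟨by
        rintro (_ | v) (_ | w) h
        · exact h
        · exact h
        · exact h
        · exact ⟨h.1.symm, h.2.symm⟩⟩
      loopless := ⟨by
        rintro (_ | v) h
        · exact h
        · rcases h.2 with h | h <;> omega⟩ }
  weight
    | none => P.center
    | some v => (P.leg v.1).get v.2

/-- The star is a negative definite plumbing of the Brieskorn sphere `Σ(b₁, b₂, b₃)`: the `i`-th
leg has the continued fraction `-bᵢ/wᵢ`, and `m + ∑ wᵢ/bᵢ = -1/(b₁b₂b₃)` for the weight `m` of the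
centre (the Seifert fibred homology sphere with three exceptional fibres of multiplicities
`b₁, b₂, b₃`, oriented as a singularity link). -/
def IsPlumbingOf (b : Fin 3 → ℕ) : Prop :=
  P.toGraph.IsNegDef ∧
  ∃ w : Fin 3 → ℤ, (∀ i, 0 < w i) ∧
    (∀ i, negContFrac (P.leg i) = -((b i : ℚ) / (w i : ℚ))) ∧
    (P.center : ℚ) + ∑ i, (w i : ℚ) / (b i : ℚ) = -(1 / (b 0 * b 1 * b 2 : ℚ))

/-- All vertices but the terminal vertex of the `i`-th leg. -/
def withoutTip (i : Fin 3) : Set P.Vertex :=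
  {v | ∀ a : Fin (P.leg i).length, (a : ℕ) + 1 = (P.leg i).length → v ≠ some ⟨i, a⟩}

open Classical in
/-- `hᵢ`: the cardinality of `H₁` of the plumbed manifold that results from removing the terminal
vertex of the `i`-th leg. -/
def h (i : Fin 3) : ℕ := (P.toGraph.restrict (P.withoutTip i)).cardH1

/-- `Δ = ¼ (∑ hᵢ - 3 s - ∑ m_v - b₂b₃/b₁ - b₁b₃/b₂ - b₁b₂/b₃)`. -/
def Delta (b : Fin 3 → ℕ) : ℚ :=
  ((∑ i, (P.h i : ℚ)) - 3 * Fintype.card P.Vertex - ((∑ v, P.toGraph.weight v : ℤ) : ℚ)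
    - (b 1 * b 2 : ℚ) / b 0 - (b 0 * b 2 : ℚ) / b 1 - (b 0 * b 1 : ℚ) / b 2) / 4

end StarPlumbing

/-! ### The coefficients and the series `A` -/

/-- For `n ≡ ± α mod 2p` the value `± ½ (t^{(∓n + c)/2p} + t^{(±n - c)/2p})`, and `0` otherwise.
It is used with `c ≡ α mod 2p`, so that the exponents are integers. -/
def phiPart (p : ℕ) (α c n : ℤ) (t : ℂ) : ℂ :=
  if n ≡ α [ZMOD 2 * p] then
    1 / 2 * (t ^ ((-n + c) / (2 * p)) + t ^ ((n - c) / (2 * p)))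
  else if n ≡ -α [ZMOD 2 * p] then
    -(1 / 2) * (t ^ ((n + c) / (2 * p)) + t ^ ((-n - c) / (2 * p)))
  else 0

/-- The Laurent polynomials `φ(n; t)`. For pairwise coprime `bᵢ ≥ 2` the eight classes
`± α₁, …, ± α₄` modulo `2p` are distinct, so at most one of the four terms is nonzero. -/
def phi (b : Fin 3 → ℕ) (n : ℤ) (t : ℂ) : ℂ :=
  let b1 : ℤ := b 0
  let b2 : ℤ := b 1
  let b3 : ℤ := b 2
  let p : ℕ := b 0 * b 1 * b 2
  let α1 : ℤ := b1 * b2 * b3 - b1 * b2 - b1 * b3 - b2 * b3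
  let α2 : ℤ := b1 * b2 * b3 + b1 * b2 - b1 * b3 - b2 * b3
  let α3 : ℤ := b1 * b2 * b3 - b1 * b2 + b1 * b3 - b2 * b3
  let α4 : ℤ := b1 * b2 * b3 + b1 * b2 + b1 * b3 - b2 * b3
  phiPart p α2 α2 n t + phiPart p α3 α3 n t
    - phiPart p α1 (α1 + 2 * p) n t - phiPart p α4 (α4 - 2 * p) n t

/-- The summand `φ(n; t) q^{n²/4p}`. -/
def ATerm (b : Fin 3 → ℕ) (t τ : ℂ) (n : ℕ) : ℂ :=
  phi b n t * qpow ((n : ℚ) ^ 2 / (4 * (b 0 * b 1 * b 2 : ℕ))) τ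

/-- `A_t(τ) = ∑_{n ≥ 0} φ(n; t) q^{n²/4p}`. -/
def ASeries (b : Fin 3 → ℕ) (t τ : ℂ) : ℂ := ∑' n : ℕ, ATerm b t τ n

/-- `q^{1/120} (t + t⁻¹)` for `Σ(2, 3, 5)`, and `0` otherwise. -/
def CTerm (b : Fin 3 → ℕ) (t τ : ℂ) : ℂ :=
  if b 0 = 2 ∧ b 1 = 3 ∧ b 2 = 5 then qpow (1 / 120) τ * (t + t⁻¹) else 0

/-! ### Quantum modular forms of half-integral weight -/

/-- The quadratic symbol `(c/d)` for odd `d`, with the usual convention for negative `d`: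
`(c/d) = (c/|d|)`, with an additional sign when `c` and `d` are both negative. -/
def thetaSymbol (c d : ℤ) : ℤ :=
  if c < 0 ∧ d < 0 then -jacobiSym c d.natAbs else jacobiSym c d.natAbs

/-- `ε_d = 1` for `d ≡ 1 mod 4` and `ε_d = i` for `d ≡ 3 mod 4`. -/
def thetaEps (d : ℤ) : ℂ := if d ≡ 1 [ZMOD 4] then 1 else Complex.I

open ComplexConjugate in
/-- `√(c x + d)` for real `x`: the boundary value at `x` of the branch of `√(c τ + d)`, with argument
in `(-π/2, π/2]`, on the lower half-plane. For `c > 0` and `c x + d < 0` this is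
`-i √|c x + d|`, the conjugate of the principal value; in the other cases it is the principal
value. -/
def lowerSqrt (c d : ℤ) (x : ℝ) : ℂ :=
  if 0 < c then conj (((c * x + d : ℝ) : ℂ) ^ (1 / 2 : ℂ))
  else ((c * x + d : ℝ) : ℂ) ^ (1 / 2 : ℂ)

/-- The factor `ε_d^{2k} (c/d) (c x + d)^{-k}` of the slash operator of weight `k = κ/2`, where `κ`
is an odd integer, at a real point `x`. -/
def slashFactor (κ : ℤ) (γ : SL(2, ℤ)) (x : ℝ) : ℂ :=
  thetaEps (γ 1 1) ^ κ * (thetaSymbol (γ 1 0) (γ 1 1) : ℂ) * lowerSqrt (γ 1 0) (γ 1 1) x ^ (-κ)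

/-- The point `γ x = (a x + b)/(c x + d)` for `x` in a field; used where `c x + d ≠ 0`. -/
def moebius {K : Type} [Field K] (γ : SL(2, ℤ)) (x : K) : K :=
  ((γ 0 0 : K) * x + (γ 0 1 : K)) / ((γ 1 0 : K) * x + (γ 1 1 : K))

/-- `h` is smooth on `ℝ`, and real analytic on `ℝ` without the point `γ⁻¹(i∞)`. -/
def IsNiceFor (γ : SL(2, ℤ)) (h : ℝ → ℂ) : Prop :=
  ContDiff ℝ ∞ h ∧ AnalyticOnNhd ℝ h {x | (γ 1 0 : ℝ) * x + (γ 1 1 : ℝ) ≠ 0}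

open ComplexConjugate in
/-- `f` is a quantum modular form of weight `κ/2` (`κ` odd) with multiplier `χ` for `Γ`, with
quantum set `ℚ`: for every `γ ∈ Γ` the function `h_γ = f - χ̄(γ) f|γ` on `ℚ ∖ {γ⁻¹(i∞)}` extends to
a smooth function on `ℝ` that is real analytic on `ℝ ∖ {γ⁻¹(i∞)}`. -/
def IsQuantumModularForm (κ : ℤ) (χ : SL(2, ℤ) → ℂ) (Γ : Subgroup SL(2, ℤ)) (f : ℚ → ℂ) : Prop :=
  ∀ γ ∈ Γ, ∃ h : ℝ → ℂ, IsNiceFor γ h ∧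
    ∀ x : ℚ, (γ 1 0 : ℚ) * x + (γ 1 1 : ℚ) ≠ 0 →
      f x - conj (χ γ) * slashFactor κ γ x * f (moebius γ x) = h x

/-- The value at `ε` of the truncation `∑_{r < N} a_r ε^r` of a formal power series. -/
def truncEval (a : ℕ → ℂ) (N : ℕ) (ε : ℂ) : ℂ := ∑ r ∈ Finset.range N, a r * ε ^ r

/-- The formal power series `∑ a_{x,r} ε^r` is the asymptotic expansion of `F(x + ε)` as `ε = i t`
tends to `0` with `t > 0`, at every rational number `x`. -/
def IsRadialExpansion (F : ℂ → ℂ) (a : ℚ → ℕ → ℂ) : Prop :=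
  ∀ (x : ℚ) (N : ℕ),
    (fun t : ℝ => F (x + Complex.I * t) - truncEval (a x) N (Complex.I * t))
      =O[𝓝[>] (0 : ℝ)] fun t : ℝ => t ^ N

open ComplexConjugate in
/-- The family of formal power series `a_x(ε)`, `x ∈ ℚ`, is a strong quantum modular form of weight
`κ/2` with multiplier `χ` for `Γ`: for every `γ ∈ Γ` there is a function `h_γ` as in
`IsQuantumModularForm` such that `a - χ̄(γ) a|γ = h_γ` as formal power series in `ε` at every
rational `x ≠ γ⁻¹(i∞)`, where `(a|γ)_x(ε)` is the slash factor at `x + ε` times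
`a_{γx}(γ(x + ε) - γx)`, and `h_γ` stands for its Taylor series at `x`. Equality of formal power
series is expressed by agreement to all orders as the real number `ε` tends to `0`. -/
def IsStrongQuantumModularForm (κ : ℤ) (χ : SL(2, ℤ) → ℂ) (Γ : Subgroup SL(2, ℤ))
    (a : ℚ → ℕ → ℂ) : Prop :=
  ∀ γ ∈ Γ, ∃ h : ℝ → ℂ, IsNiceFor γ h ∧
    ∀ x : ℚ, (γ 1 0 : ℚ) * x + (γ 1 1 : ℚ) ≠ 0 → ∀ N : ℕ,
      (fun ε : ℝ =>
        truncEval (a x) N ε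
          - conj (χ γ) * slashFactor κ γ (x + ε)
              * truncEval (a (moebius γ x)) N
                  ((moebius γ ((x : ℝ) + ε) - moebius γ (x : ℝ) : ℝ) : ℂ)
          - h (x + ε))
        =O[𝓝 (0 : ℝ)] fun ε : ℝ => ε ^ N

end

/-!
The theorem has three independent parts.

*Quantum modularity* (`exists_quantumModularForm`). The coefficients `φ(n; ζ)` are real, odd, and
periodic modulo `2pj`, and this is all that is used. An odd function of period `L` and its finite
Fourier transform have unary theta series of weight `3/2` that are exchanged by `w ↦ 1/w`
(`isThetaPair_dft`). The false theta series is an Eichler integral of such a theta series. Integrating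
the theta series against `(u - s)^{-1/2}` along a ray gives the false theta series of the function minus
or plus that of its transform at `1/s`, according to the side of the real axis on which `s` lies
(`rayIntegral_eq_eichler`); deforming the ray to the positive axis turns this into the period integral
`∫ θ(u) (u - s)^{-1/2} du`. On the boundary `s ∈ iℝ` the period integral is analytic for `s ≠ 0`, and
it is smooth at `s = 0` because `θ` decays rapidly at both cusps (`contDiff_periodIntegral`). For `γ`
with lower row `(c, d)` this is applied with `s = -i(cτ + d)` to `φ` twisted by `e(-dn²/4pc)`. The
finite Fourier transform of the twist is a multiple of `φ(n) e(an²/4pc)` (`dft_twist`); the factor is a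
quadratic Gauss sum (`quadSum_eq`), and it yields the theta multiplier. The case `c < 0` follows by
complex conjugation, since `φ` is real. The same integral, along a tilted ray, provides asymptotic
expansions in cones around the vertical direction (`exists_expansion`). The identity between the
expansions at `x` and at `γx` holds on a vertical path up to `O(t^N)`, hence as an identity of Taylor
series (`isBigO_of_slashRelation`).

*Value of the series* (`zhh_eq`). The rows of the plumbing matrix `M` along a leg are a three-term
recursion, so that all relations reduce to the values `b_i`, `w_i` of its solution `chain`. This shows
that `M` is unimodular (`mulVec_surjective`) and gives the entries of `M⁻¹` at the centre and at the
tips (`tipVec_dotProduct_solution`), where the diagonal entry at the `i`-th tip is `-h_i`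
(`h_eq_neg`). A term of the series vanishes unless the vector `2Mx + k - Mu` is odd at the centre, `±1`
at the tips, and zero elsewhere. On these vectors the exponent of `q` is a perfect square over `4p`, up
to `Δ`, and the sum is a sum over the classes of `±α_k` modulo `2p` (`hasSum_class`). The coefficient at
the centre carries the sign of the central coordinate and `φ` the sign of `n`; these agree because
`0 < α_k < 2p`, except that `α_1 = -1` for `(2, 3, 5)`, where one term with the wrong sign leaves `C`
(`hasSum_signed`).

*Existence of the tree* (`exists_isPlumbingOf`). The `w_i` are inverses modulo `b_i`, the legs are the
negative continued fractions of `-b_i/w_i`, and completing squares along the legs leaves `-1/p < 0` at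
the centre.
-/

/-! ### Unary theta series with rapid decay at both ends -/

namespace FalseTheta

open Complex MeasureTheory Set

/-- The unary theta series `∑ n ψ(n) e^{-κ n² w}` of weight `3/2`, summed over `n ≥ 0`. For odd `ψ`
this is half of the sum over all integers. -/
noncomputable def theta (κ : ℝ) (ψ : ℕ → ℂ) (w : ℂ) : ℂ :=
  ∑' n : ℕ, (n : ℂ) * ψ n * cexp (-(κ * n ^ 2 * w))

/-- The false theta series `∑ ψ(n) e^{-κ n² s}`, an Eichler integral of `theta κ ψ`. -/
noncomputable def eichler (κ : ℝ) (ψ : ℕ → ℂ) (s : ℂ) : ℂ :=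
  ∑' n : ℕ, ψ n * cexp (-(κ * n ^ 2 * s))

/-- Two bounded sequences whose theta series are exchanged by `w ↦ 1/w` in weight `3/2`. The analytic
arguments below use nothing else about them. -/
structure IsThetaPair (κ : ℝ) (ψ χ : ℕ → ℂ) : Prop where
  pos : 0 < κ
  left_zero : ψ 0 = 0
  right_zero : χ 0 = 0
  left_bdd : ∃ B, ∀ n, ‖ψ n‖ ≤ B
  right_bdd : ∃ B, ∀ n, ‖χ n‖ ≤ B
  theta_eq : ∀ w : ℂ, 0 < w.re →
    theta κ ψ w = -I * w ^ (-(3 / 2) : ℂ) * theta κ χ (1 / w)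

lemma exp_neg_le_factorial_div {y : ℝ} (hy : 0 < y) (k : ℕ) :
    Real.exp (-y) ≤ k.factorial / y ^ k := by
  have h := Real.pow_div_factorial_le_exp y hy.le k
  have hk : (0 : ℝ) < k.factorial := by positivity
  rw [Real.exp_neg, inv_le_comm₀ (Real.exp_pos _) (by positivity), inv_div]
  exact h

lemma norm_cexp_term (κ : ℝ) (n : ℕ) (w : ℂ) :
    ‖cexp (-(κ * n ^ 2 * w))‖ = Real.exp (-(κ * n ^ 2 * w.re)) := by
  rw [Complex.norm_exp]
  congr 1
  have : (κ * n ^ 2 * w : ℂ) = ((κ * n ^ 2 : ℝ) : ℂ) * w := by push_cast; ring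
  rw [neg_re, this, re_ofReal_mul]

/-- Polynomial domination of the theta summands, uniform in the real part. -/
lemma norm_theta_term_le {κ B : ℝ} (hκ : 0 < κ) {ψ : ℕ → ℂ} (hB : ∀ n, ‖ψ n‖ ≤ B) {k : ℕ}
    (hk : 2 ≤ k) {w : ℂ} (hw : 0 < w.re) (n : ℕ) :
    ‖(n : ℂ) * ψ n * cexp (-(κ * n ^ 2 * w))‖ ≤
      B * (k.factorial / (κ * w.re) ^ k) * (1 / (n : ℝ) ^ 2) := by
  have hB0 : 0 ≤ B := (norm_nonneg _).trans (hB 0)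
  rcases Nat.eq_zero_or_pos n with rfl | hn
  · simp
  have hn1 : (1 : ℝ) ≤ n := by exact_mod_cast hn
  rw [norm_mul, norm_mul, norm_cexp_term, norm_natCast]
  have h1 := exp_neg_le_factorial_div (y := κ * n ^ 2 * w.re) (by positivity) k
  have h2 : (n : ℝ) * (k.factorial / (κ * n ^ 2 * w.re) ^ k) ≤
      k.factorial / (κ * w.re) ^ k * (1 / (n : ℝ) ^ 2) := by
    have e : κ * (n : ℝ) ^ 2 * w.re = (κ * w.re) * (n : ℝ) ^ 2 := by ring
    rw [e, mul_pow, ← pow_mul]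
    have h3 : (n : ℝ) ^ 3 ≤ (n : ℝ) ^ (2 * k) := pow_le_pow_right₀ hn1 (by omega)
    rw [div_mul_div_comm, mul_one, mul_div_assoc', div_le_div_iff₀ (by positivity) (by positivity)]
    have h4 : (0 : ℝ) ≤ k.factorial * (κ * w.re) ^ k := by positivity
    nlinarith [mul_le_mul_of_nonneg_left h3 h4]
  calc (n : ℝ) * ‖ψ n‖ * Real.exp (-(κ * n ^ 2 * w.re))
      ≤ n * B * (k.factorial / (κ * n ^ 2 * w.re) ^ k) := by gcongr; exact hB n
    _ = B * (n * (k.factorial / (κ * n ^ 2 * w.re) ^ k)) := by ring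
    _ ≤ B * (k.factorial / (κ * w.re) ^ k * (1 / (n : ℝ) ^ 2)) := by gcongr
    _ = _ := by ring

lemma summable_theta {κ : ℝ} (hκ : 0 < κ) {ψ : ℕ → ℂ} (hψ : ∃ B, ∀ n, ‖ψ n‖ ≤ B) {w : ℂ}
    (hw : 0 < w.re) : Summable fun n : ℕ => (n : ℂ) * ψ n * cexp (-(κ * n ^ 2 * w)) := by
  obtain ⟨B, hB⟩ := hψ
  exact Summable.of_norm_bounded ((Real.summable_one_div_nat_pow.2 (by norm_num)).mul_left _)
    (norm_theta_term_le hκ hB le_rfl hw)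

lemma exists_norm_theta_le {κ : ℝ} (hκ : 0 < κ) {ψ : ℕ → ℂ} (hψ : ∃ B, ∀ n, ‖ψ n‖ ≤ B) {k : ℕ}
    (hk : 2 ≤ k) : ∃ C, 0 ≤ C ∧ ∀ w : ℂ, 0 < w.re → ‖theta κ ψ w‖ ≤ C / w.re ^ k := by
  obtain ⟨B, hB⟩ := hψ
  have hB0 : 0 ≤ B := (norm_nonneg _).trans (hB 0)
  have hs : Summable fun n : ℕ => 1 / (n : ℝ) ^ 2 := Real.summable_one_div_nat_pow.2 (by norm_num)
  have h0 : 0 ≤ ∑' n : ℕ, 1 / (n : ℝ) ^ 2 := tsum_nonneg fun n => by positivity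
  refine ⟨B * (k.factorial / κ ^ k) * ∑' n : ℕ, 1 / (n : ℝ) ^ 2, by positivity, fun w hw => ?_⟩
  calc ‖theta κ ψ w‖ ≤ ∑' n : ℕ, B * (k.factorial / (κ * w.re) ^ k) * (1 / (n : ℝ) ^ 2) :=
        tsum_of_norm_bounded (hs.mul_left _).hasSum (norm_theta_term_le hκ hB hk hw)
    _ = _ := by rw [tsum_mul_left, mul_pow]; field_simp

lemma differentiableOn_theta {κ : ℝ} (hκ : 0 < κ) {ψ : ℕ → ℂ} (hψ : ∃ B, ∀ n, ‖ψ n‖ ≤ B) :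
    DifferentiableOn ℂ (theta κ ψ) {w | 0 < w.re} := by
  obtain ⟨B, hB⟩ := hψ
  have hB0 : 0 ≤ B := (norm_nonneg _).trans (hB 0)
  intro w hw
  have hw' : 0 < w.re := hw
  set U : Set ℂ := {z | w.re / 2 < z.re}
  have hUo : IsOpen U := isOpen_lt continuous_const continuous_re
  have hwU : w ∈ U := by change w.re / 2 < w.re; linarith
  have hs : Summable fun n : ℕ =>
      B * ((2 : ℕ).factorial / (κ * (w.re / 2)) ^ 2) * (1 / (n : ℝ) ^ 2) :=
    (Real.summable_one_div_nat_pow.2 (by norm_num)).mul_left _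
  have := differentiableOn_tsum_of_summable_norm (U := U)
    (F := fun (n : ℕ) (w : ℂ) => (n : ℂ) * ψ n * cexp (-(κ * n ^ 2 * w))) hs
    (fun n => by fun_prop) hUo (fun n z hz => by
      have hz' : w.re / 2 < z.re := hz
      have hz0 : 0 < z.re := by linarith
      refine (norm_theta_term_le hκ hB le_rfl hz0 n).trans ?_
      gcongr)
  exact (this.differentiableAt (hUo.mem_nhds hwU)).differentiableWithinAt

lemma summable_eichler {κ : ℝ} (hκ : 0 < κ) {ψ : ℕ → ℂ} (hψ : ∃ B, ∀ n, ‖ψ n‖ ≤ B) {s : ℂ}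
    (hs : 0 < s.re) : Summable fun n : ℕ => ψ n * cexp (-(κ * n ^ 2 * s)) := by
  obtain ⟨B, hB⟩ := hψ
  have hB0 : 0 ≤ B := (norm_nonneg _).trans (hB 0)
  refine Summable.of_norm_bounded_eventually_nat
    ((Real.summable_one_div_nat_pow.2 (by norm_num : 1 < 2)).mul_left
      (B * ((2 : ℕ).factorial / (κ * s.re) ^ 2))) ?_
  filter_upwards [eventually_ge_atTop 1] with n hn
  refine le_trans ?_ (norm_theta_term_le hκ hB le_rfl hs n)
  rw [mul_assoc (n : ℂ), norm_mul (n : ℂ), norm_natCast]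
  exact le_mul_of_one_le_left (norm_nonneg _) (by exact_mod_cast hn)

/-- The false theta series decays faster than any power for large real part. -/
lemma exists_norm_eichler_le {κ : ℝ} (hκ : 0 < κ) {ψ : ℕ → ℂ} (hψ : ∃ B, ∀ n, ‖ψ n‖ ≤ B)
    (h0 : ψ 0 = 0) {k : ℕ} (hk : 2 ≤ k) :
    ∃ C, 0 ≤ C ∧ ∀ s : ℂ, 0 < s.re → ‖eichler κ ψ s‖ ≤ C / s.re ^ k := by
  obtain ⟨B, hB⟩ := hψ
  have hB0 : 0 ≤ B := (norm_nonneg _).trans (hB 0)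
  have hs : Summable fun n : ℕ => 1 / (n : ℝ) ^ 2 := Real.summable_one_div_nat_pow.2 (by norm_num)
  have h0' : 0 ≤ ∑' n : ℕ, 1 / (n : ℝ) ^ 2 := tsum_nonneg fun n => by positivity
  refine ⟨B * (k.factorial / κ ^ k) * ∑' n : ℕ, 1 / (n : ℝ) ^ 2, by positivity, fun w hw => ?_⟩
  calc ‖eichler κ ψ w‖ ≤ ∑' n : ℕ, B * (k.factorial / (κ * w.re) ^ k) * (1 / (n : ℝ) ^ 2) := by
        refine tsum_of_norm_bounded (hs.mul_left _).hasSum fun n => ?_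
        refine le_trans ?_ (norm_theta_term_le hκ hB hk hw n)
        rcases Nat.eq_zero_or_pos n with rfl | hn
        · simp [h0]
        rw [mul_assoc (n : ℂ), norm_mul (n : ℂ), norm_natCast]
        exact le_mul_of_one_le_left (norm_nonneg _) (by exact_mod_cast hn)
    _ = _ := by rw [tsum_mul_left, mul_pow]; field_simp

/-- On every compact part of a cone around the positive axis, the theta series of a pair decays
faster than any power along rays, at `0` and at `∞`. -/
lemma IsThetaPair.exists_norm_theta_ray_le {κ : ℝ} {ψ χ : ℕ → ℂ} (h : IsThetaPair κ ψ χ) {K : ℝ}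
    (hK : 0 < K) (N : ℕ) : ∃ C, 0 ≤ C ∧ ∀ (μ : ℂ) (u : ℝ), 1 ≤ K * μ.re → ‖μ‖ ≤ K → 0 < u →
      ‖theta κ ψ (μ * u)‖ ≤ C * (u ^ N / (1 + u ^ 2)) := by
  obtain ⟨C₁, hC₁, h₁⟩ := exists_norm_theta_le h.pos h.left_bdd (le_refl 2)
  obtain ⟨C₂, hC₂, h₂⟩ := exists_norm_theta_le h.pos h.right_bdd (k := N + 2) (by omega)
  set D : ℝ := K ^ (3 / 2 : ℝ) * (C₂ * K ^ (3 * (N + 2)))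
  have hD : 0 ≤ D := by positivity
  refine ⟨2 * (C₁ * K ^ 2 + D), by positivity, fun μ u hμ hμK hu => ?_⟩
  have hre : 0 < μ.re := by
    by_contra hcon
    nlinarith [mul_nonpos_of_nonneg_of_nonpos hK.le (not_lt.1 hcon)]
  have hreK : K⁻¹ ≤ μ.re := by rw [inv_le_iff_one_le_mul₀ hK, mul_comm]; linarith
  have hμ0 : 0 < ‖μ‖ := hre.trans_le (re_le_norm μ)
  have hμK' : K⁻¹ ≤ ‖μ‖ := hreK.trans (re_le_norm μ)
  have hwre : (μ * u).re = μ.re * u := re_mul_ofReal μ u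
  have hwpos : 0 < (μ * u).re := by rw [hwre]; positivity
  rcases le_total 1 u with hu1 | hu1
  · have e := h₁ _ hwpos
    rw [hwre] at e
    calc ‖theta κ ψ (μ * u)‖ ≤ C₁ / (μ.re * u) ^ 2 := e
      _ ≤ C₁ / (K⁻¹ * u) ^ 2 := by gcongr
      _ = C₁ * K ^ 2 * (1 / u ^ 2) := by field_simp
      _ ≤ C₁ * K ^ 2 * (2 * (u ^ N / (1 + u ^ 2))) := by
          gcongr
          rw [← mul_div_assoc, div_le_div_iff₀ (by positivity) (by positivity)]
          nlinarith [one_le_pow₀ hu1 (n := N), one_le_pow₀ hu1 (n := 2)]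
      _ ≤ _ := by
          have : 0 ≤ u ^ N / (1 + u ^ 2) := by positivity
          nlinarith
  · have hinv : (1 / (μ * u)).re = μ.re / (‖μ‖ ^ 2 * u) := by
      rw [one_div, inv_re, hwre, normSq_eq_norm_sq, norm_mul, norm_real, Real.norm_of_nonneg hu.le]
      field_simp
    have hinvle : (K ^ 3 * u)⁻¹ ≤ (1 / (μ * u)).re := by
      rw [hinv, inv_eq_one_div, div_le_div_iff₀ (by positivity) (by positivity)]
      have : ‖μ‖ ^ 2 ≤ K ^ 2 := by gcongr
      calc 1 * (‖μ‖ ^ 2 * u) ≤ 1 * (K ^ 2 * u) := by gcongr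
        _ ≤ (K * μ.re) * (K ^ 2 * u) := by gcongr
        _ = _ := by ring
    have hinvpos : 0 < (1 / (μ * u)).re := lt_of_lt_of_le (by positivity) hinvle
    have hnorm : ‖(μ * u : ℂ) ^ (-(3 / 2) : ℂ)‖ ≤ K ^ (3 / 2 : ℝ) * u ^ (-(3 / 2) : ℝ) := by
      have : (-(3 / 2) : ℂ) = ((-(3 / 2) : ℝ) : ℂ) := by push_cast; ring
      rw [this, norm_cpow_real, norm_mul, norm_real, Real.norm_of_nonneg hu.le,
        Real.mul_rpow (norm_nonneg _) hu.le]
      gcongr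
      rw [Real.rpow_neg (norm_nonneg _), ← Real.inv_rpow (norm_nonneg _)]
      gcongr
      rwa [inv_le_comm₀ hμ0 hK]
    have hu2 : u ^ (-(3 / 2) : ℝ) * u ^ (N + 2) ≤ u ^ N := by
      have : u ^ (-(3 / 2) : ℝ) * u ^ 2 ≤ 1 := by
        rw [← Real.rpow_natCast u 2, ← Real.rpow_add hu]
        exact Real.rpow_le_one hu.le hu1 (by norm_num)
      calc u ^ (-(3 / 2) : ℝ) * u ^ (N + 2) = (u ^ (-(3 / 2) : ℝ) * u ^ 2) * u ^ N := by ring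
        _ ≤ 1 * u ^ N := by gcongr
        _ = _ := one_mul _
    rw [h.theta_eq _ hwpos, norm_mul, norm_mul, norm_neg, norm_I, one_mul]
    calc ‖(μ * u : ℂ) ^ (-(3 / 2) : ℂ)‖ * ‖theta κ χ (1 / (μ * u))‖
        ≤ (K ^ (3 / 2 : ℝ) * u ^ (-(3 / 2) : ℝ)) * (C₂ / (1 / (μ * u)).re ^ (N + 2)) := by
          gcongr
          exact h₂ _ hinvpos
      _ ≤ (K ^ (3 / 2 : ℝ) * u ^ (-(3 / 2) : ℝ)) * (C₂ / ((K ^ 3 * u)⁻¹) ^ (N + 2)) := by gcongr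
      _ = D * (u ^ (-(3 / 2) : ℝ) * u ^ (N + 2)) := by
          simp only [D]; rw [inv_pow, div_inv_eq_mul, mul_pow, ← pow_mul]; ring
      _ ≤ D * u ^ N := by gcongr
      _ ≤ D * (2 * (u ^ N / (1 + u ^ 2))) := by
          gcongr
          rw [← mul_div_assoc, le_div_iff₀ (by positivity)]
          nlinarith [pow_pos hu N, pow_le_one₀ hu.le hu1 (n := 2)]
      _ ≤ _ := by
          have : 0 ≤ u ^ N / (1 + u ^ 2) := by positivity
          nlinarith [mul_nonneg (mul_nonneg hC₁ (sq_nonneg K)) this]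

end FalseTheta

/-! ### Integrals of theta series against a square-root kernel -/

namespace FalseTheta

open Complex MeasureTheory Set

/-- An integral of holomorphic functions with a locally uniform integrable majorant is holomorphic. -/
lemma differentiableOn_integral_of_dominated {U : Set ℂ} (hU : IsOpen U) {f : ℂ → ℝ → ℂ} {S : Set ℝ}
    (hS : MeasurableSet S) (hmeas : ∀ z ∈ U, AEStronglyMeasurable (f z) (volume.restrict S))
    (hdiff : ∀ u ∈ S, DifferentiableOn ℂ (fun z => f z u) U)
    (hb : ∀ z₀ ∈ U, ∃ g : ℝ → ℝ, IntegrableOn g S ∧ ∀ᶠ z in 𝓝 z₀, ∀ u ∈ S, ‖f z u‖ ≤ g u) :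
    DifferentiableOn ℂ (fun z => ∫ u in S, f z u) U := by
  intro z₀ hz₀
  obtain ⟨g, hg, hfg⟩ := hb z₀ hz₀
  obtain ⟨R, hR, hball⟩ := Metric.eventually_nhds_iff_ball.1 (hfg.and (hU.eventually_mem hz₀))
  set r := R / 3 with hr
  have hr0 : 0 < r := by positivity
  have hsub : ∀ z ∈ Metric.ball z₀ r, Metric.closedBall z r ⊆ Metric.ball z₀ R := by
    intro z hz w hw
    have h1 := Metric.mem_ball.1 hz
    have h2 := Metric.mem_closedBall.1 hw
    have h3 := dist_triangle w z z₀
    rw [Metric.mem_ball]; linarith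
  have hself : ∀ z ∈ Metric.ball z₀ r, z ∈ Metric.ball z₀ R := fun z hz =>
    hsub z hz (Metric.mem_closedBall_self hr0.le)
  have hda : ∀ u ∈ S, ∀ z ∈ Metric.ball z₀ r, HasDerivAt (fun z => f z u)
      (deriv (fun z => f z u) z) z := fun u hu z hz =>
    ((hdiff u hu).differentiableAt (hU.mem_nhds (hball z (hself z hz)).2)).hasDerivAt
  have hz₀r : z₀ ∈ Metric.ball z₀ r := Metric.mem_ball_self hr0
  refine ((hasDerivAt_integral_of_dominated_loc_of_deriv_le (𝕜 := ℂ) (μ := volume.restrict S)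
    (F := f) (F' := fun z u => deriv (fun z => f z u) z) (bound := fun u => g u / r)
    (Metric.ball_mem_nhds z₀ hr0) ?_ ?_ ?_ ?_ (hg.div_const r) ?_).2).differentiableAt.differentiableWithinAt
  · filter_upwards [hU.eventually_mem hz₀] with z hz using hmeas z hz
  · refine Integrable.mono' hg (hmeas z₀ hz₀) ((ae_restrict_iff' hS).2 (Eventually.of_forall ?_))
    exact (hball z₀ (hself z₀ hz₀r)).1
  · refine aestronglyMeasurable_of_tendsto_ae atTop
      (f := fun (n : ℕ) u => ((r / (n + 2) : ℝ) : ℂ)⁻¹ * (f (z₀ + (r / (n + 2) : ℝ)) u - f z₀ u))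
      (fun n => ?_) ((ae_restrict_iff' hS).2 (Eventually.of_forall fun u hu => ?_))
    · refine ((hmeas _ (hball _ (hself _ ?_)).2).sub (hmeas _ hz₀)).const_mul _
      rw [Metric.mem_ball, dist_self_add_left, norm_real, Real.norm_of_nonneg (by positivity)]
      exact div_lt_self hr0 (by linarith [n.cast_nonneg (α := ℝ)])
    · have h1 := (hda u hu z₀ hz₀r).tendsto_slope_zero
      have h2 : Tendsto (fun n : ℕ => ((r / (n + 2) : ℝ) : ℂ)) atTop (𝓝[≠] 0) := by
        rw [tendsto_nhdsWithin_iff]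
        constructor
        · rw [← ofReal_zero]
          refine (continuous_ofReal.tendsto _).comp (tendsto_const_nhds.div_atTop ?_)
          exact tendsto_atTop_add_const_right _ _ tendsto_natCast_atTop_atTop
        · refine Eventually.of_forall fun n => ?_
          have : r / ((n : ℝ) + 2) ≠ 0 := by positivity
          simpa using ofReal_ne_zero.2 this
      exact h1.comp h2
  · refine (ae_restrict_iff' hS).2 (Eventually.of_forall fun u hu z hz => ?_)
    refine norm_deriv_le_of_forall_mem_sphere_norm_le hr0 ?_ fun w hw => ?_
    · refine DifferentiableOn.diffContOnCl ((hdiff u hu).mono ?_)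
      rw [closure_ball z hr0.ne']
      exact fun w hw => (hball w (hsub z hz hw)).2
    · exact (hball w (hsub z hz (Metric.sphere_subset_closedBall hw))).1 u hu
  · exact (ae_restrict_iff' hS).2 (Eventually.of_forall fun u hu z hz => hda u hu z hz)

lemma ofReal_mul_cpow {t : ℝ} (ht : 0 < t) (z a : ℂ) :
    ((t : ℂ) * z) ^ a = (t : ℂ) ^ a * z ^ a := by
  rcases eq_or_ne z 0 with rfl | hz
  · rcases eq_or_ne a 0 with rfl | ha
    · simp
    · simp [zero_cpow ha]
  have ht' : (t : ℂ) ≠ 0 := ofReal_ne_zero.2 ht.ne'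
  rw [cpow_def_of_ne_zero (mul_ne_zero ht' hz), cpow_def_of_ne_zero ht', cpow_def_of_ne_zero hz,
    log_ofReal_mul ht hz, ← Complex.exp_add, ← ofReal_log ht.le]
  ring_nf

lemma integral_Ioi_exp_neg_mul_cpow {r : ℂ} (hr : 0 < r.re) :
    ∫ v : ℝ in Ioi 0, cexp (-r * v) * (v : ℂ) ^ (-(1 / 2) : ℂ) = (Real.pi / r) ^ (1 / 2 : ℂ) := by
  rw [← integral_comp_rpow_Ioi_of_pos (p := 2) (by norm_num)]
  have h := integral_gaussian_complex_Ioi hr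
  have : (Real.pi / r) ^ (1 / 2 : ℂ) = 2 * ((Real.pi / r) ^ (1 / 2 : ℂ) / 2) := by ring
  rw [this, ← h, ← integral_const_mul]
  refine setIntegral_congr_fun measurableSet_Ioi fun x hx => ?_
  have hx : 0 < x := hx
  have e1 : x ^ (2 - 1 : ℝ) = x := by norm_num
  have e2 : (((x ^ (2 : ℝ) : ℝ)) : ℂ) ^ (-(1 / 2) : ℂ) = (x : ℂ)⁻¹ := by
    have : (-(1 / 2) : ℂ) = ((-(1 / 2) : ℝ) : ℂ) := by push_cast; ring
    rw [this, ← ofReal_cpow (by positivity), ← Real.rpow_mul hx.le, ← ofReal_inv]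
    norm_num [Real.rpow_neg hx.le]
  have e3 : x ^ (2 : ℝ) = x ^ 2 := by exact_mod_cast Real.rpow_natCast x 2
  simp only [e2, e1]
  rw [e3, real_smul]
  have : (x : ℂ) ≠ 0 := ofReal_ne_zero.2 hx.ne'
  push_cast
  field_simp

lemma integrableOn_exp_neg_mul_rpow {r : ℝ} (hr : 0 < r) :
    IntegrableOn (fun v : ℝ => Real.exp (-r * v) * v ^ (-(1 / 2) : ℝ)) (Ioi 0) := by
  have := integrableOn_rpow_mul_exp_neg_mul_rpow (p := 1) (s := -(1/2)) (b := r)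
    (by norm_num) (by norm_num) hr
  refine this.congr_fun (fun x hx => ?_) measurableSet_Ioi
  simp [mul_comm]

lemma integral_Ioi_add {E : Type*} [NormedAddCommGroup E] [NormedSpace ℝ E] (g : ℝ → E) (a : ℝ) :
    ∫ u in Ioi a, g u = ∫ v in Ioi 0, g (v + a) := by
  rw [← (measurePreserving_add_right volume a).setIntegral_preimage_emb
    (measurableEmbedding_addRight a)]
  simp

lemma div_cpow_half_of_pos {c : ℝ} (hc : 0 < c) {s : ℂ} (hs : 0 < s.re) :
    ((c : ℂ) / s) ^ (1 / 2 : ℂ) = (c : ℂ) ^ (1 / 2 : ℂ) * s ^ (-(1 / 2) : ℂ) := by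
  have hs' : s.arg ≠ Real.pi := by
    intro h; rw [arg_eq_pi_iff] at h; linarith [h.1]
  rw [div_eq_mul_inv, ofReal_mul_cpow hc, inv_cpow _ _ hs', cpow_neg]

/-- The part `u > 1` of the kernel integral reproduces the false theta series: this is the
Gamma integral applied to each summand. -/
lemma integral_Ioi_one_theta {κ : ℝ} (hκ : 0 < κ) {ψ : ℕ → ℂ} (hψ : ∃ B, ∀ n, ‖ψ n‖ ≤ B)
    (h0 : ψ 0 = 0) {s : ℂ} (hs : 0 < s.re) :
    ∫ u : ℝ in Ioi 1, theta κ ψ (s * u) * ((u : ℂ) - 1) ^ (-(1 / 2) : ℂ) =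
      (Real.pi / κ : ℂ) ^ (1 / 2 : ℂ) * s ^ (-(1 / 2) : ℂ) * eichler κ ψ s := by
  rw [integral_Ioi_add]
  set F : ℕ → ℝ → ℂ := fun n v =>
    (n * ψ n * cexp (-(κ * n ^ 2 * s))) * (cexp (-(κ * n ^ 2 * s) * v) * (v : ℂ) ^ (-(1 / 2) : ℂ))
    with hF
  have hre : ∀ n : ℕ, (κ * n ^ 2 * s : ℂ).re = κ * n ^ 2 * s.re := fun n => by
    have : (κ * n ^ 2 * s : ℂ) = ((κ * n ^ 2 : ℝ) : ℂ) * s := by push_cast; ring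
    rw [this, re_ofReal_mul]
  have hnorm : ∀ (n : ℕ) (v : ℝ), v ∈ Ioi (0 : ℝ) → ‖F n v‖ =
      ‖n * ψ n * cexp (-(κ * n ^ 2 * s))‖ *
        (Real.exp (-(κ * n ^ 2 * s.re) * v) * v ^ (-(1 / 2) : ℝ)) := by
    intro n v hv
    have hv : 0 < v := hv
    have : (-(1 / 2) : ℂ) = ((-(1 / 2) : ℝ) : ℂ) := by push_cast; ring
    rw [hF, norm_mul, norm_mul (cexp _), this, norm_cpow_real, norm_real, Real.norm_of_nonneg hv.le,
      Complex.norm_exp, re_mul_ofReal, neg_re, hre]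
  have hint : ∀ n, Integrable (F n) (volume.restrict (Ioi 0)) := by
    intro n
    rcases Nat.eq_zero_or_pos n with rfl | hn
    · simp [hF]
    have hr : 0 < κ * (n : ℝ) ^ 2 * s.re := by positivity
    refine Integrable.mono' ((integrableOn_exp_neg_mul_rpow hr).const_mul
      ‖n * ψ n * cexp (-(κ * n ^ 2 * s))‖) ?_ ?_
    · refine ContinuousOn.aestronglyMeasurable ?_ measurableSet_Ioi
      refine ContinuousOn.mul continuousOn_const (ContinuousOn.mul (by fun_prop) ?_)
      exact ContinuousOn.cpow_const (by fun_prop) fun v hv => ofReal_mem_slitPlane.2 hv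
    · exact (ae_restrict_iff' measurableSet_Ioi).2
        (Eventually.of_forall fun v hv => (hnorm n v hv).le)
  have hval : ∀ n, ∫ v in Ioi 0, F n v = (Real.pi / κ : ℂ) ^ (1 / 2 : ℂ) * s ^ (-(1 / 2) : ℂ) *
      (ψ n * cexp (-(κ * n ^ 2 * s))) := by
    intro n
    rcases Nat.eq_zero_or_pos n with rfl | hn
    · simp [hF, h0]
    have hr : 0 < κ * (n : ℝ) ^ 2 * s.re := by positivity
    have hn' : (n : ℂ) ≠ 0 := by exact_mod_cast hn.ne'
    simp only [hF]
    rw [integral_const_mul, integral_Ioi_exp_neg_mul_cpow (by rw [hre]; exact hr)]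
    have e : (Real.pi / (κ * n ^ 2 * s) : ℂ) =
        (((n : ℝ) ^ 2)⁻¹ : ℝ) * (((Real.pi / κ : ℝ) : ℂ) / s) := by
      push_cast; field_simp
    have e2 : ((((n : ℝ) ^ 2)⁻¹ : ℝ) : ℂ) ^ (1 / 2 : ℂ) = (n : ℂ)⁻¹ := by
      have : (1 / 2 : ℂ) = ((1 / 2 : ℝ) : ℂ) := by push_cast; ring
      rw [this, ← ofReal_cpow (by positivity), Real.inv_rpow (by positivity), ← Real.rpow_natCast,
        ← Real.rpow_mul (by positivity)]
      norm_num
    rw [e, ofReal_mul_cpow (by positivity), e2,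
      div_cpow_half_of_pos (by have := Real.pi_pos; positivity) hs]
    push_cast
    field_simp
  have hsum : Summable fun n => ∫ v in Ioi 0, ‖F n v‖ := by
    have h1 : ∀ n, ∫ v in Ioi 0, ‖F n v‖ =
        ‖n * ψ n * cexp (-(κ * n ^ 2 * s))‖ * ∫ v in Ioi (0 : ℝ),
          (Real.exp (-(κ * n ^ 2 * s.re) * v) * v ^ (-(1 / 2) : ℝ)) := by
      intro n
      rw [← integral_const_mul]
      exact setIntegral_congr_fun measurableSet_Ioi fun v hv => hnorm n v hv
    refine Summable.of_nonneg_of_le (fun n => integral_nonneg fun v => norm_nonneg _) (fun n => ?_)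
      ((summable_theta hκ hψ hs).norm.mul_right (∫ v in Ioi (0 : ℝ),
          (Real.exp (-(κ * s.re) * v) * v ^ (-(1 / 2) : ℝ))))
    rcases Nat.eq_zero_or_pos n with rfl | hn
    · simp [hF]
    have hn1 : (1 : ℝ) ≤ n := by exact_mod_cast hn
    have hr : 0 < κ * (n : ℝ) ^ 2 * s.re := by positivity
    rw [h1]
    refine mul_le_mul_of_nonneg_left (setIntegral_mono_on (integrableOn_exp_neg_mul_rpow hr)
      (integrableOn_exp_neg_mul_rpow (by positivity)) measurableSet_Ioi fun v hv => ?_)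
      (norm_nonneg _)
    have hv : 0 < v := hv
    gcongr
    exact le_mul_of_one_le_right hκ.le (one_le_pow₀ hn1)
  have hfin := (hasSum_integral_of_summable_integral_norm hint hsum).tsum_eq
  simp only [hval] at hfin
  rw [tsum_mul_left] at hfin
  rw [eichler, hfin]
  refine setIntegral_congr_fun measurableSet_Ioi fun v hv => ?_
  have hv : 0 < v := hv
  simp only [hF, theta]
  rw [← tsum_mul_right]
  refine tsum_congr fun n => ?_
  have : ((v + 1 : ℝ) : ℂ) - 1 = v := by push_cast; ring
  rw [this]
  have : cexp (-(κ * n ^ 2 * (s * ((v + 1 : ℝ) : ℂ)))) =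
      cexp (-(κ * n ^ 2 * s)) * cexp (-(κ * n ^ 2 * s) * v) := by
    rw [← Complex.exp_add]; congr 1; push_cast; ring
  rw [this]; ring

lemma neg_ofReal_cpow_neg_half {x : ℝ} (hx : 0 < x) :
    (-(x : ℂ)) ^ (-(1 / 2) : ℂ) = -I * (x : ℂ) ^ (-(1 / 2) : ℂ) := by
  have hx' : (x : ℂ) ≠ 0 := ofReal_ne_zero.2 hx.ne'
  rw [cpow_def_of_ne_zero (neg_ne_zero.2 hx'), cpow_def_of_ne_zero hx', ← ofReal_neg, log, log,
    arg_ofReal_of_neg (by linarith), arg_ofReal_of_nonneg hx.le, norm_real, norm_real, norm_neg,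
    add_mul, Complex.exp_add]
  have : cexp (Real.pi * I * (-(1 / 2))) = -I := by
    have : (Real.pi * I * (-(1 / 2)) : ℂ) = -(Real.pi / 2 * I) := by ring
    rw [this, Complex.exp_neg, Complex.exp_pi_div_two_mul_I, inv_I]
  rw [this]; simp; ring

/-- The part `u < 1` of the kernel integral is carried by `u ↦ 1/u` to the one for the dual series. -/
lemma IsThetaPair.integral_Ioo_theta {κ : ℝ} {ψ χ : ℕ → ℂ} (h : IsThetaPair κ ψ χ) {s : ℂ}
    (hs : 0 < s.re) :
    ∫ u : ℝ in Ioo 0 1, theta κ ψ (s * u) * ((u : ℂ) - 1) ^ (-(1 / 2) : ℂ) =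
      -((Real.pi / κ : ℂ) ^ (1 / 2 : ℂ) * s⁻¹ * eichler κ χ (1 / s)) := by
  have himg : Ioo (0 : ℝ) 1 = (fun v : ℝ => v⁻¹) '' Ioi 1 := by
    rw [image_inv_eq_inv, inv_Ioi₀ one_pos, inv_one]
  have hs0 : s ≠ 0 := fun h0 => by simp [h0] at hs
  have hs1 : 0 < (1 / s).re := by
    rw [one_div, inv_re]; exact div_pos hs (normSq_pos.2 hs0)
  rw [himg, integral_image_eq_integral_abs_deriv_smul measurableSet_Ioi
    (f' := fun v => -(v ^ 2)⁻¹) (fun v hv => (hasDerivAt_inv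
      (ne_of_gt (lt_trans one_pos hv))).hasDerivWithinAt) inv_injective.injOn]
  have key := integral_Ioi_one_theta h.pos h.right_bdd h.right_zero hs1
  have e1 : ∀ v ∈ Ioi (1 : ℝ), |-(v ^ 2)⁻¹| • (theta κ ψ (s * ((v⁻¹ : ℝ) : ℂ)) *
      (((v⁻¹ : ℝ) : ℂ) - 1) ^ (-(1 / 2) : ℂ)) =
      (-s ^ (-(3 / 2) : ℂ)) * (theta κ χ (1 / s * v) * ((v : ℂ) - 1) ^ (-(1 / 2) : ℂ)) := by
    intro v hv
    have hv1 : 1 < v := hv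
    have hv0 : 0 < v := by linarith
    have hvC : (v : ℂ) ≠ 0 := ofReal_ne_zero.2 hv0.ne'
    have hvi : 0 < v⁻¹ := by positivity
    have hre : 0 < (s * ((v⁻¹ : ℝ) : ℂ)).re := by rw [re_mul_ofReal]; positivity
    rw [h.theta_eq _ hre, mul_comm s, ofReal_mul_cpow hvi]
    have e2 : ((v⁻¹ : ℝ) : ℂ) - 1 = ((v⁻¹ : ℝ) : ℂ) * (-((v - 1 : ℝ) : ℂ)) := by
      push_cast; field_simp; ring
    have e3 : (1 / (((v⁻¹ : ℝ) : ℂ) * s)) = 1 / s * v := by push_cast; field_simp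
    rw [e2, ofReal_mul_cpow hvi, neg_ofReal_cpow_neg_half (by linarith), e3, abs_neg,
      abs_of_pos (by positivity), real_smul]
    have e4 : ((v⁻¹ : ℝ) : ℂ) ^ (-(3 / 2) : ℂ) * ((v⁻¹ : ℝ) : ℂ) ^ (-(1 / 2) : ℂ) = (v : ℂ) ^ 2 := by
      rw [← cpow_add _ _ (ofReal_ne_zero.2 hvi.ne')]
      norm_num [cpow_neg]
    have e5 : (((v ^ 2)⁻¹ : ℝ) : ℂ) = ((v : ℂ) ^ 2)⁻¹ := by push_cast; rfl
    have e6 : ((v - 1 : ℝ) : ℂ) = (v : ℂ) - 1 := by push_cast; rfl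
    rw [e5, e6]
    calc _ = ((v : ℂ) ^ 2)⁻¹ * (((v⁻¹ : ℝ) : ℂ) ^ (-(3 / 2) : ℂ) * ((v⁻¹ : ℝ) : ℂ) ^ (-(1 / 2) : ℂ))
          * (I * I) * s ^ (-(3 / 2) : ℂ) * (theta κ χ (1 / s * v) *
            ((v : ℂ) - 1) ^ (-(1 / 2) : ℂ)) := by ring
      _ = _ := by rw [e4, I_mul_I, inv_mul_cancel₀ (pow_ne_zero 2 hvC)]; ring
  rw [setIntegral_congr_fun measurableSet_Ioi e1, integral_const_mul, key]
  have hs' : s.arg ≠ Real.pi := by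
    intro h; rw [arg_eq_pi_iff] at h; linarith [h.1]
  have e7 : s ^ (-(3 / 2) : ℂ) * (1 / s) ^ (-(1 / 2) : ℂ) = s⁻¹ := by
    rw [one_div, inv_cpow _ _ hs', ← cpow_neg, ← cpow_add _ _ hs0]
    norm_num [cpow_neg]
  calc _ = -((Real.pi / κ : ℂ) ^ (1 / 2 : ℂ) * (s ^ (-(3 / 2) : ℂ) * (1 / s) ^ (-(1 / 2) : ℂ)) *
        eichler κ χ (1 / s)) := by ring
    _ = _ := by rw [e7]

end FalseTheta

/-! ### Rotating the ray of integration -/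

namespace FalseTheta

open Complex MeasureTheory Set

/-- The integral of `theta κ ψ w (w - s)^{-1/2}` over the ray through `μ`, with `w = μ u`. -/
noncomputable def rayIntegral (κ : ℝ) (ψ : ℕ → ℂ) (s μ : ℂ) : ℂ :=
  μ ^ (1 / 2 : ℂ) * ∫ u : ℝ in Ioi 0, theta κ ψ (μ * u) * ((u : ℂ) - s / μ) ^ (-(1 / 2) : ℂ)

/-- The directions in the right half-plane that lie on the left of the direction of `s`. -/
def leftOf (s : ℂ) : Set ℂ := {μ | 0 < μ.re ∧ (s / μ).im < 0}

lemma im_div_neg_iff {s μ : ℂ} (hμ : μ ≠ 0) : (s / μ).im < 0 ↔ s.im * μ.re - s.re * μ.im < 0 := by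
  have : (s / μ).im = (s.im * μ.re - s.re * μ.im) / normSq μ := by rw [div_im]; ring
  rw [this, div_neg_iff]
  have := normSq_pos.2 hμ
  constructor
  · rintro (h | h)
    · linarith [h.2]
    · exact h.1
  · exact fun h => Or.inr ⟨h, this⟩

lemma leftOf_eq (s : ℂ) : leftOf s = {μ | 0 < μ.re ∧ s.im * μ.re - s.re * μ.im < 0} := by
  ext μ
  refine and_congr_right fun h => im_div_neg_iff ?_
  rintro rfl
  simp at h

lemma isOpen_leftOf (s : ℂ) : IsOpen (leftOf s) := by
  rw [leftOf_eq]
  exact (isOpen_lt continuous_const continuous_re).inter (isOpen_lt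
    (f := fun μ : ℂ => s.im * μ.re - s.re * μ.im) (by fun_prop) continuous_const)

lemma convex_leftOf (s : ℂ) : Convex ℝ (leftOf s) := by
  rw [leftOf_eq]
  intro x hx y hy a b ha hb hab
  obtain ⟨h1, h2⟩ := hx
  obtain ⟨h3, h4⟩ := hy
  simp only [mem_ofPred_eq, add_re, add_im, real_smul, re_ofReal_mul, im_ofReal_mul]
  rcases ha.eq_or_lt with rfl | ha
  · have : b = 1 := by linarith
    subst this
    constructor <;> nlinarith
  · constructor
    · have := mul_pos ha h1
      have := mul_nonneg hb h3.le
      linarith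
    · have := mul_neg_of_pos_of_neg ha h2
      have := mul_nonpos_of_nonneg_of_nonpos hb h4.le
      nlinarith

lemma sub_mem_slitPlane {z : ℂ} (hz : z.im < 0) (u : ℝ) : (u : ℂ) - z ∈ slitPlane := by
  right; simp; exact hz.ne

lemma norm_cpow_neg_half (z : ℂ) : ‖z ^ (-(1 / 2) : ℂ)‖ = ‖z‖ ^ (-(1 / 2) : ℝ) := by
  have : (-(1 / 2) : ℂ) = ((-(1 / 2) : ℝ) : ℂ) := by push_cast; ring
  rw [this, norm_cpow_real]

lemma continuousOn_theta_ray {κ : ℝ} (hκ : 0 < κ) {ψ : ℕ → ℂ} (hψ : ∃ B, ∀ n, ‖ψ n‖ ≤ B) {μ : ℂ}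
    (hμ : 0 < μ.re) : ContinuousOn (fun u : ℝ => theta κ ψ (μ * u)) (Ioi 0) := by
  refine (differentiableOn_theta hκ hψ).continuousOn.comp (by fun_prop) fun u hu => ?_
  have hu : 0 < u := hu
  change 0 < (μ * u).re
  rw [re_mul_ofReal]; positivity

lemma integrableOn_pow_mul_inv {S : Set ℝ} :
    IntegrableOn (fun u : ℝ => u ^ 0 / (1 + u ^ 2)) S := by
  simpa using integrable_inv_one_add_sq.integrableOn (s := S)

lemma exists_ray_bound {μ : ℂ} (hμ : 0 < μ.re) :
    ∃ K : ℝ, 0 < K ∧ ∀ᶠ ν in 𝓝 μ, 1 ≤ K * ν.re ∧ ‖ν‖ ≤ K := by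
  refine ⟨max (2 / μ.re) (‖μ‖ + 1), by positivity, ?_⟩
  have h1 : ∀ᶠ ν in 𝓝 μ, μ.re / 2 < ν.re :=
    continuous_re.continuousAt.eventually (lt_mem_nhds (by linarith))
  have h2 : ∀ᶠ ν in 𝓝 μ, ‖ν‖ < ‖μ‖ + 1 :=
    continuous_norm.continuousAt.eventually (gt_mem_nhds (by linarith))
  filter_upwards [h1, h2] with ν h1 h2
  refine ⟨?_, h2.le.trans (le_max_right _ _)⟩
  calc (1 : ℝ) = 2 / μ.re * (μ.re / 2) := by field_simp
    _ ≤ max (2 / μ.re) (‖μ‖ + 1) * ν.re := by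
      gcongr
      exact le_max_left _ _

variable {κ : ℝ} {ψ χ : ℕ → ℂ}

lemma IsThetaPair.differentiableOn_rayIntegral (h : IsThetaPair κ ψ χ) (s : ℂ) :
    DifferentiableOn ℂ (rayIntegral κ ψ s) (leftOf s) := by
  have hre : ∀ μ ∈ leftOf s, μ ∈ slitPlane := fun μ hμ => Or.inl hμ.1
  have hne : ∀ μ ∈ leftOf s, μ ≠ 0 := fun μ hμ => slitPlane_ne_zero (hre μ hμ)
  refine DifferentiableOn.mul (fun μ hμ => ?_) ?_
  · exact (DifferentiableAt.cpow_const differentiableAt_id (hre μ hμ)).differentiableWithinAt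
  refine differentiableOn_integral_of_dominated (isOpen_leftOf s) measurableSet_Ioi ?_ ?_ ?_
  · intro μ hμ
    refine ContinuousOn.aestronglyMeasurable ?_ measurableSet_Ioi
    refine (continuousOn_theta_ray h.pos h.left_bdd hμ.1).mul ?_
    exact ContinuousOn.cpow_const (by fun_prop) fun u _ => sub_mem_slitPlane hμ.2 u
  · intro u hu
    have hu : 0 < u := hu
    refine DifferentiableOn.mul ?_ ?_
    · refine (differentiableOn_theta h.pos h.left_bdd).comp (by fun_prop) fun μ hμ => ?_
      change 0 < (μ * u).re
      rw [re_mul_ofReal]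
      exact mul_pos hμ.1 hu
    · intro μ hμ
      refine (DifferentiableAt.cpow_const (f := fun μ => (u : ℂ) - s / μ) ?_
        (sub_mem_slitPlane hμ.2 u)).differentiableWithinAt
      exact (differentiableAt_const _).sub
        ((differentiableAt_const _).div differentiableAt_id (hne μ hμ))
  · intro μ hμ
    obtain ⟨K, hK, hev⟩ := exists_ray_bound hμ.1
    obtain ⟨C, hC, hbd⟩ := h.exists_norm_theta_ray_le hK 0
    set δ := -(s / μ).im / 2 with hδ
    have hδ0 : 0 < δ := by have := hμ.2; rw [hδ]; linarith
    have h2 : ∀ᶠ ν in 𝓝 μ, (s / ν).im < -δ := by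
      have : ContinuousAt (fun ν => (s / ν).im) μ :=
        continuous_im.continuousAt.comp (continuousAt_const.div continuousAt_id (hne μ hμ))
      exact this.eventually (gt_mem_nhds (by rw [hδ]; linarith))
    refine ⟨fun u => C * (u ^ 0 / (1 + u ^ 2)) * δ ^ (-(1 / 2) : ℝ),
      (integrableOn_pow_mul_inv.const_mul C).mul_const _, ?_⟩
    filter_upwards [hev, h2] with ν hν hν2 u hu
    rw [norm_mul, norm_cpow_neg_half]
    refine mul_le_mul (hbd ν u hν.1 hν.2 hu) ?_ (by positivity) (by positivity)
    refine Real.rpow_le_rpow_of_nonpos hδ0 ?_ (by norm_num)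
    calc δ ≤ |((u : ℂ) - s / ν).im| := by
          simp only [sub_im, ofReal_im, zero_sub, abs_neg]
          rw [abs_of_neg (by linarith)]; linarith
      _ ≤ _ := abs_im_le_norm _

/-- Substituting `u ↦ t u` shows that only the direction of `μ` matters. -/
lemma rayIntegral_ofReal_mul (κ : ℝ) (ψ : ℕ → ℂ) (s μ : ℂ) {t : ℝ} (ht : 0 < t) :
    rayIntegral κ ψ s (t * μ) = rayIntegral κ ψ s μ := by
  have htC : (t : ℂ) ≠ 0 := ofReal_ne_zero.2 ht.ne'
  have h := integral_comp_mul_left_Ioi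
    (fun u : ℝ => theta κ ψ (μ * u) * (((t⁻¹ : ℝ) : ℂ) * ((u : ℂ) - s / μ)) ^ (-(1 / 2) : ℂ)) 0 ht
  rw [mul_zero] at h
  have e : ∀ u ∈ Ioi (0 : ℝ), theta κ ψ (t * μ * u) * ((u : ℂ) - s / (t * μ)) ^ (-(1 / 2) : ℂ) =
      theta κ ψ (μ * (t * u : ℝ)) *
        (((t⁻¹ : ℝ) : ℂ) * (((t * u : ℝ) : ℂ) - s / μ)) ^ (-(1 / 2) : ℂ) := by
    intro u _
    congr 2
    · push_cast; ring
    · rw [mul_comm (t : ℂ) μ, ← div_div]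
      push_cast
      field_simp
  rw [rayIntegral, setIntegral_congr_fun measurableSet_Ioi e, h, rayIntegral, ofReal_mul_cpow ht]
  have e2 : ∀ u : ℝ, theta κ ψ (μ * u) * (((t⁻¹ : ℝ) : ℂ) * ((u : ℂ) - s / μ)) ^ (-(1 / 2) : ℂ) =
      ((t⁻¹ : ℝ) : ℂ) ^ (-(1 / 2) : ℂ) * (theta κ ψ (μ * u) * ((u : ℂ) - s / μ) ^ (-(1 / 2) : ℂ)) := by
    intro u; rw [ofReal_mul_cpow (by positivity)]; ring
  simp only [e2]
  rw [integral_const_mul, real_smul]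
  have e3 : (t : ℂ) ^ (1 / 2 : ℂ) * (((t⁻¹ : ℝ) : ℂ) * ((t⁻¹ : ℝ) : ℂ) ^ (-(1 / 2) : ℂ)) = 1 := by
    have : (t : ℂ).arg ≠ Real.pi := by
      rw [arg_ofReal_of_nonneg ht.le]; exact Real.pi_ne_zero.symm
    rw [ofReal_inv, inv_cpow _ _ this, ← cpow_neg, mul_comm _ ((t : ℂ) ^ _), ← mul_assoc,
      ← cpow_add _ _ htC]
    norm_num [htC]
  calc _ = ((t : ℂ) ^ (1 / 2 : ℂ) * (((t⁻¹ : ℝ) : ℂ) * ((t⁻¹ : ℝ) : ℂ) ^ (-(1 / 2) : ℂ))) *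
        (μ ^ (1 / 2 : ℂ) * ∫ u : ℝ in Ioi 0, theta κ ψ (μ * u) *
          ((u : ℂ) - s / μ) ^ (-(1 / 2) : ℂ)) := by ring
    _ = _ := by rw [e3, one_mul]

/-- A holomorphic function that is constant along rays is locally constant. This replaces a contour
deformation. -/
lemma IsThetaPair.rayIntegral_eq (h : IsThetaPair κ ψ χ) {s μ ν : ℂ} (hμ : μ ∈ leftOf s)
    (hν : ν ∈ leftOf s) : rayIntegral κ ψ s μ = rayIntegral κ ψ s ν := by
  have hd := h.differentiableOn_rayIntegral s
  have hderiv : ∀ z ∈ leftOf s, deriv (rayIntegral κ ψ s) z = 0 := by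
    intro z hz
    have hz0 : z ≠ 0 := slitPlane_ne_zero (Or.inl hz.1)
    have h1 := (hd.differentiableAt ((isOpen_leftOf s).mem_nhds hz)).hasDerivAt
    have h2 : HasDerivAt (fun t : ℝ => (t : ℂ) * z) z 1 := by
      simpa using (hasDerivAt_id (1 : ℝ)).ofReal_comp.mul_const z
    have h3 : HasDerivAt (fun t : ℝ => rayIntegral κ ψ s (t * z))
        (deriv (rayIntegral κ ψ s) z * z) 1 := by
      have h1' : HasDerivAt (rayIntegral κ ψ s) (deriv (rayIntegral κ ψ s) z) (((1 : ℝ) : ℂ) * z) := by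
        simpa using h1
      exact h1'.comp (1 : ℝ) h2
    have h4 : HasDerivAt (fun t : ℝ => rayIntegral κ ψ s (t * z)) 0 1 := by
      refine (hasDerivAt_const (1 : ℝ) (rayIntegral κ ψ s z)).congr_of_eventuallyEq ?_
      filter_upwards [lt_mem_nhds (zero_lt_one (α := ℝ))] with t ht
      exact rayIntegral_ofReal_mul κ ψ s z ht
    have := h3.unique h4
    exact (mul_eq_zero.1 this).resolve_right hz0
  refine (convex_leftOf s).is_const_of_fderivWithin_eq_zero (𝕜 := ℂ) hd (fun z hz => ?_) hμ hν
  rw [fderivWithin_of_isOpen (isOpen_leftOf s) hz]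
  ext
  simp [hderiv z hz]

lemma integrableOn_inv_mul_sqrt_kernel :
    IntegrableOn (fun u : ℝ => u ^ 0 / (1 + u ^ 2) * ‖((u : ℂ) - 1) ^ (-(1 / 2) : ℂ)‖) (Ioi 0) := by
  have hm : Measurable fun u : ℝ => ‖((u : ℂ) - 1) ^ (-(1 / 2) : ℂ)‖ := by fun_prop
  have h2 : (Ioi 0 : Set ℝ) = Ioc 0 2 ∪ Ioi 2 := (Ioc_union_Ioi_eq_Ioi (by norm_num)).symm
  rw [h2]
  refine IntegrableOn.union ?_ ?_
  · have h3 : IntervalIntegrable (fun x : ℝ => (x : ℂ) ^ (-(1 / 2) : ℂ)) volume (-1) 1 :=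
      intervalIntegral.intervalIntegrable_cpow' (by norm_num)
    have h4 := h3.comp_sub_right 1
    have h5 : IntegrableOn (fun x : ℝ => ((x - 1 : ℝ) : ℂ) ^ (-(1 / 2) : ℂ)) (Ioc 0 2) := by
      rw [intervalIntegrable_iff_integrableOn_Ioc_of_le (by norm_num)] at h4
      norm_num at h4 ⊢
      exact h4
    refine Integrable.mono' h5.norm (by fun_prop) (Eventually.of_forall fun u => ?_)
    rw [Real.norm_of_nonneg (by positivity)]
    push_cast
    refine mul_le_of_le_one_left (norm_nonneg _) ?_
    rw [pow_zero]
    exact div_le_one_of_le₀ (by nlinarith [sq_nonneg u]) (by positivity)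
  · refine Integrable.mono' (integrableOn_pow_mul_inv (S := Ioi 2)) (by fun_prop)
      ((ae_restrict_iff' measurableSet_Ioi).2 (Eventually.of_forall fun u hu => ?_))
    have hu : 2 < u := hu
    rw [Real.norm_of_nonneg (by positivity)]
    refine mul_le_of_le_one_right (by positivity) ?_
    rw [norm_cpow_neg_half]
    refine Real.rpow_le_one_of_one_le_of_nonpos ?_ (by norm_num)
    have : (u : ℂ) - 1 = ((u - 1 : ℝ) : ℂ) := by push_cast; rfl
    rw [this, norm_real, Real.norm_of_nonneg (by linarith)]
    linarith

/-- The principal branch of `z^{-1/2}` is continuous up to the negative axis from above. -/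
lemma tendsto_cpow_neg_half_of_im_nonneg {α : Type*} {l : Filter α} {f : α → ℂ} {x : ℝ}
    (hx : x ≠ 0) (hf : Tendsto f l (𝓝 x)) (him : ∀ᶠ a in l, 0 ≤ (f a).im) :
    Tendsto (fun a => f a ^ (-(1 / 2) : ℂ)) l (𝓝 ((x : ℂ) ^ (-(1 / 2) : ℂ))) := by
  rcases lt_or_gt_of_ne hx with hneg | hpos
  · have hlog : Tendsto (fun a => log (f a)) l (𝓝 (log x)) := by
      have := continuousWithinAt_log_of_re_neg_of_im_zero (z := x) (by simpa using hneg) (by simp)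
      exact this.tendsto.comp (tendsto_nhdsWithin_iff.2 ⟨hf, him⟩)
    have h0 : ∀ᶠ a in l, f a ≠ 0 := hf.eventually_ne (ofReal_ne_zero.2 hx)
    rw [cpow_def_of_ne_zero (ofReal_ne_zero.2 hx)]
    refine ((continuous_exp.tendsto _).comp (hlog.mul_const _)).congr' ?_
    filter_upwards [h0] with a ha
    rw [cpow_def_of_ne_zero ha]; rfl
  · exact (continuousAt_cpow_const (ofReal_mem_slitPlane.2 hpos)).tendsto.comp hf

lemma IsThetaPair.integrableOn_boundary (h : IsThetaPair κ ψ χ) {s : ℂ} (hs : 0 < s.re) :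
    IntegrableOn (fun u : ℝ => theta κ ψ (s * u) * ((u : ℂ) - 1) ^ (-(1 / 2) : ℂ)) (Ioi 0) := by
  obtain ⟨K, hK, hev⟩ := exists_ray_bound hs
  obtain ⟨C, hC, hbd⟩ := h.exists_norm_theta_ray_le hK 0
  refine Integrable.mono' (integrableOn_inv_mul_sqrt_kernel.const_mul C) ?_
    ((ae_restrict_iff' measurableSet_Ioi).2 (Eventually.of_forall fun u hu => ?_))
  · refine AEStronglyMeasurable.mul ?_
      (Measurable.pow_const (by fun_prop) _).aestronglyMeasurable
    exact (continuousOn_theta_ray h.pos h.left_bdd hs).aestronglyMeasurable measurableSet_Ioi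
  · rw [norm_mul, ← mul_assoc]
    gcongr
    exact hbd s u hev.self_of_nhds.1 hev.self_of_nhds.2 hu

/-- The value of the kernel integral along the ray through `s` itself, where the kernel is taken from
the side on which `w - s` lies above the negative axis. -/
lemma IsThetaPair.integral_boundary (h : IsThetaPair κ ψ χ) {s : ℂ} (hs : 0 < s.re) :
    s ^ (1 / 2 : ℂ) * ∫ u : ℝ in Ioi 0, theta κ ψ (s * u) * ((u : ℂ) - 1) ^ (-(1 / 2) : ℂ) =
      (Real.pi / κ : ℂ) ^ (1 / 2 : ℂ) *
        (eichler κ ψ s - s ^ (-(1 / 2) : ℂ) * eichler κ χ (1 / s)) := by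
  have hs0 : s ≠ 0 := fun h0 => by simp [h0] at hs
  have hI := h.integrableOn_boundary hs
  have h1 : (Ioi 0 : Set ℝ) = Ioc 0 1 ∪ Ioi 1 := (Ioc_union_Ioi_eq_Ioi (by norm_num)).symm
  rw [h1, setIntegral_union (Ioc_disjoint_Ioi le_rfl) measurableSet_Ioi
    (hI.mono_set Ioc_subset_Ioi_self) (hI.mono_set (Ioi_subset_Ioi zero_le_one)),
    integral_Ioc_eq_integral_Ioo, h.integral_Ioo_theta hs,
    integral_Ioi_one_theta h.pos h.left_bdd h.left_zero hs]
  have e1 : s ^ (1 / 2 : ℂ) * s ^ (-(1 / 2) : ℂ) = 1 := by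
    rw [← cpow_add _ _ hs0]; norm_num
  have e2 : s ^ (1 / 2 : ℂ) * s⁻¹ = s ^ (-(1 / 2) : ℂ) := by
    rw [← cpow_neg_one, ← cpow_add _ _ hs0]; norm_num
  calc _ = (Real.pi / κ : ℂ) ^ (1 / 2 : ℂ) * ((s ^ (1 / 2 : ℂ) * s ^ (-(1 / 2) : ℂ)) *
        eichler κ ψ s - (s ^ (1 / 2 : ℂ) * s⁻¹) * eichler κ χ (1 / s)) := by ring
    _ = _ := by rw [e1, e2, one_mul]

/-- The kernel integral along any ray to the left of `s` equals the combination of false theta series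
at `s` and `1/s`. -/
theorem IsThetaPair.rayIntegral_eq_eichler (h : IsThetaPair κ ψ χ) {s μ : ℂ} (hs : 0 < s.re)
    (hμ : μ ∈ leftOf s) : rayIntegral κ ψ s μ = (Real.pi / κ : ℂ) ^ (1 / 2 : ℂ) *
        (eichler κ ψ s - s ^ (-(1 / 2) : ℂ) * eichler κ χ (1 / s)) := by
  rw [← h.integral_boundary hs]
  have hμ' := hμ
  rw [leftOf_eq] at hμ'
  obtain ⟨hμre, hμdet⟩ := hμ'
  have hμ0 : μ ≠ 0 := slitPlane_ne_zero (Or.inl hμre)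
  have hs0 : s ≠ 0 := slitPlane_ne_zero (Or.inl hs)
  -- the direction `s + ε μ` tends to that of `s`
  set ν : ℝ → ℂ := fun ε => s + ε * μ with hν
  have hνre : ∀ ε : ℝ, 0 < ε → 0 < (ν ε).re := fun ε hε => by
    simp only [hν, add_re, re_ofReal_mul]; positivity
  have hνmem : ∀ ε : ℝ, 0 < ε → ν ε ∈ leftOf s := by
    intro ε hε
    rw [leftOf_eq]
    refine ⟨hνre ε hε, ?_⟩
    simp only [hν, add_re, add_im, re_ofReal_mul, im_ofReal_mul]
    nlinarith [mul_neg_of_pos_of_neg hε hμdet]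
  have hνtend : Tendsto ν (𝓝[>] 0) (𝓝 s) := by
    have : Continuous ν := by fun_prop
    have h0 : ν 0 = s := by simp [hν]
    simpa [h0] using (this.tendsto 0).mono_left nhdsWithin_le_nhds
  have hconst : ∀ᶠ ε in 𝓝[>] (0 : ℝ), rayIntegral κ ψ s (ν ε) = rayIntegral κ ψ s μ := by
    filter_upwards [self_mem_nhdsWithin] with ε hε using h.rayIntegral_eq (hνmem ε hε) hμ
  refine tendsto_nhds_unique (tendsto_const_nhds.congr' (hconst.mono fun _ => Eq.symm)) ?_
  obtain ⟨K, hK, hev⟩ := exists_ray_bound hs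
  obtain ⟨C, hC, hbd⟩ := h.exists_norm_theta_ray_le hK 0
  set c : ℝ := -(s.im * μ.re - s.re * μ.im) / (K * ‖μ‖) with hc
  have hμn : 0 < ‖μ‖ := norm_pos_iff.2 hμ0
  have hc0 : 0 < c := div_pos (by linarith) (by positivity)
  refine Tendsto.mul ?_ ?_
  · exact (continuousAt_cpow_const (Or.inl hs)).tendsto.comp hνtend
  refine tendsto_integral_filter_of_dominated_convergence
    (fun u => C * c ^ (-(1 / 2) : ℝ) *
      (u ^ 0 / (1 + u ^ 2) * ‖((u : ℂ) - 1) ^ (-(1 / 2) : ℂ)‖)) ?_ ?_ ?_ ?_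
  · filter_upwards [self_mem_nhdsWithin] with ε hε
    refine AEStronglyMeasurable.mul ?_
      (Measurable.pow_const (by fun_prop) _).aestronglyMeasurable
    exact (continuousOn_theta_ray h.pos h.left_bdd (hνre ε hε)).aestronglyMeasurable
      measurableSet_Ioi
  · filter_upwards [self_mem_nhdsWithin, hνtend.eventually hev] with ε hε hK2
    have hε : 0 < ε := hε
    refine (ae_restrict_iff' measurableSet_Ioi).2 ?_
    have hne1 : ∀ᵐ u : ℝ, u ≠ 1 := by simp [ae_iff, measure_singleton]
    filter_upwards [hne1] with u hu1 hu
    have hν0 : ν ε ≠ 0 := slitPlane_ne_zero (Or.inl (hνre ε hε))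
    have hνn : 0 < ‖ν ε‖ := norm_pos_iff.2 hν0
    -- `Im ((u ν - s) μ̄) = (u - 1) Im (s μ̄)` bounds the kernel uniformly in `ε`
    have hlow : c * ‖(u : ℂ) - 1‖ ≤ ‖(u : ℂ) - s / ν ε‖ := by
      have e1 : (u : ℂ) - s / ν ε = (u * ν ε - s) / ν ε := by field_simp
      have e2 : ((u * ν ε - s) * (starRingEnd ℂ) μ).im =
          (u - 1) * (s.im * μ.re - s.re * μ.im) := by
        simp [hν]; ring
      have e3 : |u - 1| * (-(s.im * μ.re - s.re * μ.im)) ≤ ‖u * ν ε - s‖ * ‖μ‖ := by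
        rw [← abs_of_neg hμdet, ← abs_mul, ← e2, ← norm_conj μ, ← norm_mul]
        exact abs_im_le_norm _
      have e4 : ‖(u : ℂ) - 1‖ = |u - 1| := by
        rw [← Real.norm_eq_abs, ← norm_real]; push_cast; rfl
      rw [e1, norm_div, e4, le_div_iff₀ hνn]
      calc c * |u - 1| * ‖ν ε‖ ≤ c * |u - 1| * K := by gcongr; exact hK2.2
        _ = (|u - 1| * (-(s.im * μ.re - s.re * μ.im))) / ‖μ‖ := by rw [hc]; field_simp
        _ ≤ _ := by rw [div_le_iff₀ hμn]; exact e3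
    have hpos : 0 < ‖(u : ℂ) - 1‖ := by
      rw [norm_pos_iff, sub_ne_zero]; exact_mod_cast hu1
    rw [norm_mul, norm_cpow_neg_half, norm_cpow_neg_half]
    calc ‖theta κ ψ (ν ε * u)‖ * ‖(u : ℂ) - s / ν ε‖ ^ (-(1 / 2) : ℝ)
        ≤ C * (u ^ 0 / (1 + u ^ 2)) * (c * ‖(u : ℂ) - 1‖) ^ (-(1 / 2) : ℝ) := by
          refine mul_le_mul (hbd _ u hK2.1 hK2.2 hu) ?_ (by positivity) (by positivity)
          exact Real.rpow_le_rpow_of_nonpos (by positivity) hlow (by norm_num)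
      _ = _ := by rw [Real.mul_rpow hc0.le hpos.le]; ring
  · exact integrableOn_inv_mul_sqrt_kernel.const_mul _
  · refine (ae_restrict_iff' measurableSet_Ioi).2 ?_
    have hne1 : ∀ᵐ u : ℝ, u ≠ 1 := by simp [ae_iff, measure_singleton]
    filter_upwards [hne1] with u hu1 hu
    have hu : 0 < u := hu
    refine Tendsto.mul ?_ ?_
    · have hsu : 0 < (s * u).re := by rw [re_mul_ofReal]; positivity
      have : ContinuousAt (theta κ ψ) (s * u) :=
        ((differentiableOn_theta h.pos h.left_bdd).differentiableAt
          ((isOpen_lt continuous_const continuous_re).mem_nhds hsu)).continuousAt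
      exact this.tendsto.comp (hνtend.mul_const _)
    · have e : (u : ℂ) - 1 = ((u - 1 : ℝ) : ℂ) := by push_cast; rfl
      rw [e]
      refine tendsto_cpow_neg_half_of_im_nonneg (sub_ne_zero.2 hu1) ?_ ?_
      · have : Tendsto (fun ε => (u : ℂ) - s / ν ε) (𝓝[>] 0) (𝓝 (u - s / s)) :=
          tendsto_const_nhds.sub (tendsto_const_nhds.div hνtend hs0)
        rwa [div_self hs0, e] at this
      · filter_upwards [self_mem_nhdsWithin] with ε hε
        have := (hνmem ε hε).2
        simp only [sub_im, ofReal_im, zero_sub]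
        linarith

end FalseTheta

/-! ### Asymptotic expansion of false theta series, and the period integral -/

namespace FalseTheta

open Complex MeasureTheory Set

variable {κ : ℝ} {ψ χ : ℕ → ℂ}

lemma norm_ofReal_cpow_neg_half {u : ℝ} (hu : 0 < u) :
    ‖(u : ℂ) ^ (-(1 / 2) : ℂ)‖ ≤ 1 + u⁻¹ := by
  rw [norm_cpow_neg_half, norm_real, Real.norm_of_nonneg hu.le]
  rcases le_total 1 u with h | h
  · have := Real.rpow_le_one_of_one_le_of_nonpos h (by norm_num : (-(1 / 2) : ℝ) ≤ 0)
    have : 0 < u⁻¹ := by positivity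
    linarith
  · have := Real.rpow_le_rpow_of_exponent_ge hu h (by norm_num : (-1 : ℝ) ≤ -(1 / 2))
    rw [Real.rpow_neg_one] at this
    linarith

/-- All negative moments of the theta series along a ray have a common integrable majorant. -/
lemma IsThetaPair.exists_norm_theta_moment_le (h : IsThetaPair κ ψ χ) {μ : ℂ} (hμ : 0 < μ.re)
    (N : ℕ) : ∃ C, 0 ≤ C ∧ ∀ u : ℝ, 0 < u →
      ‖theta κ ψ (μ * u)‖ * (1 + u⁻¹) * (u⁻¹) ^ N ≤ C * (u ^ 0 / (1 + u ^ 2)) := by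
  obtain ⟨K, hK, hev⟩ := exists_ray_bound hμ
  obtain ⟨C₁, hC₁, h₁⟩ := h.exists_norm_theta_ray_le hK N
  obtain ⟨C₂, hC₂, h₂⟩ := h.exists_norm_theta_ray_le hK (N + 1)
  refine ⟨C₁ + C₂, by positivity, fun u hu => ?_⟩
  have e₁ := h₁ μ u hev.self_of_nhds.1 hev.self_of_nhds.2 hu
  have e₂ := h₂ μ u hev.self_of_nhds.1 hev.self_of_nhds.2 hu
  calc ‖theta κ ψ (μ * u)‖ * (1 + u⁻¹) * (u⁻¹) ^ N
      = ‖theta κ ψ (μ * u)‖ * (u⁻¹) ^ N + ‖theta κ ψ (μ * u)‖ * (u⁻¹) ^ (N + 1) := by ring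
    _ ≤ C₁ * (u ^ N / (1 + u ^ 2)) * (u⁻¹) ^ N +
        C₂ * (u ^ (N + 1) / (1 + u ^ 2)) * (u⁻¹) ^ (N + 1) := by gcongr
    _ = _ := by rw [inv_pow, inv_pow]; field_simp

/-- Taylor approximation of `(1 - y)^{-1/2}`, uniformly in a sector that avoids the cut. -/
lemma exists_taylor_one_sub_cpow : ∃ β : ℕ → ℂ, ∀ N, ∃ C, 0 ≤ C ∧ ∀ y : ℂ, y.re ≤ 3 * -y.im →
    ‖(1 - y) ^ (-(1 / 2) : ℂ) - ∑ r ∈ Finset.range N, β r * y ^ r‖ ≤ C * ‖y‖ ^ N := by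
  have han : AnalyticAt ℂ (fun y : ℂ => (1 - y) ^ (-(1 / 2) : ℂ)) 0 :=
    (analyticAt_const.sub analyticAt_id).cpow analyticAt_const (by simp)
  obtain ⟨p, hp⟩ := han
  refine ⟨p.coeff, fun N => ?_⟩
  have hO := hp.isBigO_sub_partialSum_pow N
  have hpart : ∀ y : ℂ, p.partialSum N y = ∑ r ∈ Finset.range N, p.coeff r * y ^ r := by
    intro y
    simp only [FormalMultilinearSeries.partialSum, FormalMultilinearSeries.apply_eq_pow_smul_coeff,
      smul_eq_mul]
    exact Finset.sum_congr rfl fun r _ => mul_comm _ _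
  simp only [zero_add, hpart] at hO
  obtain ⟨c, hc⟩ := hO.bound
  obtain ⟨ρ, hρ, hball⟩ := Metric.eventually_nhds_iff_ball.1 hc
  -- away from the origin both terms are bounded by a multiple of `‖y‖ ^ N`
  set D : ℝ := (1 / 6) ^ (-(1 / 2) : ℝ) * (ρ⁻¹) ^ N +
    ∑ r ∈ Finset.range N, ‖p.coeff r‖ * (ρ⁻¹) ^ (N - r) with hD
  have hD0 : 0 ≤ D := by positivity
  refine ⟨max c D, le_max_of_le_right hD0, fun y hy => ?_⟩
  rcases lt_or_ge ‖y‖ ρ with hlt | hge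
  · have := hball y (by simpa using hlt)
    rw [norm_pow, norm_norm] at this
    exact this.trans (by gcongr; exact le_max_left _ _)
  have hy0 : 0 < ‖y‖ := hρ.trans_le hge
  have hone : 1 ≤ ρ⁻¹ * ‖y‖ := by rw [inv_mul_eq_div, one_le_div hρ]; exact hge
  -- the sector has a positive distance from the point `1`
  have hlow : (1 / 6 : ℝ) ≤ ‖1 - y‖ := by
    rcases le_total y.re (1 / 2) with h1 | h1
    · calc (1 / 6 : ℝ) ≤ (1 - y).re := by simp; linarith
        _ ≤ _ := re_le_norm _
    · calc (1 / 6 : ℝ) ≤ |(1 - y).im| := by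
            simp only [sub_im, one_im, zero_sub]
            exact le_trans (by linarith) (le_abs_self _)
        _ ≤ _ := abs_im_le_norm _
  calc ‖(1 - y) ^ (-(1 / 2) : ℂ) - ∑ r ∈ Finset.range N, p.coeff r * y ^ r‖
      ≤ ‖(1 - y) ^ (-(1 / 2) : ℂ)‖ + ‖∑ r ∈ Finset.range N, p.coeff r * y ^ r‖ := norm_sub_le _ _
    _ ≤ (1 / 6) ^ (-(1 / 2) : ℝ) * (ρ⁻¹ * ‖y‖) ^ N +
        ∑ r ∈ Finset.range N, ‖p.coeff r‖ * (ρ⁻¹) ^ (N - r) * ‖y‖ ^ N := by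
        gcongr ?_ + ?_
        · rw [norm_cpow_neg_half]
          refine le_trans (Real.rpow_le_rpow_of_nonpos (by norm_num) hlow (by norm_num)) ?_
          exact le_mul_of_one_le_right (by positivity) (one_le_pow₀ hone)
        · refine (norm_sum_le _ _).trans (Finset.sum_le_sum fun r hr => ?_)
          have hr : r < N := Finset.mem_range.1 hr
          rw [norm_mul, norm_pow, mul_assoc]
          gcongr
          calc ‖y‖ ^ r ≤ (ρ⁻¹ * ‖y‖) ^ (N - r) * ‖y‖ ^ r :=
                le_mul_of_one_le_left (by positivity) (one_le_pow₀ hone)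
            _ = (ρ⁻¹) ^ (N - r) * (‖y‖ ^ (N - r) * ‖y‖ ^ r) := by rw [mul_pow, mul_assoc]
            _ = _ := by rw [← pow_add, Nat.sub_add_cancel hr.le]
    _ = D * ‖y‖ ^ N := by rw [hD, add_mul, mul_pow, Finset.sum_mul]; ring
    _ ≤ _ := by gcongr; exact le_max_right _ _

/-- A false theta series has an asymptotic expansion at `s = 0`, uniformly in a cone. -/
theorem IsThetaPair.exists_expansion (h : IsThetaPair κ ψ χ) :
    ∃ a : ℕ → ℂ, ∀ N, ∃ C, 0 ≤ C ∧ ∀ s : ℂ, 0 < s.re → |s.im| ≤ s.re / 2 → ‖s‖ ≤ 1 →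
      ‖eichler κ ψ s - ∑ r ∈ Finset.range N, a r * s ^ r‖ ≤ C * ‖s‖ ^ N := by
  obtain ⟨β, hβ⟩ := exists_taylor_one_sub_cpow
  -- along this ray `s / μ` has negative imaginary part for every `s` in the cone, and stays in a
  -- sector that avoids the ray of integration
  set μ : ℂ := 1 + I with hμ
  have hμre : 0 < μ.re := by simp [hμ]
  have hμ0 : μ ≠ 0 := slitPlane_ne_zero (Or.inl hμre)
  set c : ℂ := (Real.pi / κ : ℂ) ^ (1 / 2 : ℂ) with hc
  have hc0 : c ≠ 0 := by
    have hb : (Real.pi / κ : ℂ) ≠ 0 :=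
      div_ne_zero (ofReal_ne_zero.2 Real.pi_ne_zero) (ofReal_ne_zero.2 h.pos.ne')
    rw [hc, cpow_def_of_ne_zero hb]
    exact exp_ne_zero _
  -- the moments of the theta series along the ray
  set m : ℕ → ℝ → ℂ := fun r u => theta κ ψ (μ * u) * ((u : ℂ) ^ (-(1 / 2) : ℂ) * (u : ℂ)⁻¹ ^ r)
    with hm
  have hmeas : ∀ r, AEStronglyMeasurable (m r) (volume.restrict (Ioi 0)) := fun r =>
    ((continuousOn_theta_ray h.pos h.left_bdd hμre).aestronglyMeasurable measurableSet_Ioi).mul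
      (Measurable.aestronglyMeasurable (by fun_prop))
  have hmle : ∀ r, ∀ u ∈ Ioi (0 : ℝ), ‖m r u‖ ≤
      ‖theta κ ψ (μ * u)‖ * (1 + u⁻¹) * (u⁻¹) ^ r := by
    intro r u hu
    have hu : 0 < u := hu
    rw [hm, norm_mul, norm_mul, norm_pow, norm_inv, norm_real, Real.norm_of_nonneg hu.le, mul_assoc]
    gcongr
    exact norm_ofReal_cpow_neg_half hu
  have hmint : ∀ r, IntegrableOn (m r) (Ioi 0) := by
    intro r
    obtain ⟨C, hC, hb⟩ := h.exists_norm_theta_moment_le hμre r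
    exact Integrable.mono' (integrableOn_pow_mul_inv.const_mul C) (hmeas r)
      ((ae_restrict_iff' measurableSet_Ioi).2
        (Eventually.of_forall fun u hu => (hmle r u hu).trans (hb u hu)))
  refine ⟨fun r => c⁻¹ * μ ^ (1 / 2 : ℂ) * (β r * (∫ u in Ioi 0, m r u) * (μ⁻¹) ^ r), fun N => ?_⟩
  obtain ⟨C₁, hC₁, h₁⟩ := hβ N
  obtain ⟨C₂, hC₂, h₂⟩ := h.exists_norm_theta_moment_le hμre N
  obtain ⟨C₃, hC₃, h₃⟩ := exists_norm_eichler_le h.pos h.right_bdd h.right_zero (k := N + 2)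
    (by omega)
  set J : ℝ := ∫ u in Ioi (0 : ℝ), u ^ 0 / (1 + u ^ 2)
  have hJ : 0 ≤ J := setIntegral_nonneg measurableSet_Ioi fun u _ => by positivity
  refine ⟨‖c⁻¹ * μ ^ (1 / 2 : ℂ)‖ * (C₁ * ‖μ⁻¹‖ ^ N * C₂ * J) + C₃ * 2 ^ (N + 2), by positivity,
    fun s hs hcone hs1 => ?_⟩
  have hs0 : s ≠ 0 := slitPlane_ne_zero (Or.inl hs)
  have hsn : 0 < ‖s‖ := norm_pos_iff.2 hs0
  have hmem : μ ∈ leftOf s := by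
    rw [leftOf_eq]
    refine ⟨hμre, ?_⟩
    have := (abs_le.1 hcone).2
    simp [hμ]; linarith
  have hmain := h.rayIntegral_eq_eichler hs hmem
  have hE : eichler κ ψ s = c⁻¹ * rayIntegral κ ψ s μ + s ^ (-(1 / 2) : ℂ) * eichler κ χ (1 / s) := by
    rw [hmain]; field_simp; ring
  set z : ℂ := s * μ⁻¹ with hz
  have hzsec : z.re ≤ 3 * -z.im := by
    have hi : μ⁻¹ = (1 - I) / 2 := by
      refine inv_eq_of_mul_eq_one_right ?_
      rw [hμ]
      linear_combination (-(1 / 2) : ℂ) * I_mul_I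
    have h1 : z.re = (s.re + s.im) / 2 := by rw [hz, hi]; simp; ring
    have h2 : z.im = (s.im - s.re) / 2 := by rw [hz, hi]; simp; ring
    have := (abs_le.1 hcone).2
    rw [h1, h2]; linarith
  have hker : ∀ u ∈ Ioi (0 : ℝ), theta κ ψ (μ * u) * ((u : ℂ) - s / μ) ^ (-(1 / 2) : ℂ) =
      theta κ ψ (μ * u) * ((u : ℂ) ^ (-(1 / 2) : ℂ) * (1 - z * (u : ℂ)⁻¹) ^ (-(1 / 2) : ℂ)) := by
    intro u hu
    have hu : 0 < u := hu
    have huC : (u : ℂ) ≠ 0 := ofReal_ne_zero.2 hu.ne'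
    rw [← ofReal_mul_cpow hu]
    congr 2
    rw [hz]; field_simp
  have hsec : ∀ u : ℝ, 0 < u → (z * (u : ℂ)⁻¹).re ≤ 3 * -(z * (u : ℂ)⁻¹).im := by
    intro u hu
    rw [← ofReal_inv, re_mul_ofReal, im_mul_ofReal]
    have : 0 < u⁻¹ := by positivity
    nlinarith
  set R : ℝ → ℂ := fun u => theta κ ψ (μ * u) * ((u : ℂ) ^ (-(1 / 2) : ℂ) *
    ((1 - z * (u : ℂ)⁻¹) ^ (-(1 / 2) : ℂ) - ∑ r ∈ Finset.range N, β r * (z * (u : ℂ)⁻¹) ^ r)) with hR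
  have hRle : ∀ u ∈ Ioi (0 : ℝ), ‖R u‖ ≤ C₁ * ‖z‖ ^ N * C₂ * (u ^ 0 / (1 + u ^ 2)) := by
    intro u hu
    have hu : 0 < u := hu
    have e1 := h₁ _ (hsec u hu)
    rw [norm_mul z, mul_pow, norm_inv, norm_real, Real.norm_of_nonneg hu.le] at e1
    rw [hR, norm_mul, norm_mul]
    calc _ ≤ ‖theta κ ψ (μ * u)‖ * ((1 + u⁻¹) * (C₁ * (‖z‖ ^ N * (u⁻¹) ^ N))) := by
          gcongr
          exact norm_ofReal_cpow_neg_half hu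
      _ = C₁ * ‖z‖ ^ N * (‖theta κ ψ (μ * u)‖ * (1 + u⁻¹) * (u⁻¹) ^ N) := by ring
      _ ≤ C₁ * ‖z‖ ^ N * (C₂ * (u ^ 0 / (1 + u ^ 2))) :=
          mul_le_mul_of_nonneg_left (h₂ u hu) (by positivity)
      _ = _ := by ring
  have hRmeas : AEStronglyMeasurable R (volume.restrict (Ioi 0)) :=
    ((continuousOn_theta_ray h.pos h.left_bdd hμre).aestronglyMeasurable measurableSet_Ioi).mul
      (Measurable.aestronglyMeasurable (by fun_prop))
  have hRint : IntegrableOn R (Ioi 0) := Integrable.mono' (integrableOn_pow_mul_inv.const_mul _)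
    hRmeas ((ae_restrict_iff' measurableSet_Ioi).2 (Eventually.of_forall hRle))
  have hRJ : ‖∫ u in Ioi 0, R u‖ ≤ C₁ * ‖z‖ ^ N * C₂ * J := by
    rw [← integral_const_mul]
    exact norm_integral_le_of_norm_le (integrableOn_pow_mul_inv.const_mul _)
      ((ae_restrict_iff' measurableSet_Ioi).2 (Eventually.of_forall hRle))
  have hsplit : rayIntegral κ ψ s μ = μ ^ (1 / 2 : ℂ) * ((∫ u in Ioi 0, R u) +
      ∑ r ∈ Finset.range N, β r * (∫ u in Ioi 0, m r u) * z ^ r) := by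
    have e1 : ∀ u ∈ Ioi (0 : ℝ), theta κ ψ (μ * u) * ((u : ℂ) - s / μ) ^ (-(1 / 2) : ℂ) =
        R u + ∑ r ∈ Finset.range N, (β r * z ^ r) * m r u := by
      intro u hu
      rw [hker u hu, hR]
      simp only [hm, mul_sub, Finset.mul_sum]
      rw [sub_add_eq_add_sub, eq_comm, sub_eq_iff_eq_add]
      congr 1
      refine Finset.sum_congr rfl fun r _ => ?_
      rw [mul_pow]; ring
    rw [rayIntegral, setIntegral_congr_fun measurableSet_Ioi e1, integral_add hRint
      (integrable_finsetSum _ fun r _ => (hmint r).const_mul _),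
      integral_finsetSum _ fun r _ => (hmint r).const_mul _]
    congr 2
    refine Finset.sum_congr rfl fun r _ => ?_
    rw [integral_const_mul]; ring
  -- in the cone `Re (1/s) ≥ 1/(2‖s‖)`, so that the dual series decays faster than any power of `s`
  have hdual : ‖s ^ (-(1 / 2) : ℂ) * eichler κ χ (1 / s)‖ ≤ C₃ * 2 ^ (N + 2) * ‖s‖ ^ N := by
    have hre2 : ‖s‖ ≤ 2 * s.re := by
      have := norm_le_abs_re_add_abs_im s
      rw [abs_of_pos hs] at this
      linarith
    have hinv : (1 / s).re = s.re / ‖s‖ ^ 2 := by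
      rw [one_div, inv_re, normSq_eq_norm_sq]
    have hinvle : (2 * ‖s‖)⁻¹ ≤ (1 / s).re := by
      rw [hinv, inv_eq_one_div, div_le_div_iff₀ (by positivity) (by positivity)]
      nlinarith
    have hinvpos : 0 < (1 / s).re := lt_of_lt_of_le (by positivity) hinvle
    have hhalf : ‖s‖ ^ (-(1 / 2) : ℝ) * ‖s‖ ^ 2 ≤ 1 := by
      rw [← Real.rpow_natCast ‖s‖ 2, ← Real.rpow_add hsn]
      exact Real.rpow_le_one hsn.le hs1 (by norm_num)
    rw [norm_mul, norm_cpow_neg_half]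
    calc _ ≤ ‖s‖ ^ (-(1 / 2) : ℝ) * (C₃ / (1 / s).re ^ (N + 2)) := by
          gcongr
          exact h₃ _ hinvpos
      _ ≤ ‖s‖ ^ (-(1 / 2) : ℝ) * (C₃ / ((2 * ‖s‖)⁻¹) ^ (N + 2)) := by gcongr
      _ = C₃ * 2 ^ (N + 2) * ‖s‖ ^ N * (‖s‖ ^ (-(1 / 2) : ℝ) * ‖s‖ ^ 2) := by
          rw [inv_pow, div_inv_eq_mul, mul_pow]; ring
      _ ≤ _ := mul_le_of_le_one_right (by positivity) hhalf
  have hfin : eichler κ ψ s - ∑ r ∈ Finset.range N,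
      c⁻¹ * μ ^ (1 / 2 : ℂ) * (β r * (∫ u in Ioi 0, m r u) * (μ⁻¹) ^ r) * s ^ r =
      c⁻¹ * μ ^ (1 / 2 : ℂ) * (∫ u in Ioi 0, R u) + s ^ (-(1 / 2) : ℂ) * eichler κ χ (1 / s) := by
    rw [hE, hsplit, mul_add, mul_add, Finset.mul_sum, Finset.mul_sum]
    have : ∀ r ∈ Finset.range N,
        c⁻¹ * μ ^ (1 / 2 : ℂ) * (β r * (∫ u in Ioi 0, m r u) * (μ⁻¹) ^ r) * s ^ r =
        c⁻¹ * (μ ^ (1 / 2 : ℂ) * (β r * (∫ u in Ioi 0, m r u) * z ^ r)) := by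
      intro r _
      rw [hz, mul_pow]; ring
    rw [Finset.sum_congr rfl this]; ring
  rw [hfin]
  refine (norm_add_le _ _).trans ?_
  rw [add_mul]
  gcongr ?_ + ?_
  · rw [norm_mul, mul_assoc]
    gcongr
    calc _ ≤ C₁ * ‖z‖ ^ N * C₂ * J := hRJ
      _ = _ := by rw [hz, norm_mul, mul_pow]; ring

/-- The integral of the theta series over the positive axis against `(u - z)^{-1/2}`. -/
noncomputable def periodIntegral (κ : ℝ) (ψ : ℕ → ℂ) (z : ℂ) : ℂ :=
  ∫ u : ℝ in Ioi 0, theta κ ψ u * ((u : ℂ) - z) ^ (-(1 / 2) : ℂ)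

lemma IsThetaPair.exists_norm_theta_ofReal_moment_le (h : IsThetaPair κ ψ χ) (N : ℕ) :
    ∃ C, 0 ≤ C ∧ ∀ u : ℝ, 0 < u →
      ‖theta κ ψ u‖ * (1 + u⁻¹) * (u⁻¹) ^ N ≤ C * (u ^ 0 / (1 + u ^ 2)) := by
  simpa using h.exists_norm_theta_moment_le (μ := 1) (by simp) N

lemma IsThetaPair.continuousOn_theta_ofReal (h : IsThetaPair κ ψ χ) :
    ContinuousOn (fun u : ℝ => theta κ ψ u) (Ioi 0) := by
  simpa using continuousOn_theta_ray h.pos h.left_bdd (μ := 1) (by simp)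

lemma IsThetaPair.differentiableOn_periodIntegral (h : IsThetaPair κ ψ χ) :
    DifferentiableOn ℂ (periodIntegral κ ψ) {z | z.im ≠ 0} := by
  have hopen : IsOpen {z : ℂ | z.im ≠ 0} := isOpen_ne_fun continuous_im continuous_const
  have hsl : ∀ z ∈ {z : ℂ | z.im ≠ 0}, ∀ u : ℝ, (u : ℂ) - z ∈ slitPlane := by
    intro z hz u
    right
    simpa using hz
  refine differentiableOn_integral_of_dominated hopen measurableSet_Ioi ?_ ?_ ?_
  · intro z hz
    refine ContinuousOn.aestronglyMeasurable ?_ measurableSet_Ioi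
    refine h.continuousOn_theta_ofReal.mul ?_
    exact ContinuousOn.cpow_const (by fun_prop) fun u _ => hsl z hz u
  · intro u _ z hz
    refine ((differentiableAt_const _).mul ?_).differentiableWithinAt
    exact DifferentiableAt.cpow_const (by fun_prop) (hsl z hz u)
  · intro z hz
    obtain ⟨C, hC, hbd⟩ := h.exists_norm_theta_ofReal_moment_le 0
    have hz0 : 0 < |z.im| := abs_pos.2 hz
    have hev : ∀ᶠ ν in 𝓝 z, |z.im| / 2 < |ν.im| :=
      (continuous_abs.comp continuous_im).continuousAt.eventually
        (lt_mem_nhds (by change |z.im| / 2 < |z.im|; linarith))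
    refine ⟨fun u => C * (u ^ 0 / (1 + u ^ 2)) * (|z.im| / 2) ^ (-(1 / 2) : ℝ),
      (integrableOn_pow_mul_inv.const_mul C).mul_const _, ?_⟩
    filter_upwards [hev] with ν hν u hu
    have hu : 0 < u := hu
    have hui : 0 < u⁻¹ := by positivity
    rw [norm_mul, norm_cpow_neg_half]
    refine mul_le_mul (le_trans ?_ (hbd u hu)) ?_ (by positivity) (by positivity)
    · rw [pow_zero, mul_one]
      exact le_mul_of_one_le_right (norm_nonneg _) (by linarith)
    refine Real.rpow_le_rpow_of_nonpos (by positivity) ?_ (by norm_num)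
    calc |z.im| / 2 ≤ |((u : ℂ) - ν).im| := by
          simp only [sub_im, ofReal_im, zero_sub, abs_neg]; exact hν.le
      _ ≤ _ := abs_im_le_norm _

/-- Rapid decay of the theta series at both cusps makes its period integral smooth on the boundary
line, also at the cusp `X = 0` itself. -/
lemma IsThetaPair.contDiff_periodIntegral (h : IsThetaPair κ ψ χ) :
    ContDiff ℝ ∞ fun X : ℝ => periodIntegral κ ψ (-(I * X)) := by
  -- up to a constant factor the `k`-th derivative
  set G : ℕ → ℝ → ℂ := fun k X =>
    ∫ u : ℝ in Ioi 0, theta κ ψ u * ((u : ℂ) + I * X) ^ (-(1 / 2) - k : ℂ) with hG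
  have hsl : ∀ u ∈ Ioi (0 : ℝ), ∀ X : ℝ, (u : ℂ) + I * X ∈ slitPlane := by
    intro u hu X
    left
    simpa using hu
  have hmeas : ∀ (k : ℕ) (X : ℝ), AEStronglyMeasurable (fun u : ℝ => theta κ ψ u *
      ((u : ℂ) + I * X) ^ (-(1 / 2) - k : ℂ)) (volume.restrict (Ioi 0)) := fun k X =>
    (h.continuousOn_theta_ofReal.aestronglyMeasurable measurableSet_Ioi).mul
      (Measurable.pow_const (by fun_prop) _).aestronglyMeasurable
  have hbound : ∀ k : ℕ, ∃ C, 0 ≤ C ∧ ∀ u ∈ Ioi (0 : ℝ), ∀ X : ℝ,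
      ‖theta κ ψ u * ((u : ℂ) + I * X) ^ (-(1 / 2) - k : ℂ)‖ ≤ C * (u ^ 0 / (1 + u ^ 2)) := by
    intro k
    obtain ⟨C, hC, hbd⟩ := h.exists_norm_theta_ofReal_moment_le k
    refine ⟨C, hC, fun u hu X => le_trans ?_ (hbd u hu)⟩
    have hu' : 0 < u := hu
    have hle : u ≤ ‖(u : ℂ) + I * X‖ := by
      refine le_trans ?_ (re_le_norm _)
      simp
    rw [norm_mul, mul_assoc]
    gcongr
    rw [cpow_sub _ _ (slitPlane_ne_zero (hsl u hu X)), cpow_natCast, norm_div, norm_pow,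
      norm_cpow_neg_half, inv_pow, div_eq_mul_inv]
    gcongr
    refine le_trans ?_ (norm_ofReal_cpow_neg_half hu')
    rw [norm_cpow_neg_half, norm_real, Real.norm_of_nonneg hu'.le]
    exact Real.rpow_le_rpow_of_nonpos hu' hle (by norm_num)
  have hint : ∀ (k : ℕ) (X : ℝ), IntegrableOn (fun u : ℝ => theta κ ψ u *
      ((u : ℂ) + I * X) ^ (-(1 / 2) - k : ℂ)) (Ioi 0) := by
    intro k X
    obtain ⟨C, hC, hb⟩ := hbound k
    exact Integrable.mono' (integrableOn_pow_mul_inv.const_mul C) (hmeas k X)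
      ((ae_restrict_iff' measurableSet_Ioi).2 (Eventually.of_forall fun u hu => hb u hu X))
  have hder : ∀ (k : ℕ) (X : ℝ), HasDerivAt (G k) ((-(1 / 2) - k : ℂ) * I * G (k + 1) X) X := by
    intro k X
    obtain ⟨C, hC, hb⟩ := hbound (k + 1)
    have hd := (hasDerivAt_integral_of_dominated_loc_of_deriv_le (𝕜 := ℝ)
      (μ := volume.restrict (Ioi 0)) (s := univ)
      (F := fun (X : ℝ) (u : ℝ) => theta κ ψ u * ((u : ℂ) + I * X) ^ (-(1 / 2) - k : ℂ))
      (F' := fun X u => (-(1 / 2) - k : ℂ) * I *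
        (theta κ ψ u * ((u : ℂ) + I * X) ^ (-(1 / 2) - (k + 1 : ℕ) : ℂ)))
      (bound := fun u => ‖(-(1 / 2) - k : ℂ) * I‖ * (C * (u ^ 0 / (1 + u ^ 2)))) (x₀ := X)
      Filter.univ_mem (Eventually.of_forall fun Y => hmeas k Y) (hint k X)
      ((hmeas (k + 1) X).const_mul _) ?_ ((integrableOn_pow_mul_inv.const_mul C).const_mul _) ?_).2
    · rwa [integral_const_mul] at hd
    · refine (ae_restrict_iff' measurableSet_Ioi).2 (Eventually.of_forall fun u hu Y _ => ?_)
      rw [norm_mul]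
      gcongr
      exact hb u hu Y
    · refine (ae_restrict_iff' measurableSet_Ioi).2 (Eventually.of_forall fun u hu Y _ => ?_)
      have h1 : HasDerivAt (fun Y : ℝ => (u : ℂ) + I * Y) I Y := by
        simpa using ((hasDerivAt_id Y).ofReal_comp.const_mul I).const_add (u : ℂ)
      have h2 := (Complex.hasStrictDerivAt_cpow_const (c := (-(1 / 2) - k : ℂ))
        (hsl u hu Y)).hasDerivAt.comp Y h1
      have h3 := h2.const_mul (theta κ ψ u)
      refine h3.congr_deriv ?_
      have : (-(1 / 2) - (k : ℂ) - 1) = (-(1 / 2) - (k + 1 : ℕ) : ℂ) := by push_cast; ring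
      rw [this]; ring
  have hsmooth : ∀ n k : ℕ, ContDiff ℝ n (G k) := by
    intro n
    induction n with
    | zero =>
      intro k
      exact contDiff_zero.2 (continuous_iff_continuousAt.2 fun X => (hder k X).continuousAt)
    | succ n ih =>
      intro k
      have : ((n + 1 : ℕ) : WithTop ℕ∞) = (n : WithTop ℕ∞) + 1 := by push_cast; rfl
      rw [this, contDiff_succ_iff_deriv]
      refine ⟨fun X => (hder k X).differentiableAt, by simp, ?_⟩
      have : deriv (G k) = fun X => (-(1 / 2) - k : ℂ) * I * G (k + 1) X :=
        funext fun X => (hder k X).deriv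
      rw [this]
      exact contDiff_const.mul (ih (k + 1))
  have h0 : (fun X : ℝ => periodIntegral κ ψ (-(I * X))) = G 0 := by
    funext X
    simp only [periodIntegral, hG, sub_neg_eq_add, Nat.cast_zero, sub_zero]
  rw [h0]
  exact contDiff_infty.2 fun n => hsmooth n 0

/-- Complex conjugation of a theta pair. -/
lemma IsThetaPair.conj (h : IsThetaPair κ ψ χ) :
    IsThetaPair κ (fun n => (starRingEnd ℂ) (ψ n)) fun n => -(starRingEnd ℂ) (χ n) where
  pos := h.pos
  left_zero := by simp [h.left_zero]
  right_zero := by simp [h.right_zero]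
  left_bdd := by simpa using h.left_bdd
  right_bdd := by simpa using h.right_bdd
  theta_eq := by
    intro w hw
    have hconj : ∀ (φ : ℕ → ℂ) (z : ℂ), theta κ (fun n => (starRingEnd ℂ) (φ n)) z =
        (starRingEnd ℂ) (theta κ φ ((starRingEnd ℂ) z)) := by
      intro φ z
      simp only [theta]
      rw [conj_tsum]
      refine tsum_congr fun n => ?_
      rw [map_mul, map_mul, ← exp_conj]
      simp
    have hneg : ∀ (φ : ℕ → ℂ) (z : ℂ), theta κ (fun n => -φ n) z = -theta κ φ z := by
      intro φ z
      simp only [theta]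
      rw [← tsum_neg]
      exact tsum_congr fun n => by ring
    have harg : w.arg ≠ Real.pi := by
      intro h; rw [arg_eq_pi_iff] at h; linarith [h.1]
    rw [hneg, hconj, hconj, h.theta_eq _ (by simpa using hw), map_mul, map_mul, ← cpow_conj _ _ harg]
    have : (-(3 / 2) : ℂ) = ((-(3 / 2) : ℝ) : ℂ) := by push_cast; ring
    rw [this, conj_ofReal]
    simp

lemma conj_eichler (κ : ℝ) (ψ : ℕ → ℂ) (s : ℂ) :
    eichler κ (fun n => (starRingEnd ℂ) (ψ n)) ((starRingEnd ℂ) s) =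
      (starRingEnd ℂ) (eichler κ ψ s) := by
  simp only [eichler]
  rw [conj_tsum]
  refine tsum_congr fun n => ?_
  rw [map_mul, ← exp_conj]
  simp

lemma IsThetaPair.periodIntegral_of_im_neg (h : IsThetaPair κ ψ χ) {s : ℂ} (hs : 0 < s.re)
    (him : s.im < 0) : periodIntegral κ ψ s = (Real.pi / κ : ℂ) ^ (1 / 2 : ℂ) *
        (eichler κ ψ s - s ^ (-(1 / 2) : ℂ) * eichler κ χ (1 / s)) := by
  rw [← h.rayIntegral_eq_eichler hs (μ := 1) ⟨by simp, by simpa using him⟩]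
  simp [periodIntegral, rayIntegral]

lemma IsThetaPair.periodIntegral_of_im_pos (h : IsThetaPair κ ψ χ) {s : ℂ} (hs : 0 < s.re)
    (him : 0 < s.im) : periodIntegral κ ψ s = (Real.pi / κ : ℂ) ^ (1 / 2 : ℂ) *
        (eichler κ ψ s + s ^ (-(1 / 2) : ℂ) * eichler κ χ (1 / s)) := by
  have key := congrArg (starRingEnd ℂ) (h.conj.periodIntegral_of_im_neg
    (s := (starRingEnd ℂ) s) (by simpa using hs) (by simpa using him))
  have hneg : ∀ z, eichler κ (fun n => -(starRingEnd ℂ) (χ n)) z =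
      -eichler κ (fun n => (starRingEnd ℂ) (χ n)) z := by
    intro z
    simp only [eichler]
    rw [← tsum_neg]
    exact tsum_congr fun n => by ring
  have hL : (starRingEnd ℂ) (periodIntegral κ (fun n => (starRingEnd ℂ) (ψ n)) ((starRingEnd ℂ) s)) =
      periodIntegral κ ψ s := by
    simp only [periodIntegral]
    rw [← integral_conj]
    refine setIntegral_congr_fun measurableSet_Ioi fun u _ => ?_
    have harg : ((u : ℂ) - s).arg ≠ Real.pi := by
      intro h
      rw [arg_eq_pi_iff] at h
      have := h.2
      simp only [sub_im, ofReal_im, zero_sub, neg_eq_zero] at this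
      exact him.ne' this
    have e1 : theta κ (fun n => (starRingEnd ℂ) (ψ n)) u = (starRingEnd ℂ) (theta κ ψ u) := by
      simp only [theta]
      rw [conj_tsum]
      refine tsum_congr fun n => ?_
      rw [map_mul, map_mul, ← exp_conj]
      simp
    have e2 : (u : ℂ) - (starRingEnd ℂ) s = (starRingEnd ℂ) ((u : ℂ) - s) := by simp
    have e3 : (-(1 / 2) : ℂ) = (starRingEnd ℂ) (-(1 / 2) : ℂ) := by
      have : (-(1 / 2) : ℂ) = ((-(1 / 2) : ℝ) : ℂ) := by push_cast; ring
      rw [this, conj_ofReal]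
    rw [e1, e2, map_mul, conj_conj, conj_cpow _ _ harg, conj_conj, ← e3]
  have hc : (starRingEnd ℂ) ((Real.pi / κ : ℂ) ^ (1 / 2 : ℂ)) = (Real.pi / κ : ℂ) ^ (1 / 2 : ℂ) := by
    have h1 : (1 / 2 : ℂ) = ((1 / 2 : ℝ) : ℂ) := by push_cast; ring
    rw [h1, ← ofReal_div, ← ofReal_cpow (by have := h.pos; positivity), conj_ofReal]
  have hargs : s.arg ≠ Real.pi := by
    intro h
    rw [arg_eq_pi_iff] at h
    linarith [h.1]
  have e4 : ((starRingEnd ℂ) s) ^ (-(1 / 2) : ℂ) = (starRingEnd ℂ) (s ^ (-(1 / 2) : ℂ)) := by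
    have h1 : (-(1 / 2) : ℂ) = ((-(1 / 2) : ℝ) : ℂ) := by push_cast; ring
    rw [h1, conj_cpow _ _ hargs, conj_ofReal]
  have e5 : 1 / (starRingEnd ℂ) s = (starRingEnd ℂ) (1 / s) := by simp
  rw [hL, hneg, e4, e5, conj_eichler, conj_eichler] at key
  rw [key]
  simp only [map_mul, map_sub, map_neg, conj_conj, hc]
  ring

end FalseTheta

/-! ### Theta series with periodic coefficients -/

namespace FalseTheta

open Complex

section Periodic

lemma sum_range_add_one {f : ℤ → ℂ} {L : ℕ} (hf : ∀ n, f (n + L) = f n) :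
    ∑ a ∈ Finset.range L, f (a + 1) = ∑ a ∈ Finset.range L, f a := by
  have h1 := Finset.sum_range_succ (fun a : ℕ => f a) L
  have h2 := Finset.sum_range_succ' (fun a : ℕ => f a) L
  have h3 : f (L : ℤ) = f 0 := by simpa using hf 0
  rw [h1] at h2
  push_cast at h2
  rw [h3] at h2
  exact (add_right_cancel h2).symm

/-- A sum over a full period is invariant under shifts. -/
lemma sum_range_add {f : ℤ → ℂ} {L : ℕ} (hf : ∀ n, f (n + L) = f n) (t : ℤ) :
    ∑ a ∈ Finset.range L, f (a + t) = ∑ a ∈ Finset.range L, f a := by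
  induction t with
  | zero => simp
  | succ t ih =>
    rw [← ih, ← sum_range_add_one (f := fun n => f (n + t))
      (fun n => by rw [add_right_comm]; exact hf _)]
    exact Finset.sum_congr rfl fun a _ => by congr 1; ring
  | pred t ih =>
    rw [← ih, ← sum_range_add_one (f := fun n => f (n + (-t - 1)))
      (fun n => by rw [add_right_comm]; exact hf _)]
    exact Finset.sum_congr rfl fun a _ => by congr 1; ring

lemma periodic_mul {f : ℤ → ℂ} {L : ℕ} (hf : ∀ n, f (n + L) = f n) (n t : ℤ) :
    f (n + t * L) = f n := by
  have h : Function.Periodic f (L : ℤ) := hf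
  have := h.zsmul t n
  simpa using this

lemma hasSum_of_eq {f : ℤ → ℂ} {x y : ℂ} (h : HasSum f x) (e : x = y) : HasSum f y := e ▸ h

/-- Summation over residue classes. -/
lemma hasSum_of_residues {f : ℤ → ℂ} {L : ℕ} (hL : 0 < L) {g : ℕ → ℂ}
    (h : ∀ a < L, HasSum (fun k : ℤ => f (a + k * L)) (g a)) :
    HasSum f (∑ a ∈ Finset.range L, g a) := by
  have hLZ : (0 : ℤ) < L := by exact_mod_cast hL
  have h1 : ∀ a ∈ Finset.range L, HasSum (fun n : ℤ => if n % L = a then f n else 0) (g a) := by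
    intro a ha
    have ha : a < L := Finset.mem_range.1 ha
    have haZ : (a : ℤ) < L := by exact_mod_cast ha
    have hinj : Function.Injective fun k : ℤ => (a : ℤ) + k * L := fun k k' hk => by
      have : k * (L : ℤ) = k' * L := by simpa using hk
      exact mul_right_cancel₀ hLZ.ne' this
    rw [← hinj.hasSum_iff]
    · refine (h a ha).congr_fun fun k => ?_
      have : ((a : ℤ) + k * L) % L = a := by
        rw [Int.add_mul_emod_self_right, Int.emod_eq_of_lt (by positivity) haZ]
      simp [this]
    · intro n hn
      rw [if_neg]
      intro hmod
      exact hn ⟨n / L, by change (a : ℤ) + n / L * L = n; rw [← hmod]; exact Int.emod_add_ediv_mul n L⟩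
  refine (hasSum_sum h1).congr_fun fun n => ?_
  have hn0 : 0 ≤ n % L := Int.emod_nonneg _ hLZ.ne'
  have hnL : n % L < L := Int.emod_lt_of_pos _ hLZ
  rw [Finset.sum_eq_single (n % L).toNat]
  · rw [if_pos (Int.toNat_of_nonneg hn0).symm]
  · intro a _ ha
    rw [if_neg]
    intro h
    exact ha (by rw [h]; simp)
  · intro hnot
    exact absurd (Finset.mem_range.2 (by omega)) hnot

end Periodic

/-- The normalized finite Fourier transform of a function with period `L`. -/
noncomputable def dft (L : ℕ) (ψ : ℤ → ℂ) (m : ℤ) : ℂ :=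
  ((Real.sqrt L : ℝ) : ℂ)⁻¹ * ∑ a ∈ Finset.range L, ψ a * cexp (2 * Real.pi * I * (a * m / L))

section Poisson

variable {L : ℕ} {w : ℂ}

lemma im_I_mul_pos (hL : 0 < L) (hw : 0 < w.re) : 0 < (I * (L * w)).im := by
  have : (I * (L * w)).im = L * w.re := by simp
  rw [this]; positivity

lemma theta_exponent (hL : 0 < L) (a k : ℤ) (w : ℂ) :
    -(Real.pi / L * ((a + k * L : ℤ) : ℂ) ^ 2 * w) = -(Real.pi / L * (a : ℂ) ^ 2 * w) +
      (2 * Real.pi * I * k * (I * (a * w)) + Real.pi * I * k ^ 2 * (I * (L * w))) := by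
  have hL' : (L : ℂ) ≠ 0 := by exact_mod_cast hL.ne'
  push_cast
  field_simp
  ring_nf
  rw [I_sq]; ring

lemma transformed_args (hL : 0 < L) (hw : 0 < w.re) (a : ℤ) :
    I * (a * w) / (I * (L * w)) = a / L ∧ -1 / (I * (L * w)) = I * (1 / (L * w)) ∧
      -Real.pi * I * (I * (a * w)) ^ 2 / (I * (L * w)) = Real.pi / L * (a : ℂ) ^ 2 * w ∧
      -I * (I * (L * w)) = (L : ℝ) * w := by
  have hL' : (L : ℂ) ≠ 0 := by exact_mod_cast hL.ne'
  have hw' : w ≠ 0 := fun h => by simp [h] at hw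
  have hI := I_ne_zero
  refine ⟨by field_simp, ?_, ?_, ?_⟩
  · field_simp; rw [I_sq]
  · field_simp
    have : I ^ 2 = -1 := I_sq
    linear_combination (-(a : ℂ) ^ 2) * this
  · push_cast
    linear_combination (-(L * w : ℂ)) * I_mul_I

lemma dual_term (m a : ℤ) (L : ℕ) (w : ℂ) : jacobiTheta₂_term m (a / L) (I * (1 / (L * w))) =
    cexp (2 * Real.pi * I * (a * m / L)) * cexp (-(Real.pi / L * m ^ 2 * (1 / w))) := by
  rw [jacobiTheta₂_term, ← Complex.exp_add]
  congr 1
  have : (Real.pi * I * m ^ 2 * (I * (1 / (L * w))) : ℂ) =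
      (I * I) * (Real.pi / L * m ^ 2 * (1 / w)) := by
    rw [one_div, one_div, mul_inv]; ring
  rw [this, I_mul_I]
  ring

/-- Poisson summation over a residue class, even case. -/
lemma hasSum_residue_even (hL : 0 < L) (hw : 0 < w.re) (a : ℤ) :
    HasSum (fun k : ℤ => cexp (-(Real.pi / L * ((a + k * L : ℤ) : ℂ) ^ 2 * w)))
      (((L : ℝ) * w) ^ (-(1 / 2) : ℂ) * ∑' m : ℤ, cexp (2 * Real.pi * I * (a * m / L)) *
        cexp (-(Real.pi / L * m ^ 2 * (1 / w)))) := by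
  have h := (hasSum_jacobiTheta₂_term (I * (a * w)) (im_I_mul_pos hL hw)).mul_left
    (cexp (-(Real.pi / L * (a : ℂ) ^ 2 * w)))
  obtain ⟨h1, h2, h3, h4⟩ := transformed_args hL hw a
  rw [jacobiTheta₂_functional_equation, h1, h2, h3, h4] at h
  have e : ∀ k : ℤ, cexp (-(Real.pi / L * (a : ℂ) ^ 2 * w)) *
      jacobiTheta₂_term k (I * (a * w)) (I * (L * w)) =
      cexp (-(Real.pi / L * ((a + k * L : ℤ) : ℂ) ^ 2 * w)) := by
    intro k
    rw [jacobiTheta₂_term, ← Complex.exp_add, theta_exponent hL]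
  simp only [e] at h
  refine hasSum_of_eq h ?_
  have e2 : jacobiTheta₂ (a / L) (I * (1 / (L * w))) = ∑' m : ℤ,
      cexp (2 * Real.pi * I * (a * m / L)) * cexp (-(Real.pi / L * m ^ 2 * (1 / w))) :=
    tsum_congr fun m => dual_term m a L w
  rw [e2, cpow_neg, one_div (_ ^ _ : ℂ), Complex.exp_neg]
  field_simp

/-- Poisson summation over a residue class, odd case. -/
lemma hasSum_residue_odd (hL : 0 < L) (hw : 0 < w.re) (a : ℤ) :
    HasSum (fun k : ℤ => ((a + k * L : ℤ) : ℂ) *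
        cexp (-(Real.pi / L * ((a + k * L : ℤ) : ℂ) ^ 2 * w)))
      (-I * w ^ (-(3 / 2) : ℂ) * (((Real.sqrt L : ℝ) : ℂ)⁻¹ * ∑' m : ℤ,
        m * cexp (2 * Real.pi * I * (a * m / L)) * cexp (-(Real.pi / L * m ^ 2 * (1 / w))))) := by
  have hL' : (L : ℂ) ≠ 0 := by exact_mod_cast hL.ne'
  have hw' : w ≠ 0 := fun h => by simp [h] at hw
  have hpi : (Real.pi : ℂ) ≠ 0 := ofReal_ne_zero.2 Real.pi_ne_zero
  have hI := I_ne_zero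
  have h0 := ((hasSum_jacobiTheta₂_term (I * (a * w)) (im_I_mul_pos hL hw)).mul_left (a : ℂ)).add
    ((hasSum_jacobiTheta₂'_term (I * (a * w)) (im_I_mul_pos hL hw)).mul_left
      (L / (2 * Real.pi * I) : ℂ))
  have h := h0.mul_left (cexp (-(Real.pi / L * (a : ℂ) ^ 2 * w)))
  obtain ⟨h1, h2, h3, h4⟩ := transformed_args hL hw a
  rw [jacobiTheta₂_functional_equation, jacobiTheta₂'_functional_equation, h1, h2, h3, h4] at h
  have e : ∀ k : ℤ, cexp (-(Real.pi / L * (a : ℂ) ^ 2 * w)) *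
      ((a : ℂ) * jacobiTheta₂_term k (I * (a * w)) (I * (L * w)) +
        L / (2 * Real.pi * I) * jacobiTheta₂'_term k (I * (a * w)) (I * (L * w))) =
      ((a + k * L : ℤ) : ℂ) * cexp (-(Real.pi / L * ((a + k * L : ℤ) : ℂ) ^ 2 * w)) := by
    intro k
    rw [theta_exponent hL, Complex.exp_add, jacobiTheta₂'_term, jacobiTheta₂_term]
    push_cast
    field_simp
  simp only [e] at h
  refine hasSum_of_eq h ?_
  have e2 : jacobiTheta₂' (a / L) (I * (1 / (L * w))) = 2 * Real.pi * I * ∑' m : ℤ,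
      m * cexp (2 * Real.pi * I * (a * m / L)) * cexp (-(Real.pi / L * m ^ 2 * (1 / w))) := by
    rw [← tsum_mul_left]
    refine tsum_congr fun m => ?_
    rw [jacobiTheta₂'_term, dual_term]; ring
  have e3 : (1 : ℂ) / ((L : ℝ) * w) ^ (1 / 2 : ℂ) =
      ((Real.sqrt L : ℝ) : ℂ)⁻¹ * (w ^ (-(3 / 2) : ℂ) * w) := by
    have : w ^ (-(3 / 2) : ℂ) * w = w ^ (-(1 / 2) : ℂ) := by
      nth_rewrite 2 [← cpow_one w]
      rw [← cpow_add _ _ hw']; norm_num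
    rw [this, one_div, ← cpow_neg, ofReal_mul_cpow (by exact_mod_cast hL)]
    congr 1
    have h5 : (-(1 / 2) : ℂ) = ((-(1 / 2) : ℝ) : ℂ) := by push_cast; ring
    rw [h5, ← ofReal_cpow (by positivity), Real.rpow_neg (by positivity), ← Real.sqrt_eq_rpow,
      ofReal_inv]
  rw [e2, e3, Complex.exp_neg]
  have hs : ((Real.sqrt L : ℝ) : ℂ) ≠ 0 := ofReal_ne_zero.2 (Real.sqrt_ne_zero'.2 (by exact_mod_cast hL))
  have hexp := exp_ne_zero (Real.pi / L * (a : ℂ) ^ 2 * w)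
  generalize (∑' m : ℤ, (m : ℂ) * cexp (2 * Real.pi * I * (a * m / L)) *
    cexp (-(Real.pi / L * m ^ 2 * (1 / w)))) = S
  generalize jacobiTheta₂ (a / L) (I * (1 / (L * w))) = T
  field_simp
  ring_nf
  simp only [I_sq]
  ring

end Poisson

section ThetaPair

lemma sum_range_neg {f : ℤ → ℂ} {L : ℕ} (hf : ∀ n, f (n + L) = f n) :
    ∑ a ∈ Finset.range L, f (-a) = ∑ a ∈ Finset.range L, f a := by
  rw [← Finset.sum_range_reflect, ← sum_range_add hf (1 - L)]
  refine Finset.sum_congr rfl fun a ha => ?_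
  have := Finset.mem_range.1 ha
  congr 1
  omega

lemma exists_bound_of_periodic {f : ℤ → ℂ} {L : ℕ} (hL : 0 < L) (hf : ∀ n, f (n + L) = f n) :
    ∃ B, ∀ n, ‖f n‖ ≤ B := by
  refine ⟨∑ a ∈ Finset.range L, ‖f a‖, fun n => ?_⟩
  have hLZ : (0 : ℤ) < L := by exact_mod_cast hL
  have hn0 : 0 ≤ n % L := Int.emod_nonneg _ hLZ.ne'
  have hnL : n % L < L := Int.emod_lt_of_pos _ hLZ
  have e : f n = f ((n % L).toNat : ℤ) := by
    rw [Int.toNat_of_nonneg hn0, ← periodic_mul hf (n % L) (n / L), Int.emod_add_ediv_mul]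
  rw [e]
  exact Finset.single_le_sum (f := fun a : ℕ => ‖f a‖) (fun a _ => norm_nonneg _)
    (Finset.mem_range.2 (by omega))

lemma cexp_add_int_mul (z : ℂ) (k : ℤ) : cexp (z + 2 * Real.pi * I * k) = cexp z := by
  have : (2 * Real.pi * I * k : ℂ) = k * (2 * Real.pi * I) := by ring
  rw [this]
  exact exp_periodic.int_mul k z

variable {L : ℕ} {ψ : ℤ → ℂ}

lemma dft_neg (hL : 0 < L) (hodd : ∀ n, ψ (-n) = -ψ n) (hper : ∀ n, ψ (n + L) = ψ n) (m : ℤ) :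
    dft L ψ (-m) = -dft L ψ m := by
  have hL' : (L : ℂ) ≠ 0 := by exact_mod_cast hL.ne'
  set f : ℤ → ℂ := fun a => ψ a * cexp (2 * Real.pi * I * (a * m / L)) with hf
  have hfper : ∀ n, f (n + L) = f n := by
    intro n
    have : (2 * Real.pi * I * (((n + L : ℤ) : ℂ) * m / L)) =
        2 * Real.pi * I * (n * m / L) + 2 * Real.pi * I * m := by
      push_cast
      field_simp
    simp only [hf]
    rw [hper, this, cexp_add_int_mul]
  have h := sum_range_neg hfper
  simp only [hf, hodd] at h
  rw [dft, dft, ← mul_neg]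
  congr 1
  push_cast at h ⊢
  rw [← h, ← Finset.sum_neg_distrib]
  refine Finset.sum_congr rfl fun a _ => ?_
  ring_nf

lemma summable_int_theta {κ : ℝ} (hκ : 0 < κ) {φ : ℤ → ℂ} (hφ : ∃ B, ∀ n, ‖φ n‖ ≤ B) {w : ℂ}
    (hw : 0 < w.re) : Summable fun n : ℤ => (n : ℂ) * φ n * cexp (-(κ * n ^ 2 * w)) := by
  obtain ⟨B, hB⟩ := hφ
  refine Summable.of_nat_of_neg ?_ ?_
  · simpa using summable_theta hκ (ψ := fun n => φ n) ⟨B, fun n => hB n⟩ hw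
  · refine (summable_theta hκ (ψ := fun n => -φ (-n)) ⟨B, fun n => ?_⟩ hw).congr fun n => ?_
    · simpa using hB (-n)
    · push_cast; rw [neg_sq]; ring

/-- For odd coefficients the sum over all integers is twice the sum over the natural numbers. -/
lemma hasSum_int_theta {κ : ℝ} (hκ : 0 < κ) {φ : ℤ → ℂ} (hφ : ∃ B, ∀ n, ‖φ n‖ ≤ B)
    (hodd : ∀ n, φ (-n) = -φ n) {w : ℂ} (hw : 0 < w.re) :
    HasSum (fun n : ℤ => (n : ℂ) * φ n * cexp (-(κ * n ^ 2 * w)))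
      (2 * theta κ (fun n => φ n) w) := by
  obtain ⟨B, hB⟩ := hφ
  have h1 := (summable_theta hκ (ψ := fun n => φ n) ⟨B, fun n => hB n⟩ hw).hasSum
  have h2 := (hasSum_nat_add_iff' 1).2 h1
  rw [two_mul]
  refine HasSum.of_nat_of_neg_add_one (by simpa [theta] using h1) ?_
  simp only [Finset.range_one, Finset.sum_singleton, Nat.cast_zero, zero_mul, sub_zero] at h2
  refine h2.congr_fun fun n => ?_
  rw [hodd]
  push_cast
  rw [neg_sq]
  ring

/-- An odd periodic function and its finite Fourier transform form a theta pair. -/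
theorem isThetaPair_dft (hL : 0 < L) (hodd : ∀ n, ψ (-n) = -ψ n) (hper : ∀ n, ψ (n + L) = ψ n) :
    IsThetaPair (Real.pi / L) (fun n => ψ n) (fun n => dft L ψ n) := by
  have hκ : 0 < Real.pi / L := by have := Real.pi_pos; positivity
  have hzero : ∀ φ : ℤ → ℂ, (∀ n, φ (-n) = -φ n) → φ 0 = 0 := by
    intro φ h
    have := h 0
    rw [neg_zero] at this
    exact self_eq_neg.1 this
  have hdodd := dft_neg hL hodd hper
  obtain ⟨B, hB⟩ := exists_bound_of_periodic hL hper
  have hdb : ∃ B', ∀ n, ‖dft L ψ n‖ ≤ B' := by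
    refine ⟨‖((Real.sqrt L : ℝ) : ℂ)⁻¹‖ * ∑ a ∈ Finset.range L, B, fun n => ?_⟩
    rw [dft, norm_mul]
    gcongr
    refine (norm_sum_le _ _).trans (Finset.sum_le_sum fun a _ => ?_)
    have : (2 * Real.pi * I * (a * n / L) : ℂ) = ((2 * Real.pi * (a * n / L) : ℝ) : ℂ) * I := by
      push_cast; ring
    rw [norm_mul, this, norm_exp_ofReal_mul_I, mul_one]
    exact hB a
  refine ⟨hκ, hzero _ hodd, hzero _ hdodd, ⟨B, fun n => hB n⟩, hdb.imp fun _ h n => h n, ?_⟩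
  intro w hw
  have hw0 : w ≠ 0 := fun h => by simp [h] at hw
  have hw1 : 0 < (1 / w).re := by
    rw [one_div, inv_re]; exact div_pos hw (normSq_pos.2 hw0)
  have hcast : ((Real.pi / L : ℝ) : ℂ) = Real.pi / L := by push_cast; rfl
  have hA := hasSum_int_theta hκ ⟨B, hB⟩ hodd hw
  have hB' := hasSum_int_theta hκ hdb hdodd hw1
  rw [hcast] at hA hB'
  -- the transformation of the theta function of each residue class of `n`
  have hC : HasSum (fun n : ℤ => (n : ℂ) * ψ n * cexp (-(Real.pi / L * n ^ 2 * w)))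
      (∑ a ∈ Finset.range L, ψ a * (-I * w ^ (-(3 / 2) : ℂ) * (((Real.sqrt L : ℝ) : ℂ)⁻¹ *
        ∑' m : ℤ, m * cexp (2 * Real.pi * I * ((a : ℤ) * m / L)) *
          cexp (-(Real.pi / L * m ^ 2 * (1 / w)))))) := by
    refine hasSum_of_residues hL fun a _ => ?_
    refine ((hasSum_residue_odd hL hw a).mul_left (ψ a)).congr_fun fun k => ?_
    rw [periodic_mul hper]
    ring
  have hD : ∀ a ∈ Finset.range L, HasSum (fun m : ℤ => ψ a * (((Real.sqrt L : ℝ) : ℂ)⁻¹ *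
      (m * cexp (2 * Real.pi * I * ((a : ℤ) * m / L)) * cexp (-(Real.pi / L * m ^ 2 * (1 / w))))))
      (ψ a * (((Real.sqrt L : ℝ) : ℂ)⁻¹ *
        ∑' m : ℤ, m * cexp (2 * Real.pi * I * ((a : ℤ) * m / L)) *
          cexp (-(Real.pi / L * m ^ 2 * (1 / w))))) := by
    intro a _
    refine (Summable.hasSum ?_).mul_left _ |>.mul_left _
    have := summable_int_theta hκ (φ := fun m => cexp (2 * Real.pi * I * ((a : ℤ) * m / L)))
      ⟨1, fun m => ?_⟩ hw1
    · rwa [hcast] at this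
    · have : (2 * Real.pi * I * ((a : ℤ) * m / L) : ℂ) =
          ((2 * Real.pi * ((a : ℤ) * m / L) : ℝ) : ℂ) * I := by push_cast; ring
      rw [this, norm_exp_ofReal_mul_I]
  have hE := hasSum_sum hD
  have hF : HasSum (fun n : ℤ => (n : ℂ) * dft L ψ n * cexp (-(Real.pi / L * n ^ 2 * (1 / w))))
      (∑ a ∈ Finset.range L, ψ a * (((Real.sqrt L : ℝ) : ℂ)⁻¹ *
        ∑' m : ℤ, m * cexp (2 * Real.pi * I * ((a : ℤ) * m / L)) *
          cexp (-(Real.pi / L * m ^ 2 * (1 / w))))) := by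
    refine hE.congr_fun fun m => ?_
    rw [dft, Finset.mul_sum, Finset.mul_sum, Finset.sum_mul]
    refine Finset.sum_congr rfl fun a _ => ?_
    push_cast
    ring
  have e1 := hA.unique hC
  have e2 := hB'.unique hF
  -- the terms of `n` and `-n` are equal, and so the sums over `ℤ` are twice the theta series
  have e3 : (2 : ℂ) * theta (Real.pi / L) (fun n => ψ n) w =
      2 * (-I * w ^ (-(3 / 2) : ℂ) * theta (Real.pi / L) (fun n => dft L ψ n) (1 / w)) := by
    rw [e1]
    calc _ = -I * w ^ (-(3 / 2) : ℂ) * ∑ a ∈ Finset.range L, ψ a * (((Real.sqrt L : ℝ) : ℂ)⁻¹ *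
        ∑' m : ℤ, m * cexp (2 * Real.pi * I * ((a : ℤ) * m / L)) *
          cexp (-(Real.pi / L * m ^ 2 * (1 / w)))) := by
          rw [Finset.mul_sum]
          exact Finset.sum_congr rfl fun a _ => by ring
      _ = _ := by rw [← e2]; ring
  exact mul_left_cancel₀ two_ne_zero e3

end ThetaPair

/-- Behaviour of an even periodic theta series near a cusp: it grows like `w^{-1/2}` times a
multiple of the mean of its coefficients. -/
lemma tendsto_even_theta {L : ℕ} (hL : 0 < L) {f : ℤ → ℂ} (hf : ∀ n, f (n + L) = f n)
    {α : Type*} {l : Filter α} {w : α → ℂ} (hw : ∀ᶠ x in l, 0 < (w x).re)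
    (hinv : Tendsto (fun x => (1 / w x).re) l atTop) :
    Tendsto (fun x => (w x) ^ (1 / 2 : ℂ) *
        ∑' n : ℤ, f n * cexp (-(Real.pi / L * n ^ 2 * w x))) l
      (𝓝 (((Real.sqrt L : ℝ) : ℂ)⁻¹ * ∑ a ∈ Finset.range L, f a)) := by
  have hκ : 0 < Real.pi / L := by have := Real.pi_pos; positivity
  have hcast : ((Real.pi / L : ℝ) : ℂ) = Real.pi / L := by push_cast; rfl
  set T : ℕ → ℂ → ℂ := fun a w => ∑' m : ℤ, cexp (2 * Real.pi * I * ((a : ℤ) * m / L)) *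
        cexp (-(Real.pi / L * m ^ 2 * (1 / w))) with hT
  have hnorm : ∀ (a : ℕ) (m : ℤ) (z : ℂ), ‖cexp (2 * Real.pi * I * ((a : ℤ) * m / L)) *
      cexp (-(Real.pi / L * m ^ 2 * z))‖ = Real.exp (-(Real.pi / L * m ^ 2 * z.re)) := by
    intro a m z
    have h1 : (2 * Real.pi * I * ((a : ℤ) * m / L) : ℂ) =
        ((2 * Real.pi * ((a : ℤ) * m / L) : ℝ) : ℂ) * I := by push_cast; ring
    have h2 : (Real.pi / L * m ^ 2 * z : ℂ) = ((Real.pi / L * m ^ 2 : ℝ) : ℂ) * z := by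
      push_cast; ring
    rw [norm_mul, h1, norm_exp_ofReal_mul_I, one_mul, Complex.norm_exp, neg_re, h2, re_ofReal_mul]
  have hlim : ∀ a, Tendsto (fun x => T a (w x)) l (𝓝 1) := by
    intro a
    have h1 : (1 : ℂ) = ∑' m : ℤ, if m = 0 then (1 : ℂ) else 0 := by simp
    rw [h1]
    refine tendsto_tsum_of_dominated_convergence
      (bound := fun m : ℤ => Real.exp (-(Real.pi / L * m ^ 2 * 1))) ?_ ?_ ?_
    · have := (hasSum_jacobiTheta₂_term 0 (τ := I * (1 / L : ℝ)) (by
        simp; exact hL)).summable.norm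
      refine this.congr fun m => ?_
      rw [norm_jacobiTheta₂_term]
      congr 1
      simp
      ring
    · intro m
      by_cases hm : m = 0
      · simpa [hm] using tendsto_const_nhds
      rw [if_neg hm, tendsto_zero_iff_norm_tendsto_zero]
      simp only [hnorm]
      refine Real.tendsto_exp_neg_atTop_nhds_zero.comp ?_
      have hm2 : 0 < Real.pi / L * (m : ℝ) ^ 2 := by
        have : (m : ℝ) ≠ 0 := by exact_mod_cast hm
        positivity
      exact hinv.const_mul_atTop hm2
    · filter_upwards [hinv.eventually_ge_atTop 1] with x hx m
      rw [hnorm]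
      gcongr
  have hev : ∀ᶠ x in l, (w x) ^ (1 / 2 : ℂ) * ∑' n : ℤ, f n * cexp (-(Real.pi / L * n ^ 2 * w x)) =
      ((Real.sqrt L : ℝ) : ℂ)⁻¹ * ∑ a ∈ Finset.range L, f a * T a (w x) := by
    filter_upwards [hw] with x hx
    have hw0 : w x ≠ 0 := fun h => by simp [h] at hx
    have h1 : HasSum (fun n : ℤ => f n * cexp (-(Real.pi / L * n ^ 2 * w x)))
        (∑ a ∈ Finset.range L, f a * (((L : ℝ) * w x) ^ (-(1 / 2) : ℂ) * T a (w x))) := by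
      refine hasSum_of_residues hL fun a _ => ?_
      refine ((hasSum_residue_even hL hx a).mul_left (f a)).congr_fun fun k => ?_
      rw [periodic_mul hf]
    rw [h1.tsum_eq, ofReal_mul_cpow (by exact_mod_cast hL)]
    have h5 : (-(1 / 2) : ℂ) = ((-(1 / 2) : ℝ) : ℂ) := by push_cast; ring
    have h6 : (((L : ℝ) : ℂ)) ^ (-(1 / 2) : ℂ) = ((Real.sqrt L : ℝ) : ℂ)⁻¹ := by
      rw [h5, ← ofReal_cpow (by positivity), Real.rpow_neg (by positivity), ← Real.sqrt_eq_rpow,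
        ofReal_inv]
    have h7 : (w x) ^ (1 / 2 : ℂ) * (w x) ^ (-(1 / 2) : ℂ) = 1 := by
      rw [← cpow_add _ _ hw0]; norm_num
    rw [h6, Finset.mul_sum, Finset.mul_sum]
    refine Finset.sum_congr rfl fun a _ => ?_
    calc _ = ((w x) ^ (1 / 2 : ℂ) * (w x) ^ (-(1 / 2) : ℂ)) *
          (((Real.sqrt L : ℝ) : ℂ)⁻¹ * (f a * T a (w x))) := by ring
      _ = _ := by rw [h7, one_mul]
  refine Tendsto.congr' (hev.mono fun _ h => h.symm) ?_
  refine Tendsto.const_mul _ (tendsto_finsetSum _ fun a _ => ?_)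
  simpa using (hlim a).const_mul (f a)

end FalseTheta

/-! ### Quadratic Gauss sums -/

namespace FalseTheta

open Complex

/-- The quadratic Gauss sum `∑ e(d a² / N)` over `a` modulo `N`. -/
noncomputable def quadSum (d : ℤ) (N : ℕ) : ℂ :=
  ∑ a ∈ Finset.range N, cexp (2 * Real.pi * I * (d * (a : ℤ) ^ 2 / N))

lemma cexp_quad_periodic (d : ℤ) {N : ℕ} (hN : 0 < N) (n : ℤ) :
    cexp (2 * Real.pi * I * (d * ((n + N : ℤ) : ℂ) ^ 2 / N)) =
      cexp (2 * Real.pi * I * (d * (n : ℂ) ^ 2 / N)) := by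
  have hN' : (N : ℂ) ≠ 0 := by exact_mod_cast hN.ne'
  rw [← cexp_add_int_mul (2 * Real.pi * I * (d * (n : ℂ) ^ 2 / N)) (d * (2 * n + N))]
  congr 1
  push_cast
  field_simp
  ring

/-- The Landsberg–Schaar reciprocity, with an unspecified factor that depends on `ℓ` only. It compares
the growth of the Jacobi theta function at `ℓ/2c` and at `-2c/ℓ`. -/
lemma exists_reciprocity {ℓ : ℕ} (hℓ : 0 < ℓ) : ∃ K : ℂ, ∀ c : ℕ, 0 < c →
    quadSum ℓ (4 * c) = ((Real.sqrt c : ℝ) : ℂ) * K * quadSum (-c) ℓ := by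
  have hIhalf : ((-I : ℂ) ^ (1 / 2 : ℂ)) ≠ 0 := by
    rw [cpow_def_of_ne_zero (neg_ne_zero.2 I_ne_zero)]; exact exp_ne_zero _
  refine ⟨2 * ((-I) ^ (1 / 2 : ℂ) * (1 / 2 : ℂ) ^ (1 / 2 : ℂ))⁻¹ * ((Real.sqrt ℓ : ℝ) : ℂ)⁻¹,
    fun c hc => ?_⟩
  have hcC : (c : ℂ) ≠ 0 := by exact_mod_cast hc.ne'
  have hℓC : (ℓ : ℂ) ≠ 0 := by exact_mod_cast hℓ.ne'
  have hcR : (0 : ℝ) < c := by exact_mod_cast hc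
  have hℓR : (0 : ℝ) < ℓ := by exact_mod_cast hℓ
  -- `τ` approaches the cusp `ℓ / 2c` vertically, and `w` measures the approach of `-1/τ` to `-2c/ℓ`
  set τ : ℝ → ℂ := fun x => ((ℓ / (2 * c) : ℝ) : ℂ) + I * ((x / (4 * c) : ℝ) : ℂ) with hτ
  set w : ℝ → ℂ := fun x => x * (1 / (2 * τ x)) with hw
  have hτre : ∀ x, (τ x).re = ℓ / (2 * c) := fun x => by
    simp only [hτ, add_re, mul_re, I_re, I_im, ofReal_re, ofReal_im]; ring
  have hτ0 : ∀ x, τ x ≠ 0 := fun x h => by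
    have := hτre x
    rw [h, zero_re] at this
    have : 0 < (ℓ : ℝ) / (2 * c) := by positivity
    linarith
  have hpos : ∀ᶠ x : ℝ in 𝓝[>] 0, 0 < x := self_mem_nhdsWithin
  have hτlim : Tendsto τ (𝓝[>] 0) (𝓝 ((ℓ / (2 * c) : ℝ) : ℂ)) := by
    have : Continuous τ := by fun_prop
    have h0 : τ 0 = ((ℓ / (2 * c) : ℝ) : ℂ) := by simp [hτ]
    simpa [h0] using (this.tendsto 0).mono_left nhdsWithin_le_nhds
  have hinvw : ∀ x : ℝ, 0 < x → (1 / w x).re = ℓ / c * x⁻¹ := by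
    intro x hx
    have hxC : (x : ℂ) ≠ 0 := ofReal_ne_zero.2 hx.ne'
    have : 1 / w x = ((2 * x⁻¹ : ℝ) : ℂ) * τ x := by
      have := hτ0 x
      simp only [hw]
      push_cast
      field_simp
    rw [this, re_ofReal_mul, hτre]
    field_simp
  have hwlim : Tendsto (fun x => (1 / w x).re) (𝓝[>] 0) atTop := by
    have h1 : Tendsto (fun x : ℝ => (ℓ : ℝ) / c * x⁻¹) (𝓝[>] 0) atTop :=
      tendsto_inv_nhdsGT_zero.const_mul_atTop (by positivity)
    exact h1.congr' (hpos.mono fun x hx => (hinvw x hx).symm)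
  have hwre : ∀ᶠ x in 𝓝[>] (0 : ℝ), 0 < (w x).re := by
    filter_upwards [hpos] with x hx
    have h1 : 0 < (1 / w x).re := by rw [hinvw x hx]; positivity
    have h2 : w x = (1 / w x)⁻¹ := by simp
    rw [h2, inv_re]
    refine div_pos h1 (normSq_pos.2 fun h => ?_)
    rw [h] at h1
    simp at h1
  -- growth at the two cusps
  have hlim1 := tendsto_even_theta (L := 4 * c) (by omega)
    (f := fun n => cexp (2 * Real.pi * I * ((ℓ : ℤ) * (n : ℂ) ^ 2 / (4 * c : ℕ))))
    (fun n => cexp_quad_periodic ℓ (by omega) n) (l := 𝓝[>] (0 : ℝ)) (w := fun x : ℝ => (x : ℂ))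
    (by simpa using hpos) (by
      refine tendsto_inv_nhdsGT_zero.congr fun x => ?_
      rw [one_div, ← ofReal_inv, ofReal_re])
  have hlim2 := tendsto_even_theta (L := ℓ) hℓ
    (f := fun n => cexp (2 * Real.pi * I * ((-c : ℤ) * (n : ℂ) ^ 2 / ℓ)))
    (fun n => cexp_quad_periodic (-c) hℓ n) hwre hwlim
  have hθ1 : ∀ x : ℝ, ∑' n : ℤ, cexp (2 * Real.pi * I * ((ℓ : ℤ) * (n : ℂ) ^ 2 / (4 * c : ℕ))) *
      cexp (-(Real.pi / (4 * c : ℕ) * n ^ 2 * x)) = jacobiTheta₂ 0 (τ x) := by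
    intro x
    refine tsum_congr fun n => ?_
    rw [jacobiTheta₂_term, ← Complex.exp_add]
    congr 1
    simp only [hτ]
    push_cast
    field_simp
    ring_nf
    rw [I_sq]
    ring
  have hθ2 : ∀ x : ℝ, ∑' n : ℤ, cexp (2 * Real.pi * I * ((-c : ℤ) * (n : ℂ) ^ 2 / ℓ)) *
      cexp (-(Real.pi / ℓ * n ^ 2 * w x)) = jacobiTheta₂ 0 (-1 / τ x) := by
    intro x
    refine tsum_congr fun n => ?_
    rw [jacobiTheta₂_term, ← Complex.exp_add]
    congr 1
    have h0 := hτ0 x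
    have hx : (x : ℂ) = (4 * c * τ x - 2 * ℓ) * -I := by
      simp only [hτ]
      push_cast
      field_simp
      ring_nf
      rw [I_sq]
      ring
    simp only [hw]
    rw [hx]
    push_cast
    field_simp
    ring
  simp only [hθ1] at hlim1
  simp only [hθ2] at hlim2
  have hlim3 : Tendsto (fun x => ((-I * τ x) ^ (1 / 2 : ℂ) * (1 / (2 * τ x)) ^ (1 / 2 : ℂ))⁻¹)
      (𝓝[>] 0) (𝓝 ((-I) ^ (1 / 2 : ℂ) * (1 / 2 : ℂ) ^ (1 / 2 : ℂ))⁻¹) := by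
    have hτp : (0 : ℝ) < ℓ / (2 * c) := by positivity
    have hτC : (((ℓ / (2 * c) : ℝ)) : ℂ) ≠ 0 := ofReal_ne_zero.2 hτp.ne'
    have e : (-I * ((ℓ / (2 * c) : ℝ) : ℂ)) ^ (1 / 2 : ℂ) *
        (1 / (2 * ((ℓ / (2 * c) : ℝ) : ℂ))) ^ (1 / 2 : ℂ) =
        (-I) ^ (1 / 2 : ℂ) * (1 / 2 : ℂ) ^ (1 / 2 : ℂ) := by
      have e1 : (1 / (2 * ((ℓ / (2 * c) : ℝ) : ℂ))) = (((ℓ / (2 * c) : ℝ)⁻¹ : ℝ) : ℂ) * (1 / 2) := by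
        push_cast; field_simp
      have e2 : (((ℓ / (2 * c) : ℝ)) : ℂ) ^ (1 / 2 : ℂ) *
          (((ℓ / (2 * c) : ℝ)⁻¹ : ℝ) : ℂ) ^ (1 / 2 : ℂ) = 1 := by
        rw [← mul_cpow_ofReal_nonneg hτp.le (by positivity), ← ofReal_mul, mul_inv_cancel₀ hτp.ne']
        simp
      rw [mul_comm (-I), ofReal_mul_cpow hτp, e1, ofReal_mul_cpow (by positivity)]
      calc _ = ((((ℓ / (2 * c) : ℝ)) : ℂ) ^ (1 / 2 : ℂ) *
          (((ℓ / (2 * c) : ℝ)⁻¹ : ℝ) : ℂ) ^ (1 / 2 : ℂ)) *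
          ((-I) ^ (1 / 2 : ℂ) * (1 / 2 : ℂ) ^ (1 / 2 : ℂ)) := by ring
        _ = _ := by rw [e2, one_mul]
    have hh : (1 / 2 : ℂ) ^ (1 / 2 : ℂ) ≠ 0 := by
      rw [cpow_def_of_ne_zero (by norm_num)]; exact exp_ne_zero _
    rw [← e]
    refine Tendsto.inv₀ (Tendsto.mul ?_ ?_) (by rw [e]; exact mul_ne_zero hIhalf hh)
    · refine (continuousAt_cpow_const ?_).tendsto.comp (hτlim.const_mul (-I))
      right
      have : (-I * ((ℓ / (2 * c) : ℝ) : ℂ)).im = -(ℓ / (2 * c)) := by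
        rw [im_mul_ofReal]; simp
      rw [this]
      exact neg_ne_zero.2 hτp.ne'
    · refine (continuousAt_cpow_const ?_).tendsto.comp
        (tendsto_const_nhds.div (hτlim.const_mul 2) (mul_ne_zero two_ne_zero hτC))
      left
      have : (1 / (2 * ((ℓ / (2 * c) : ℝ) : ℂ))) = ((1 / (2 * (ℓ / (2 * c))) : ℝ) : ℂ) := by
        push_cast; rfl
      rw [this, ofReal_re]
      positivity
  -- the functional equation of the theta function relates the two limits
  have hfe : ∀ᶠ x : ℝ in 𝓝[>] (0 : ℝ), (x : ℂ) ^ (1 / 2 : ℂ) * jacobiTheta₂ 0 (τ x) =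
      ((-I * τ x) ^ (1 / 2 : ℂ) * (1 / (2 * τ x)) ^ (1 / 2 : ℂ))⁻¹ *
        ((w x) ^ (1 / 2 : ℂ) * jacobiTheta₂ 0 (-1 / τ x)) := by
    filter_upwards [hpos] with x hx
    have h1 : (1 / (2 * τ x)) ^ (1 / 2 : ℂ) ≠ 0 := by
      rw [cpow_def_of_ne_zero (one_div_ne_zero (mul_ne_zero two_ne_zero (hτ0 x)))]
      exact exp_ne_zero _
    rw [jacobiTheta₂_functional_equation]
    simp only [hw]
    rw [ofReal_mul_cpow hx]
    simp
    field_simp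
  have := tendsto_nhds_unique hlim1 ((hlim3.mul hlim2).congr' (hfe.mono fun _ h => h.symm))
  have hs4 : Real.sqrt ((4 * c : ℕ) : ℝ) = 2 * Real.sqrt c := by
    push_cast
    rw [Real.sqrt_mul (by norm_num)]
    congr 1
    rw [show (4 : ℝ) = 2 ^ 2 by norm_num, Real.sqrt_sq (by norm_num)]
  rw [hs4] at this
  have hsc : ((Real.sqrt c : ℝ) : ℂ) ≠ 0 := ofReal_ne_zero.2 (Real.sqrt_ne_zero'.2 hcR)
  have hq1 : ∑ a ∈ Finset.range (4 * c), cexp (2 * Real.pi * I *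
      ((ℓ : ℤ) * ((a : ℤ) : ℂ) ^ 2 / (4 * c : ℕ))) = quadSum ℓ (4 * c) := rfl
  have hq2 : ∑ a ∈ Finset.range ℓ, cexp (2 * Real.pi * I *
      ((-c : ℤ) * ((a : ℤ) : ℂ) ^ 2 / ℓ)) = quadSum (-c) ℓ := rfl
  rw [hq1, hq2] at this
  push_cast at this
  rw [inv_mul_eq_iff_eq_mul₀ (by simpa using hsc)] at this
  rw [this]
  ring

lemma sum_range_eq_sum_zmod {N : ℕ} [NeZero N] (f : ZMod N → ℂ) :
    ∑ a ∈ Finset.range N, f ((a : ℤ) : ZMod N) = ∑ x : ZMod N, f x := by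
  refine Finset.sum_bij' (fun a _ => ((a : ℤ) : ZMod N)) (fun x _ => x.val) (fun _ _ => Finset.mem_univ _)
    (fun x _ => Finset.mem_range.2 (ZMod.val_lt x)) (fun a ha => ?_) (fun x _ => ?_) (fun _ _ => rfl)
  · simpa using ZMod.val_cast_of_lt (Finset.mem_range.1 ha)
  · simp

lemma quadSum_eq_sum_zmod (d : ℤ) (N : ℕ) [NeZero N] :
    quadSum d N = ∑ x : ZMod N, ZMod.stdAddChar ((d : ZMod N) * x ^ 2) := by
  rw [← sum_range_eq_sum_zmod, quadSum]
  refine Finset.sum_congr rfl fun a _ => ?_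
  have : ((d : ZMod N) * (((a : ℤ) : ZMod N)) ^ 2) = ((d * (a : ℤ) ^ 2 : ℤ) : ZMod N) := by push_cast; rfl
  rw [this, ZMod.stdAddChar_coe]
  congr 1
  push_cast
  ring

/-- Modulo an odd prime the quadratic Gauss sum is a Gauss sum of the quadratic character. -/
lemma quadSum_prime {ℓ : ℕ} [hℓ : Fact ℓ.Prime] (h2 : ℓ ≠ 2) {d : ℤ} (hd : (d : ZMod ℓ) ≠ 0) :
    quadSum d ℓ = (quadraticChar (ZMod ℓ) d : ℂ) *
      ∑ y : ZMod ℓ, (quadraticChar (ZMod ℓ) y : ℂ) * ZMod.stdAddChar y := by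
  classical
  have hchar : ringChar (ZMod ℓ) ≠ 2 := by rwa [ZMod.ringChar_zmod_n]
  have h1 : quadSum d ℓ = ∑ y : ZMod ℓ, ((quadraticChar (ZMod ℓ) y : ℂ) + 1) *
      ZMod.stdAddChar ((d : ZMod ℓ) * y) := by
    rw [quadSum_eq_sum_zmod, ← Finset.sum_fiberwise (g := fun x : ZMod ℓ => x ^ 2)]
    refine Finset.sum_congr rfl fun y _ => ?_
    have hcard := quadraticChar_card_sqrts hchar y
    have e : ∀ x ∈ Finset.univ.filter (fun x : ZMod ℓ => x ^ 2 = y),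
        ZMod.stdAddChar ((d : ZMod ℓ) * x ^ 2) = ZMod.stdAddChar ((d : ZMod ℓ) * y) := by
      intro x hx
      rw [(Finset.mem_filter.1 hx).2]
    rw [Finset.sum_congr rfl e, Finset.sum_const, nsmul_eq_mul]
    congr 1
    have : Finset.univ.filter (fun x : ZMod ℓ => x ^ 2 = y) = {x : ZMod ℓ | x ^ 2 = y}.toFinset := by
      ext; simp
    rw [this]
    exact_mod_cast hcard
  have h3 : ∑ y : ZMod ℓ, ZMod.stdAddChar ((d : ZMod ℓ) * y) = 0 := by
    have := AddChar.sum_mulShift (d : ZMod ℓ) (ZMod.isPrimitive_stdAddChar ℓ)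
    rw [if_neg hd] at this
    simpa [mul_comm] using this
  have h4 : ((quadraticChar (ZMod ℓ) d : ℤ) : ℂ) * (quadraticChar (ZMod ℓ) d : ℤ) = 1 := by
    have := quadraticChar_sq_one hd
    rw [sq] at this
    exact_mod_cast this
  rw [h1]
  simp only [add_mul, one_mul]
  rw [Finset.sum_add_distrib, h3, add_zero, Finset.mul_sum]
  refine Fintype.sum_bijective (fun y => (d : ZMod ℓ) * y) (mulLeft_bijective₀ _ hd) _ _ fun y => ?_
  rw [map_mul (quadraticChar (ZMod ℓ))]
  push_cast
  rw [← mul_assoc, ← mul_assoc, h4, one_mul]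

lemma quadSum_congr {d d' : ℤ} {N : ℕ} (hN : 0 < N) (h : d ≡ d' [ZMOD N]) :
    quadSum d N = quadSum d' N := by
  have : NeZero N := ⟨hN.ne'⟩
  rw [quadSum_eq_sum_zmod, quadSum_eq_sum_zmod, (ZMod.intCast_eq_intCast_iff _ _ _).2 h]

lemma quadSum_four {ℓ : ℤ} (h : ℓ ≡ 1 [ZMOD 4]) : quadSum ℓ 4 = 2 * (1 + I) := by
  rw [quadSum_congr (d' := 1) (by norm_num) h, quadSum]
  have e1 : cexp (2 * Real.pi * I * (1 / 4)) = I := by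
    rw [show (2 * Real.pi * I * (1 / 4) : ℂ) = Real.pi / 2 * I by ring, exp_pi_div_two_mul_I]
  have e2 : cexp (2 * Real.pi * I * (4 / 4)) = 1 := by
    rw [show (2 * Real.pi * I * (4 / 4) : ℂ) = 2 * Real.pi * I by ring, exp_two_pi_mul_I]
  have e3 : cexp (2 * Real.pi * I * (9 / 4)) = I := by
    rw [show (2 * Real.pi * I * (9 / 4) : ℂ) = 2 * Real.pi * I * (1 / 4) + 2 * Real.pi * I * (2 : ℤ) by
      push_cast; ring, cexp_add_int_mul, e1]
  norm_num [Finset.sum_range_succ] at *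
  rw [e1, e3]
  ring

lemma jacobiSym_four_mul_sub_one {a : ℕ} (ha : 0 < a) : jacobiSym a (4 * a - 1) = 1 := by
  have hodd : Odd (4 * a - 1) := ⟨2 * a - 1, by omega⟩
  have h1 : jacobiSym ((4 : ℤ) * a) (4 * a - 1) = 1 := by
    rw [jacobiSym.mod_left' (a₂ := 1), jacobiSym.one_left]
    refine Int.ModEq.symm ((Int.modEq_iff_dvd).2 ⟨1, ?_⟩)
    push_cast [Nat.cast_sub (show 1 ≤ 4 * a by omega)]
    ring
  rwa [jacobiSym.mul_left, jacobiSym.at_four hodd, one_mul] at h1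

/-- The symbol `(a/·)` with `a > 0` is an even function modulo `4a`. -/
lemma jacobiSym_natAbs_congr {a : ℕ} (ha : 0 < a) {m n : ℤ} (hm : Odd m) (hn : Odd n)
    (h : m ≡ n [ZMOD 4 * a]) : jacobiSym a m.natAbs = jacobiSym a n.natAbs := by
  have key : ∀ k l : ℕ, Odd k → Odd l → ((k : ℤ) ≡ l [ZMOD 4 * a]) → jacobiSym a k = jacobiSym a l := by
    intro k l hk hl hkl
    rw [jacobiSym.mod_right _ hk, jacobiSym.mod_right _ hl]
    congr 1
    have : ((k : ℤ) ≡ l [ZMOD ((4 * a : ℕ) : ℤ)]) := by push_cast; exact hkl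
    exact (Int.natCast_modEq_iff).1 this
  have hodd : Odd (4 * a - 1) := ⟨2 * a - 1, by omega⟩
  have key2 : ∀ k l : ℕ, Odd k → Odd l → ((k : ℤ) ≡ -l [ZMOD 4 * a]) →
      jacobiSym a k = jacobiSym a l := by
    intro k l hk hl hkl
    have h1 : jacobiSym a ((4 * a - 1) * l) = jacobiSym a l := by
      rw [jacobiSym.mul_right' _ (by omega) (by rintro rfl; simp at hl),
        jacobiSym_four_mul_sub_one ha, one_mul]
    rw [← h1]
    refine key _ _ hk (hodd.mul hl) (hkl.trans ((Int.modEq_iff_dvd).2 ⟨l, ?_⟩))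
    push_cast [Nat.cast_sub (show 1 ≤ 4 * a by omega)]
    ring
  have hm' : Odd m.natAbs := Int.natAbs_odd.2 hm
  have hn' : Odd n.natAbs := Int.natAbs_odd.2 hn
  rcases Int.natAbs_eq m with e1 | e1 <;> rcases Int.natAbs_eq n with e2 | e2
  · exact key _ _ hm' hn' (by rw [← e1, ← e2]; exact h)
  · exact key2 _ _ hm' hn' (by rw [← e1, ← e2]; exact h)
  · refine key2 _ _ hm' hn' ?_
    have : ((m.natAbs : ℕ) : ℤ) = -m := by omega
    rw [this, ← e2]; exact h.neg
  · refine key _ _ hm' hn' ?_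
    have h1 : ((m.natAbs : ℕ) : ℤ) = -m := by omega
    have h2 : ((n.natAbs : ℕ) : ℤ) = -n := by omega
    rw [h1, h2]; exact h.neg

/-- Evaluation of the quadratic Gauss sum to a modulus divisible by `4`. Dirichlet's theorem reduces
it to a prime `ℓ`, and reciprocity for `ℓ` to the case `c = 1`. -/
theorem quadSum_eq {c : ℕ} (hc : 0 < c) {d : ℤ} (hd : d ≡ 1 [ZMOD 4]) (hcop : IsCoprime d c) :
    quadSum d (4 * c) = 2 * (1 + I) * ((Real.sqrt c : ℝ) : ℂ) * (jacobiSym c d.natAbs : ℂ) := by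
  have hdodd : Odd d := by
    have := hd.eq
    rw [Int.odd_iff]; omega
  have hd4 : IsCoprime d (4 : ℤ) := by
    obtain ⟨k, hk⟩ := (Int.modEq_iff_dvd).1 hd
    exact ⟨1, k, by linarith⟩
  have hcop4 : IsCoprime d ((4 * c : ℕ) : ℤ) := by
    push_cast
    exact hd4.mul_right hcop
  obtain ⟨ℓ, hℓc, hℓp, hℓd⟩ := Nat.forall_exists_prime_gt_and_zmodEq (4 * c) (q := 4 * c) (a := d)
    (by omega) hcop4
  have hfact : Fact ℓ.Prime := ⟨hℓp⟩
  have hℓ4 : (ℓ : ℤ) ≡ 1 [ZMOD 4] := by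
    refine Int.ModEq.trans (Int.ModEq.of_mul_right (c : ℤ) ?_) hd
    push_cast at hℓd
    exact hℓd
  have hℓodd : Odd (ℓ : ℤ) := by
    have := hℓ4.eq
    rw [Int.odd_iff]; omega
  have hℓ2 : ℓ ≠ 2 := by omega
  have hne : ∀ k : ℕ, 0 < k → k < ℓ → (((-k : ℤ)) : ZMod ℓ) ≠ 0 := by
    intro k hk hkℓ h
    rw [Int.cast_neg, neg_eq_zero, Int.cast_natCast, ZMod.natCast_eq_zero_iff] at h
    exact absurd (Nat.le_of_dvd hk h) (by omega)
  -- the unknown factor `K` is eliminated between the moduli `4` and `4c`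
  obtain ⟨K, hK⟩ := exists_reciprocity hℓp.pos
  have h1 := hK 1 one_pos
  have h2 := hK c hc
  rw [quadSum_prime hℓ2 (hne c hc (by omega))] at h2
  rw [mul_one, quadSum_four hℓ4, quadSum_prime hℓ2 (hne 1 one_pos (by omega))] at h1
  have hchi : ((quadraticChar (ZMod ℓ) ((-c : ℤ) : ZMod ℓ) : ℤ) : ℂ) =
      (jacobiSym c d.natAbs : ℂ) * (quadraticChar (ZMod ℓ) ((-(1 : ℕ) : ℤ) : ZMod ℓ) : ℤ) := by
    have e1 : jacobiSym c d.natAbs = quadraticChar (ZMod ℓ) ((c : ℤ) : ZMod ℓ) := by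
      have := jacobiSym_natAbs_congr hc hℓodd hdodd (by push_cast at hℓd; exact hℓd)
      rw [← this, Int.natAbs_natCast, ← jacobiSym.legendreSym.to_jacobiSym]
      rfl
    rw [e1, ← Int.cast_mul, ← map_mul]
    congr 2
    push_cast
    ring
  rw [quadSum_congr (d' := ℓ) (by omega) hℓd.symm, h2, hchi]
  simp only [Nat.cast_one, Real.sqrt_one, ofReal_one, one_mul] at h1
  linear_combination (-((Real.sqrt c : ℝ) : ℂ) * (jacobiSym c d.natAbs : ℂ)) * h1

end FalseTheta

/-! ### The Fourier transform of a twisted coefficient function -/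

namespace FalseTheta

open Complex

/-- `e(z) = exp(2πiz)`. -/
noncomputable def expi (z : ℂ) : ℂ := cexp (2 * Real.pi * I * z)

lemma expi_add (z w : ℂ) : expi (z + w) = expi z * expi w := by
  rw [expi, expi, expi, ← Complex.exp_add]; congr 1; ring

lemma expi_add_int (z : ℂ) (k : ℤ) : expi (z + k) = expi z := by
  rw [expi, mul_add, cexp_add_int_mul, expi]

lemma sum_range_mul_of_periodic {f : ℤ → ℂ} {T : ℕ} (hf : ∀ n, f (n + T) = f n) (M : ℕ) :
    ∑ k ∈ Finset.range (M * T), f k = M * ∑ k ∈ Finset.range T, f k := by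
  induction M with
  | zero => simp
  | succ M ih =>
    rw [add_mul, one_mul, Finset.sum_range_add, ih]
    have : ∀ k ∈ Finset.range T, f ((M * T + k : ℕ) : ℤ) = f k := by
      intro k _
      have := periodic_mul hf k M
      rw [← this]
      congr 1
      push_cast
      ring
    rw [Finset.sum_congr rfl this]
    push_cast
    ring

lemma sum_range_mul_ite_dvd (g : ℤ → ℂ) {N : ℕ} (hN : 0 < N) (K : ℕ) :
    ∑ n ∈ Finset.range (N * K), (if ((N : ℤ) ∣ n) then g n else 0) =
      ∑ k ∈ Finset.range K, g (N * k) := by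
  rw [← Finset.sum_filter]
  refine Finset.sum_bij' (fun n _ => n / N) (fun k _ => N * k) (fun n hn => ?_) (fun k hk => ?_)
    (fun n hn => ?_) (fun k hk => ?_) (fun n hn => ?_)
  · simp only [Finset.mem_filter, Finset.mem_range] at hn ⊢
    exact Nat.div_lt_of_lt_mul hn.1
  · simp only [Finset.mem_filter, Finset.mem_range] at hk ⊢
    exact ⟨Nat.mul_lt_mul_of_pos_left hk hN, by push_cast; exact dvd_mul_right _ _⟩
  · simp only [Finset.mem_filter, Finset.mem_range] at hn
    exact Nat.mul_div_cancel' (by exact_mod_cast hn.2)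
  · exact Nat.mul_div_cancel_left _ hN
  · simp only [Finset.mem_filter, Finset.mem_range] at hn
    congr 1
    have := Nat.mul_div_cancel' (show N ∣ n by exact_mod_cast hn.2)
    exact_mod_cast this.symm

lemma sum_expi_div {N : ℕ} (hN : 0 < N) (n : ℤ) :
    ∑ v ∈ Finset.range N, expi (n * v / N) = if (N : ℤ) ∣ n then (N : ℂ) else 0 := by
  have : NeZero N := ⟨hN.ne'⟩
  have h1 : ∀ v ∈ Finset.range N, expi (n * v / N) =
      (fun x : ZMod N => ZMod.stdAddChar (x * (n : ZMod N))) ((v : ℤ) : ZMod N) := by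
    intro v _
    have e : (((v : ℤ) : ZMod N) * (n : ZMod N)) = ((v * n : ℤ) : ZMod N) := by push_cast; rfl
    simp only
    rw [e, ZMod.stdAddChar_coe, expi]
    congr 1
    push_cast
    ring
  rw [Finset.sum_congr rfl h1, sum_range_eq_sum_zmod (fun x : ZMod N => ZMod.stdAddChar (x * (n : ZMod N))),
    AddChar.sum_mulShift _ (ZMod.isPrimitive_stdAddChar N)]
  simp [ZMod.intCast_zmod_eq_zero_iff_dvd, ZMod.card]

lemma quadSum_neg (d : ℤ) (N : ℕ) : quadSum (-d) N = (starRingEnd ℂ) (quadSum d N) := by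
  rw [quadSum, quadSum, map_sum]
  refine Finset.sum_congr rfl fun a _ => ?_
  rw [← exp_conj]
  congr 1
  simp only [map_mul, map_div₀, map_ofNat, conj_ofReal, conj_I, map_pow, map_intCast, map_natCast]
  push_cast
  ring

/-- Completing the square. The sum over `n` modulo `2pc` is averaged over the translations by multiples
of `c / j`, which retains only the `n` divisible by `2pj`, where the coefficient function is constant;
a quadratic Gauss sum remains. -/
theorem dft_twist {p j c₁ : ℕ} (hp : 0 < p) (hj : 0 < j) (hc₁ : 0 < c₁) {φ : ℤ → ℂ}
    (hper : ∀ n, φ (n + (2 * p * j : ℕ)) = φ n) {a b d : ℤ}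
    (hdet : a * d - b * (4 * p * j ^ 2 * c₁) = 1) (ha : (4 * p * j ^ 2 : ℤ) ∣ a - 1)
    (hb : (4 * p * j ^ 2 : ℤ) ∣ b) (hd : (4 * p * j ^ 2 : ℤ) ∣ d - 1) (m : ℤ) :
    dft (2 * p * (4 * p * j ^ 2 * c₁))
        (fun n => φ n * expi (-(d * n ^ 2 / (4 * p * (4 * p * j ^ 2 * c₁ : ℕ))))) m =
      (1 - I) / (Real.sqrt 2 : ℝ) * (jacobiSym ((4 * p * j ^ 2 * c₁ : ℕ) : ℤ) d.natAbs : ℂ) *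
        (φ m * expi (a * m ^ 2 / (4 * p * (4 * p * j ^ 2 * c₁ : ℕ)))) := by
  have hpC : (p : ℂ) ≠ 0 := by exact_mod_cast hp.ne'
  have hjC : (j : ℂ) ≠ 0 := by exact_mod_cast hj.ne'
  have hcC : (c₁ : ℂ) ≠ 0 := by exact_mod_cast hc₁.ne'
  obtain ⟨a', ha'⟩ := ha
  obtain ⟨b', hb'⟩ := hb
  obtain ⟨d', hd'⟩ := hd
  have hdet' : (a : ℂ) * d - b * (4 * p * j ^ 2 * c₁) = 1 := by exact_mod_cast hdet
  have hda : (d : ℂ) = 1 + 4 * p * j ^ 2 * d' := by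
    have : d = 1 + 4 * p * j ^ 2 * d' := by linarith
    rw [this]; push_cast; ring
  have hbb : (b : ℂ) = 4 * p * j ^ 2 * b' := by rw [hb']; push_cast; ring
  set L : ℕ := 2 * p * (4 * p * j ^ 2 * c₁) with hL
  have hLpos : 0 < L := by positivity
  have hφ : ∀ n t : ℤ, φ (n + t * (2 * p * j : ℕ)) = φ n := periodic_mul hper
  set g : ℤ → ℂ := fun n => φ (n + m) * expi (-(d * n ^ 2 / (4 * p * (4 * p * j ^ 2 * c₁ : ℕ)))) with hg
  have hgper : ∀ n, g (n + L) = g n := by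
    intro n
    simp only [hg]
    have e1 : n + L + m = (n + m) + (4 * p * j * c₁ : ℤ) * (2 * p * j : ℕ) := by
      rw [hL]; push_cast; ring
    have e2 : (-(d * ((n + L : ℤ) : ℂ) ^ 2 / (4 * p * (4 * p * j ^ 2 * c₁ : ℕ))) : ℂ) =
        -(d * n ^ 2 / (4 * p * (4 * p * j ^ 2 * c₁ : ℕ))) +
          ((-(d * (n + p * (4 * p * j ^ 2 * c₁))) : ℤ) : ℂ) := by
      rw [hL]; push_cast; field_simp; ring
    rw [e1, hφ, e2, expi_add_int]
  -- completing the square: `n` is replaced by `n - a m`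
  have hshift : ∀ n : ℤ, φ n * expi (-(d * n ^ 2 / (4 * p * (4 * p * j ^ 2 * c₁ : ℕ)))) *
      expi (n * m / L) =
      expi (a * m ^ 2 / (4 * p * (4 * p * j ^ 2 * c₁ : ℕ))) * g (n + -(a * m)) := by
    intro n
    simp only [hg]
    have e1 : n + -(a * m) + m = n + (-(2 * j * a' * m) : ℤ) * (2 * p * j : ℕ) := by
      have : a = 1 + 4 * p * j ^ 2 * a' := by linarith
      rw [this]; push_cast; ring
    rw [e1, hφ, mul_left_comm, ← expi_add, mul_assoc, ← expi_add]
    congr 1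
    rw [← expi_add_int (_ + (n * m / L : ℂ)) (2 * j ^ 2 * b' * m * n - a * b' * j ^ 2 * m ^ 2)]
    congr 1
    have hb2 : (2 * j ^ 2 * b' * m * n - a * b' * j ^ 2 * m ^ 2 : ℂ) =
        (b : ℂ) * (4 * p * j ^ 2 * c₁) * (2 * m * n - a * m ^ 2) /
          (4 * p * (4 * p * j ^ 2 * c₁)) := by
      rw [hbb]; field_simp
    push_cast
    rw [hb2, show (b : ℂ) * (4 * p * j ^ 2 * c₁) = a * d - 1 by linear_combination -hdet', hL]
    push_cast
    field_simp
    ring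
  have hsum1 : dft L (fun n => φ n * expi (-(d * n ^ 2 / (4 * p * (4 * p * j ^ 2 * c₁ : ℕ))))) m =
      ((Real.sqrt L : ℝ) : ℂ)⁻¹ * (expi (a * m ^ 2 / (4 * p * (4 * p * j ^ 2 * c₁ : ℕ))) *
        ∑ n ∈ Finset.range L, g n) := by
    rw [dft, ← sum_range_add hgper (-(a * m))]
    congr 1
    rw [Finset.mul_sum]
    refine Finset.sum_congr rfl fun n _ => ?_
    have := hshift n
    simp only [expi] at this ⊢
    push_cast at this ⊢
    exact this
  -- translation by `v c / j` multiplies the terms by the character `n ↦ e(-d n v / 2pj)`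
  have havg : ((2 * p * j : ℕ) : ℂ) * ∑ n ∈ Finset.range L, g n =
      ∑ n ∈ Finset.range L, if (((2 * p * j : ℕ) : ℤ) ∣ n) then ((2 * p * j : ℕ) : ℂ) * g n else 0 := by
    have h1 : ∀ v ∈ Finset.range (2 * p * j), ∑ n ∈ Finset.range L, g n =
        ∑ n ∈ Finset.range L, g n * expi ((-(d * n) : ℤ) * v / (2 * p * j : ℕ)) := by
      intro v _
      rw [← sum_range_add hgper (v * (4 * p * j * c₁))]
      refine Finset.sum_congr rfl fun n _ => ?_
      simp only [hg]
      have e1 : (n : ℤ) + v * (4 * p * j * c₁) + m = (n + m) + (2 * c₁ * v : ℤ) * (2 * p * j : ℕ) := by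
        push_cast; ring
      rw [e1, hφ, mul_assoc (φ (n + m)), ← expi_add,
        ← expi_add_int (_ + ((-(d * n) : ℤ) * v / (2 * p * j : ℕ) : ℂ)) (-(d * c₁ * v ^ 2))]
      congr 2
      push_cast
      field_simp
      ring
    have h2 : ((2 * p * j : ℕ) : ℂ) * ∑ n ∈ Finset.range L, g n =
        ∑ v ∈ Finset.range (2 * p * j), ∑ n ∈ Finset.range L, g n := by
      rw [Finset.sum_const, Finset.card_range, nsmul_eq_mul]
    rw [h2, Finset.sum_congr rfl h1, Finset.sum_comm]
    refine Finset.sum_congr rfl fun n _ => ?_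
    rw [← Finset.mul_sum, sum_expi_div (by positivity)]
    have hiff : (((2 * p * j : ℕ) : ℤ) ∣ -(d * n)) ↔ (((2 * p * j : ℕ) : ℤ) ∣ n) := by
      rw [dvd_neg]
      have : d * n = n + ((2 * p * j : ℕ) : ℤ) * (2 * j * d' * n) := by
        have : d = 1 + 4 * p * j ^ 2 * d' := by linarith
        rw [this]; push_cast; ring
      rw [this]
      exact (Int.dvd_add_left (dvd_mul_right _ _))
    simp only [hiff]
    split_ifs <;> ring
  have hNK : L = (2 * p * j) * ((p * j) * (4 * c₁)) := by rw [hL]; ring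
  have hsum2 : ∑ n ∈ Finset.range L, g n = φ m * (p * j) * (starRingEnd ℂ) (quadSum d (4 * c₁)) := by
    have hNC : ((2 * p * j : ℕ) : ℂ) ≠ 0 := Nat.cast_ne_zero.2 (by positivity)
    refine mul_left_cancel₀ hNC (havg.trans ?_)
    rw [hNK, sum_range_mul_ite_dvd (fun n => ((2 * p * j : ℕ) : ℂ) * g n) (by positivity),
      ← Finset.mul_sum]
    congr 1
    have e1 : ∀ k ∈ Finset.range ((p * j) * (4 * c₁)), g (((2 * p * j : ℕ) : ℤ) * k) =
        φ m * (fun k : ℤ => cexp (2 * Real.pi * I * ((-d : ℤ) * (k : ℂ) ^ 2 / (4 * c₁ : ℕ)))) k := by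
      intro k _
      simp only [hg]
      rw [add_comm, mul_comm ((2 * p * j : ℕ) : ℤ), hφ]
      congr 1
      rw [expi]
      congr 2
      push_cast
      field_simp
      ring
    rw [Finset.sum_congr rfl e1, ← Finset.mul_sum,
      sum_range_mul_of_periodic
        (f := fun k : ℤ => cexp (2 * Real.pi * I * ((-d : ℤ) * (k : ℂ) ^ 2 / (4 * c₁ : ℕ))))
        (fun n => cexp_quad_periodic (-d) (by omega) n), ← quadSum_neg, mul_assoc (φ m),
      Nat.cast_mul]
    rfl
  have hd4 : d ≡ 1 [ZMOD 4] :=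
    ((Int.modEq_iff_dvd).2 ⟨p * j ^ 2 * d', by rw [hd']; ring⟩ : (1 : ℤ) ≡ d [ZMOD 4]).symm
  have hdc : IsCoprime d c₁ := ⟨a, -(b * (4 * p * j ^ 2)), by linear_combination hdet⟩
  have hdj : IsCoprime d j := ⟨a, -(b * (4 * p * j * c₁)), by linear_combination hdet⟩
  have hdodd : Odd d := by
    have := hd4.eq
    rw [Int.odd_iff]; omega
  -- `4` and `j ^ 2` are squares, and the symbol at `p` is `1` since `d ≡ 1` modulo `4p`
  have hjac : jacobiSym ((4 * p * j ^ 2 * c₁ : ℕ) : ℤ) d.natAbs = jacobiSym c₁ d.natAbs := by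
    have hd4p : d ≡ 1 [ZMOD 4 * p] :=
      ((Int.modEq_iff_dvd).2 ⟨j ^ 2 * d', by rw [hd']; ring⟩ : (1 : ℤ) ≡ d [ZMOD 4 * p]).symm
    have hjp : jacobiSym p d.natAbs = 1 := by
      rw [jacobiSym_natAbs_congr hp hdodd odd_one hd4p]; simp
    have hjj : jacobiSym ((j : ℤ) ^ 2) d.natAbs = 1 := by
      refine jacobiSym.sq_one' ?_
      have := Int.isCoprime_iff_gcd_eq_one.1 hdj.symm
      rwa [Int.gcd_eq_natAbs, ← Int.natAbs_natCast d.natAbs, ← Int.gcd_eq_natAbs] at this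
    push_cast
    rw [jacobiSym.mul_left, jacobiSym.mul_left, jacobiSym.mul_left,
      jacobiSym.at_four (Int.natAbs_odd.2 hdodd), hjp, hjj]
    ring
  have hsq : Real.sqrt L = 2 * Real.sqrt 2 * (p * j) * Real.sqrt c₁ := by
    rw [Real.sqrt_eq_iff_eq_sq (by positivity) (by positivity)]
    rw [mul_pow, mul_pow, mul_pow, Real.sq_sqrt (by positivity), Real.sq_sqrt (by positivity), hL]
    push_cast
    ring
  have hs2 : ((Real.sqrt 2 : ℝ) : ℂ) ≠ 0 := by
    exact ofReal_ne_zero.2 (Real.sqrt_ne_zero'.2 (by norm_num))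
  have hsc : ((Real.sqrt c₁ : ℝ) : ℂ) ≠ 0 := by
    exact ofReal_ne_zero.2 (Real.sqrt_ne_zero'.2 (by exact_mod_cast hc₁))
  rw [hsum1, hsum2, quadSum_eq hc₁ hd4 hdc, hjac, hsq]
  simp only [map_mul, map_add, map_one, conj_I, conj_ofReal, map_intCast, map_ofNat]
  push_cast
  field_simp
  ring

end FalseTheta

/-! ### Transformation of the false theta series -/

namespace FalseTheta

open Complex

/-- The series `∑_{n ≥ 0} φ(n) q^{n²/4p}`. -/
noncomputable def falseTheta (p : ℕ) (φ : ℤ → ℂ) (τ : ℂ) : ℂ :=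
  ∑' n : ℕ, φ n * expi (n ^ 2 / (4 * p) * τ)

/-- The formal power series `∑ a_r ε^r` is the asymptotic expansion of `F(x + ε)` in a cone around
the vertical direction. -/
def HasConeExpansion (F : ℂ → ℂ) (x : ℂ) (a : ℕ → ℂ) : Prop :=
  ∀ N, ∃ C r : ℝ, 0 < r ∧ ∀ ε : ℂ, 0 < ε.im → |ε.re| ≤ ε.im / 2 → ‖ε‖ ≤ r →
    ‖F (x + ε) - truncEval a N ε‖ ≤ C * ‖ε‖ ^ N

/-- The false theta series satisfies the transformation law for `γ`, with an error `h` that continues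
analytically to the upper half-plane near every real point other than `γ⁻¹(i∞)`. -/
def SlashRelation (F : ℂ → ℂ) (γ : SL(2, ℤ)) : Prop :=
  ∃ h : ℝ → ℂ, IsNiceFor γ h ∧ ∀ x : ℝ, (γ 1 0 : ℝ) * x + (γ 1 1 : ℝ) ≠ 0 →
    ∃ J H : ℂ → ℂ, AnalyticAt ℂ J 0 ∧ AnalyticAt ℂ H 0 ∧
      (∀ᶠ ε : ℝ in 𝓝 0, J ε = slashFactor 1 γ (x + ε)) ∧
      (∀ᶠ ε : ℝ in 𝓝 0, H ε = h (x + ε)) ∧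
      ∀ᶠ t : ℝ in 𝓝[>] 0, F (x + I * t) - J (I * t) * F (moebius γ (x + I * t : ℂ)) = H (I * t)

section

variable {p j : ℕ} {φ : ℤ → ℂ}

/-- The false theta series has asymptotic expansions at the rational points: at `x` its coefficients
are `φ` twisted by `e(n² x / 4p)`, which are again odd and periodic. -/
theorem exists_hasConeExpansion (hp : 0 < p) (hj : 0 < j) (hodd : ∀ n, φ (-n) = -φ n)
    (hper : ∀ n, φ (n + (2 * p * j : ℕ)) = φ n) (x : ℚ) :
    ∃ a, HasConeExpansion (falseTheta p φ) x a := by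
  have hv : 0 < x.den := x.den_pos
  have hpC : (p : ℂ) ≠ 0 := by exact_mod_cast hp.ne'
  have hjC : (j : ℂ) ≠ 0 := by exact_mod_cast hj.ne'
  have hvC : (x.den : ℂ) ≠ 0 := by exact_mod_cast hv.ne'
  have hx : (x : ℂ) = x.num / x.den := Rat.cast_def x
  set L : ℕ := 2 * p * j * x.den with hL
  have hLpos : 0 < L := by positivity
  set ψ : ℤ → ℂ := fun n => φ n * expi (n ^ 2 * x / (4 * p)) with hψ
  have hψodd : ∀ n, ψ (-n) = -ψ n := by
    intro n
    simp only [hψ]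
    rw [hodd]
    push_cast
    rw [neg_sq]
    ring
  have hψper : ∀ n, ψ (n + L) = ψ n := by
    intro n
    simp only [hψ]
    have e1 : n + (L : ℤ) = n + (x.den : ℤ) * (2 * p * j : ℕ) := by rw [hL]; push_cast; ring
    rw [e1, periodic_mul hper, ← expi_add_int (n ^ 2 * x / (4 * p)) (x.num * (n * j + p * j ^ 2 * x.den))]
    congr 2
    rw [hx]
    push_cast
    field_simp
    ring
  obtain ⟨α, hα⟩ := (isThetaPair_dft hLpos hψodd hψper).exists_expansion
  -- `s = -i m ε` maps the cone around the vertical direction to the one around the positive axis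
  set m : ℝ := j * x.den with hm
  have hm0 : 0 < m := by positivity
  refine ⟨fun r => α r * (-(I * m)) ^ r, fun N => ?_⟩
  obtain ⟨C, hC, h⟩ := hα N
  refine ⟨C * m ^ N, 1 / m, by positivity, fun ε h1 h2 h3 => ?_⟩
  have hre : (-(I * m) * ε).re = m * ε.im := by simp
  have him : (-(I * m) * ε).im = -(m * ε.re) := by simp
  have hnorm : ‖-(I * m) * ε‖ = m * ‖ε‖ := by
    rw [norm_mul, norm_neg, norm_mul, norm_I, norm_real, Real.norm_of_nonneg hm0.le, one_mul]
  have := h (-(I * m) * ε) (by rw [hre]; positivity) (by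
    rw [hre, him, abs_neg, abs_mul, abs_of_pos hm0, mul_div_assoc]
    exact mul_le_mul_of_nonneg_left h2 hm0.le) (by
    rw [hnorm]
    calc m * ‖ε‖ ≤ m * (1 / m) := mul_le_mul_of_nonneg_left h3 hm0.le
      _ = 1 := by field_simp)
  rw [hnorm] at this
  have e1 : falseTheta p φ (x + ε) = eichler (Real.pi / L) (fun n => ψ n) (-(I * m) * ε) := by
    rw [falseTheta, eichler]
    refine tsum_congr fun n => ?_
    simp only [hψ]
    rw [mul_assoc, expi, expi, ← Complex.exp_add]
    congr 2
    rw [hL, hm]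
    push_cast
    field_simp
    ring
  have e2 : truncEval (fun r => α r * (-(I * m)) ^ r) N ε =
      ∑ r ∈ Finset.range N, α r * (-(I * m) * ε) ^ r := by
    rw [truncEval]
    exact Finset.sum_congr rfl fun r _ => by rw [mul_pow]; ring
  rw [e1, e2]
  refine this.trans_eq ?_
  ring

lemma neg_I_cpow_neg_half : (-I) ^ (-(1 / 2) : ℂ) = (1 + I) / (Real.sqrt 2 : ℝ) := by
  have h2 : ((Real.sqrt 2 : ℝ) : ℂ) ≠ 0 := ofReal_ne_zero.2 (Real.sqrt_ne_zero'.2 (by norm_num))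
  have h3 : ((Real.sqrt 2 : ℝ) : ℂ) ^ 2 = 2 := by
    rw [← ofReal_pow, Real.sq_sqrt (by norm_num)]; norm_num
  rw [cpow_def_of_ne_zero (neg_ne_zero.2 I_ne_zero), log_neg_I,
    show (-(Real.pi / 2) * I * -(1 / 2) : ℂ) = ((Real.pi / 4 : ℝ) : ℂ) * I by push_cast; ring,
    exp_mul_I, ← ofReal_cos, ← ofReal_sin, Real.cos_pi_div_four, Real.sin_pi_div_four]
  push_cast
  field_simp
  rw [h3]

lemma I_cpow_neg_half : I ^ (-(1 / 2) : ℂ) = (1 - I) / (Real.sqrt 2 : ℝ) := by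
  have h2 : ((Real.sqrt 2 : ℝ) : ℂ) ≠ 0 := ofReal_ne_zero.2 (Real.sqrt_ne_zero'.2 (by norm_num))
  have h3 : ((Real.sqrt 2 : ℝ) : ℂ) ^ 2 = 2 := by
    rw [← ofReal_pow, Real.sq_sqrt (by norm_num)]; norm_num
  rw [cpow_def_of_ne_zero I_ne_zero, log_I,
    show (Real.pi / 2 * I * -(1 / 2) : ℂ) = ((-(Real.pi / 4) : ℝ) : ℂ) * I by push_cast; ring,
    exp_mul_I, ← ofReal_cos, ← ofReal_sin, Real.cos_neg, Real.sin_neg, Real.cos_pi_div_four,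
    Real.sin_pi_div_four]
  push_cast
  field_simp
  rw [h3]
  ring

lemma sqrt_two_sq : ((Real.sqrt 2 : ℝ) : ℂ) * (Real.sqrt 2 : ℝ) = 2 := by
  rw [← ofReal_mul, Real.mul_self_sqrt (by norm_num)]; norm_num

lemma inv_conj_cpow_half_of_pos {X : ℝ} (hX : 0 < X) :
    ((starRingEnd ℂ) ((X : ℂ) ^ (1 / 2 : ℂ)))⁻¹ =
      (1 - I) / (Real.sqrt 2 : ℝ) * (-(I * X)) ^ (-(1 / 2) : ℂ) := by
  have h2 : ((Real.sqrt 2 : ℝ) : ℂ) ≠ 0 := ofReal_ne_zero.2 (Real.sqrt_ne_zero'.2 (by norm_num))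
  have e1 : (X : ℂ) ^ (1 / 2 : ℂ) = ((X ^ (1 / 2 : ℝ) : ℝ) : ℂ) := by
    rw [ofReal_cpow hX.le]; norm_num
  rw [show (-(I * X) : ℂ) = X * -I by ring, ofReal_mul_cpow hX, neg_I_cpow_neg_half, cpow_neg, e1,
    conj_ofReal]
  have : ((X ^ (1 / 2 : ℝ) : ℝ) : ℂ) ≠ 0 := ofReal_ne_zero.2 (Real.rpow_pos_of_pos hX _).ne'
  field_simp
  linear_combination sqrt_two_sq + I_sq

lemma inv_conj_cpow_half_of_neg {X : ℝ} (hX : X < 0) :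
    ((starRingEnd ℂ) ((X : ℂ) ^ (1 / 2 : ℂ)))⁻¹ =
      -((1 - I) / (Real.sqrt 2 : ℝ) * (-(I * X)) ^ (-(1 / 2) : ℂ)) := by
  have h2 : ((Real.sqrt 2 : ℝ) : ℂ) ≠ 0 := ofReal_ne_zero.2 (Real.sqrt_ne_zero'.2 (by norm_num))
  obtain ⟨Y, rfl⟩ : ∃ Y, X = -Y := ⟨-X, by ring⟩
  have hY : 0 < Y := by linarith
  have e1 : (Y : ℂ) ^ (1 / 2 : ℂ) = ((Y ^ (1 / 2 : ℝ) : ℝ) : ℂ) := by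
    rw [ofReal_cpow hY.le]; norm_num
  have e2 : (-1 : ℂ) ^ (1 / 2 : ℂ) = I := by
    rw [cpow_def_of_ne_zero (by norm_num), log_neg_one,
      show (Real.pi * I * (1 / 2) : ℂ) = Real.pi / 2 * I by ring, exp_pi_div_two_mul_I]
  rw [show (-(I * (-Y : ℝ)) : ℂ) = Y * I by push_cast; ring, ofReal_mul_cpow hY, I_cpow_neg_half,
    cpow_neg, show ((-Y : ℝ) : ℂ) = Y * (-1) by push_cast; ring, ofReal_mul_cpow hY, e2, e1, map_mul,
    conj_ofReal, conj_I]
  have : ((Y ^ (1 / 2 : ℝ) : ℝ) : ℂ) ≠ 0 := ofReal_ne_zero.2 (Real.rpow_pos_of_pos hY _).ne'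
  have hI := I_ne_zero
  field_simp
  linear_combination -sqrt_two_sq + (I - 2) * I_sq

/-- Members of the congruence subgroup, in coordinates. -/
lemma mem_Gamma_coords {N : ℕ} {γ : SL(2, ℤ)} (h : γ ∈ CongruenceSubgroup.Gamma N) :
    (N : ℤ) ∣ γ 0 0 - 1 ∧ (N : ℤ) ∣ γ 0 1 ∧ (N : ℤ) ∣ γ 1 0 ∧ (N : ℤ) ∣ γ 1 1 - 1 := by
  rw [CongruenceSubgroup.Gamma_mem] at h
  obtain ⟨h1, h2, h3, h4⟩ := h
  simp only [← ZMod.intCast_zmod_eq_zero_iff_dvd (a := _) (b := N)]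
  push_cast
  exact ⟨by rw [h1, sub_self], h2, h3, by rw [h4, sub_self]⟩

lemma thetaEps_of_dvd {d : ℤ} (h : (4 : ℤ) ∣ d - 1) : thetaEps d = 1 := by
  rw [thetaEps, if_pos ((Int.modEq_iff_dvd.2 h : (1 : ℤ) ≡ d [ZMOD 4]).symm)]

/-- The transformation law for `c > 0`. The error is the period integral of the theta series that
belongs to the twist of `φ` at the cusp `γ⁻¹(i∞) = -d/c`. -/
theorem slashRelation_of_pos (hp : 0 < p) (hj : 0 < j) (hodd : ∀ n, φ (-n) = -φ n)
    (hper : ∀ n, φ (n + (2 * p * j : ℕ)) = φ n) {γ : SL(2, ℤ)}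
    (hγ : γ ∈ CongruenceSubgroup.Gamma (4 * p * j ^ 2)) (hc : 0 < γ 1 0) :
    SlashRelation (falseTheta p φ) γ := by
  obtain ⟨ha, hb, hcd, hd⟩ := mem_Gamma_coords hγ
  have hdet : γ 0 0 * γ 1 1 - γ 0 1 * γ 1 0 = 1 := by
    have := γ.det_coe
    rwa [Matrix.det_fin_two] at this
  set a := γ 0 0
  set b := γ 0 1
  set d := γ 1 1
  obtain ⟨c', hc'⟩ := hcd
  have hc'pos : 0 < c' := by
    by_contra hcon
    have : ((4 * p * j ^ 2 : ℕ) : ℤ) * c' ≤ 0 := mul_nonpos_of_nonneg_of_nonpos (by positivity) (by omega)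
    omega
  obtain ⟨c₁, rfl⟩ : ∃ n : ℕ, c' = n := ⟨c'.toNat, by omega⟩
  have hc₁ : 0 < c₁ := by exact_mod_cast hc'pos
  set c : ℕ := 4 * p * j ^ 2 * c₁ with hcdef
  have hγc : γ 1 0 = (c : ℤ) := by rw [hc', hcdef]; push_cast; ring
  have hcpos : 0 < c := by positivity
  have hcC : (c : ℂ) ≠ 0 := by exact_mod_cast hcpos.ne'
  have hpC : (p : ℂ) ≠ 0 := by exact_mod_cast hp.ne'
  have hcR : (0 : ℝ) < c := by exact_mod_cast hcpos
  rw [hγc] at hdet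
  push_cast at ha hb hd
  set L : ℕ := 2 * p * c with hL
  have hLpos : 0 < L := by positivity
  -- `φ` is twisted by the additive character of the cusp `-d/c`
  set ψ : ℤ → ℂ := fun n => φ n * expi (-(d * n ^ 2 / (4 * p * (c : ℕ)))) with hψ
  have hφ : ∀ n t : ℤ, φ (n + t * (2 * p * j : ℕ)) = φ n := periodic_mul hper
  have hψodd : ∀ n, ψ (-n) = -ψ n := by
    intro n
    simp only [hψ]
    rw [hodd]
    push_cast
    rw [neg_sq]
    ring
  have hψper : ∀ n, ψ (n + L) = ψ n := by
    intro n
    simp only [hψ]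
    have e1 : n + (L : ℤ) = n + (4 * p * j * c₁ : ℤ) * (2 * p * j : ℕ) := by
      rw [hL, hcdef]; push_cast; ring
    have e2 : φ (n + L) = φ n := by rw [e1, hφ]
    rw [e2, ← expi_add_int (-(d * n ^ 2 / (4 * p * (c : ℕ)))) (-(d * (n + p * c)))]
    congr 2
    rw [hL]
    push_cast
    field_simp
    ring
  have hpair := isThetaPair_dft hLpos hψodd hψper
  set κ : ℝ := Real.pi / L with hκ
  have hκpos : 0 < κ := hpair.pos
  set ν : ℂ := (1 - I) / (Real.sqrt 2 : ℝ) with hν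
  set J₀ : ℂ := (jacobiSym (c : ℤ) d.natAbs : ℂ) with hJ₀
  have hdft : ∀ m, dft L ψ m = ν * J₀ * (φ m * expi (a * m ^ 2 / (4 * p * (c : ℕ)))) :=
    dft_twist hp hj hc₁ hper (by rw [← hdet, hcdef]; push_cast; ring) ha hb hd
  have hden : ∀ τ : ℂ, 0 < τ.im → (c : ℂ) * τ + d ≠ 0 := by
    intro τ hτ h0
    have := congrArg Complex.im h0
    simp [hcpos.ne', hτ.ne'] at this
  -- `τ` corresponds to `s = -i (c τ + d)`
  have hF1 : ∀ τ : ℂ, falseTheta p φ τ = eichler κ (fun n => ψ n) (-(I * (c * τ + d))) := by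
    intro τ
    rw [falseTheta, eichler]
    refine tsum_congr fun n => ?_
    simp only [hψ]
    rw [mul_assoc, expi, expi, ← Complex.exp_add]
    congr 2
    rw [hκ, hL]
    push_cast
    field_simp
    ring
  -- `1 / s` corresponds to `γ τ`, up to a translation that is absorbed in the twist of `φ`
  have hF2 : ∀ τ : ℂ, 0 < τ.im → eichler κ (fun n => dft L ψ n) (1 / (-(I * (c * τ + d)))) =
      ν * J₀ * falseTheta p φ (moebius γ τ) := by
    intro τ hτ
    have h0 := hden τ hτ
    have hdetC : (b : ℂ) = (a * d - 1) / c := by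
      have : (a : ℂ) * d - b * c = 1 := by exact_mod_cast hdet
      field_simp
      linear_combination -this
    have hm : moebius γ τ = a / c - 1 / (c * (c * τ + d)) := by
      rw [moebius]
      change ((a : ℂ) * τ + b) / (((γ 1 0 : ℤ) : ℂ) * τ + d) = _
      obtain ⟨D, hD⟩ : ∃ D, D = (c : ℂ) * τ + d := ⟨_, rfl⟩
      have hτD : (a : ℂ) * τ = a * (D - d) / c := by rw [hD]; field_simp; ring
      rw [hγc, hdetC, Int.cast_natCast, hτD, ← hD]
      rw [← hD] at h0
      field_simp
      ring
    rw [falseTheta, eichler, ← tsum_mul_left]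
    refine tsum_congr fun n => ?_
    simp only [hdft]
    rw [mul_assoc, mul_assoc (φ _)]
    congr 2
    rw [expi, expi, ← Complex.exp_add]
    congr 1
    rw [hm, hκ, hL]
    push_cast
    have := I_ne_zero
    field_simp
    ring_nf
    rw [I_sq]
    ring
  set cc : ℂ := (Real.pi / κ : ℂ) ^ (1 / 2 : ℂ) with hcc
  have hcc0 : cc ≠ 0 := by
    rw [hcc, cpow_def_of_ne_zero (div_ne_zero (ofReal_ne_zero.2 Real.pi_pos.ne')
      (ofReal_ne_zero.2 hκpos.ne'))]
    exact exp_ne_zero _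
  set P : ℂ → ℂ := periodIntegral κ (fun n => ψ n) with hP
  have hPan : ∀ z : ℂ, z.im ≠ 0 → AnalyticAt ℂ P z := fun z hz =>
    hpair.differentiableOn_periodIntegral.analyticAt
      ((isOpen_ne_fun continuous_im continuous_const).mem_nhds hz)
  have hslash : ∀ y : ℝ, slashFactor 1 γ y =
      J₀ * ((starRingEnd ℂ) (((c * y + d : ℝ) : ℂ) ^ (1 / 2 : ℂ)))⁻¹ := by
    intro y
    have hdvd : (4 : ℤ) ∣ d - 1 := (by exact ⟨p * j ^ 2, by ring⟩ : (4 : ℤ) ∣ 4 * p * j ^ 2).trans hd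
    rw [slashFactor, thetaEps_of_dvd hdvd, thetaSymbol, lowerSqrt, if_neg (by omega), if_pos hc, hγc]
    simp only [one_mul, zpow_neg, zpow_one, Int.cast_natCast]
    rfl
  refine ⟨fun x => cc⁻¹ * P (-(I * (c * x + d : ℝ))), ⟨?_, ?_⟩, ?_⟩
  · refine contDiff_const.mul ?_
    have : ContDiff ℝ ∞ fun x : ℝ => (c : ℝ) * x + d := by fun_prop
    exact hpair.contDiff_periodIntegral.comp this
  · intro x hx
    have hx' : (c : ℝ) * x + d ≠ 0 := by
      have : (γ 1 0 : ℝ) * x + (γ 1 1 : ℝ) ≠ 0 := hx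
      rw [hγc] at this
      exact_mod_cast this
    refine analyticAt_const.mul ?_
    have h1 : AnalyticAt ℝ P (-(I * (c * x + d : ℝ))) :=
      (hPan _ (by rw [neg_im, I_mul_im, ofReal_re]; exact neg_ne_zero.2 hx')).restrictScalars
    have h2 : AnalyticAt ℝ (fun x : ℝ => (-(I * (c * x + d : ℝ)) : ℂ)) x := by
      refine (analyticAt_const.mul ?_).neg
      have h3 : AnalyticAt ℝ (fun x : ℝ => c * x + d) x := by fun_prop
      exact (ofRealCLM.analyticAt _).comp h3
    exact AnalyticAt.comp (g := P) (f := fun x : ℝ => (-(I * (c * x + d : ℝ)) : ℂ)) h1 h2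
  · intro x hx
    have hX : (c : ℝ) * x + d ≠ 0 := by
      rw [hγc] at hx
      exact_mod_cast hx
    set X : ℝ := c * x + d with hXdef
    have hlin : AnalyticAt ℂ (fun ε : ℂ => -(I * (c * (x + ε) + d))) 0 := by fun_prop
    have hz0 : -(I * (c * ((x : ℂ) + 0) + d)) = -(I * X) := by rw [hXdef]; push_cast; ring
    have him : (-(I * (X : ℂ))).im ≠ 0 := by simpa using hX
    have hHan : AnalyticAt ℂ (fun ε : ℂ => cc⁻¹ * P (-(I * (c * (x + ε) + d)))) 0 := by
      refine analyticAt_const.mul ?_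
      have h1 : AnalyticAt ℂ P (-(I * (c * ((x : ℂ) + 0) + d))) := by
        rw [hz0]; exact hPan _ him
      exact h1.comp (f := fun ε : ℂ => -(I * (c * (x + ε) + d))) hlin
    have hJan : AnalyticAt ℂ (fun ε : ℂ => (-(I * (c * (x + ε) + d))) ^ (-(1 / 2) : ℂ)) 0 := by
      refine hlin.cpow analyticAt_const ?_
      rw [hz0]
      exact Or.inr him
    have hHreal : ∀ ε : ℝ, cc⁻¹ * P (-(I * (c * (x + (ε : ℂ)) + d))) =
        cc⁻¹ * P (-(I * (c * (x + ε) + d : ℝ))) := by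
      intro ε; push_cast; rfl
    have hs : ∀ t : ℝ, (-(I * (c * (x + I * t) + d))).re = c * t ∧
        (-(I * (c * (x + I * t) + d))).im = -X := by
      intro t
      constructor <;> simp [hXdef]
    have hcast : ∀ ε : ℝ, (-(I * ((c * (x + ε) + d : ℝ) : ℂ))) = -(I * (c * (x + (ε : ℂ)) + d)) := by
      intro ε; push_cast; rfl
    have hcont : Continuous fun ε : ℝ => c * (x + ε) + (d : ℝ) := by fun_prop
    -- the sign in front of the dual series depends on the side of the real axis on which `s` lies; it
    -- is the one by which the principal branch of `s ^ (-1/2)` differs from the slash factor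
    rcases lt_or_gt_of_ne hX with hneg | hpos
    · refine ⟨fun ε => -(J₀ * (ν * (-(I * (c * (x + ε) + d))) ^ (-(1 / 2) : ℂ))), _,
        (analyticAt_const.mul (analyticAt_const.mul hJan)).neg, hHan, ?_, Eventually.of_forall hHreal, ?_⟩
      · have : ∀ᶠ ε : ℝ in 𝓝 0, c * (x + ε) + (d : ℝ) < 0 :=
          hcont.continuousAt.eventually_lt continuousAt_const (by simpa using hneg)
        filter_upwards [this] with ε hε
        rw [hslash, inv_conj_cpow_half_of_neg hε, hcast]
        ring
      · filter_upwards [self_mem_nhdsWithin] with t ht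
        obtain ⟨h1, h2⟩ := hs t
        have key := hpair.periodIntegral_of_im_pos (s := -(I * (c * (x + I * t) + d)))
          (by rw [h1]; exact mul_pos hcR ht) (by rw [h2]; linarith)
        rw [← hP, ← hF1, hF2 _ (by simpa using ht)] at key
        rw [key, ← hcc, inv_mul_cancel_left₀ hcc0]
        ring
    · refine ⟨fun ε => J₀ * (ν * (-(I * (c * (x + ε) + d))) ^ (-(1 / 2) : ℂ)), _,
        (analyticAt_const.mul (analyticAt_const.mul hJan)), hHan, ?_, Eventually.of_forall hHreal, ?_⟩
      · have : ∀ᶠ ε : ℝ in 𝓝 0, 0 < c * (x + ε) + (d : ℝ) :=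
          continuousAt_const.eventually_lt hcont.continuousAt (by simpa using hpos)
        filter_upwards [this] with ε hε
        rw [hslash, inv_conj_cpow_half_of_pos hε, hcast]
      · filter_upwards [self_mem_nhdsWithin] with t ht
        obtain ⟨h1, h2⟩ := hs t
        have key := hpair.periodIntegral_of_im_neg (s := -(I * (c * (x + I * t) + d)))
          (by rw [h1]; exact mul_pos hcR ht) (by rw [h2]; linarith)
        rw [← hP, ← hF1, hF2 _ (by simpa using ht)] at key
        rw [key, ← hcc, inv_mul_cancel_left₀ hcc0]
        ring

end

end FalseTheta

/-! ### Quantum modularity -/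

namespace FalseTheta

open Complex

section

variable {p j : ℕ} {φ : ℤ → ℂ}

lemma conj_falseTheta (hreal : ∀ n, (starRingEnd ℂ) (φ n) = φ n) (τ : ℂ) :
    (starRingEnd ℂ) (falseTheta p φ τ) = falseTheta p φ (-(starRingEnd ℂ) τ) := by
  rw [falseTheta, falseTheta, conj_tsum]
  refine tsum_congr fun n => ?_
  rw [map_mul, hreal, expi, expi, ← exp_conj]
  congr 2
  simp only [map_mul, map_div₀, map_ofNat, conj_ofReal, conj_I, map_pow, map_natCast]
  ring

lemma falseTheta_add_int (hp : 0 < p) (τ : ℂ) (k : ℤ) :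
    falseTheta p φ (τ + ((4 * p : ℕ) : ℤ) * k) = falseTheta p φ τ := by
  have hpC : (p : ℂ) ≠ 0 := by exact_mod_cast hp.ne'
  refine tsum_congr fun n => ?_
  rw [← expi_add_int (n ^ 2 / (4 * p) * τ) (n ^ 2 * k)]
  congr 2
  push_cast
  field_simp

/-- For `c = 0` the matrix is a translation by a multiple of the period `4p`. -/
lemma slashRelation_of_zero (hp : 0 < p) {γ : SL(2, ℤ)}
    (hγ : γ ∈ CongruenceSubgroup.Gamma (4 * p * j ^ 2)) (hc : γ 1 0 = 0) :
    SlashRelation (falseTheta p φ) γ := by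
  obtain ⟨-, hb, -, hd⟩ := mem_Gamma_coords hγ
  have hdet : γ 0 0 * γ 1 1 - γ 0 1 * γ 1 0 = 1 := by
    have := γ.det_coe
    rwa [Matrix.det_fin_two] at this
  rw [hc, mul_zero, sub_zero] at hdet
  have hd1 : γ 1 1 = 1 := by
    have h4 : (4 : ℤ) ∣ γ 1 1 - 1 := (by push_cast; exact ⟨p * j ^ 2, by ring⟩ :
      (4 : ℤ) ∣ ((4 * p * j ^ 2 : ℕ) : ℤ)).trans hd
    rcases Int.isUnit_iff.1 (IsUnit.of_mul_eq_one _ ((mul_comm _ _).trans hdet)) with h | h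
    · exact h
    · rw [h] at h4; norm_num at h4
  have ha1 : γ 0 0 = 1 := by rwa [hd1, mul_one] at hdet
  obtain ⟨b', hb'⟩ := hb
  have hm : ∀ τ : ℂ, moebius γ τ = τ + ((4 * p : ℕ) : ℤ) * ((j ^ 2 * b' : ℤ) : ℂ) := by
    intro τ
    rw [moebius, hc, hd1, ha1, hb']
    push_cast
    ring
  have hs : ∀ y : ℝ, slashFactor 1 γ y = 1 := by
    intro y
    rw [slashFactor, thetaSymbol, lowerSqrt, hc, hd1, thetaEps_of_dvd (by norm_num)]
    simp
  refine ⟨fun _ => 0, ⟨contDiff_const, analyticOnNhd_const⟩, fun x _ => ⟨fun _ => 1, fun _ => 0,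
    analyticAt_const, analyticAt_const, Eventually.of_forall fun ε => (hs _).symm,
    Eventually.of_forall fun _ => rfl, Eventually.of_forall fun t => ?_⟩⟩
  rw [hm, falseTheta_add_int hp]
  ring

lemma analyticAt_conj_conj {f : ℂ → ℂ} (hf : AnalyticAt ℂ f 0) :
    AnalyticAt ℂ (fun ε => (starRingEnd ℂ) (f (-(starRingEnd ℂ) ε))) 0 := by
  have h1 : ∀ᶠ z in 𝓝 (0 : ℂ), DifferentiableAt ℂ f z := by
    filter_upwards [hf.eventually_analyticAt] with z hz using hz.differentiableAt
  have hcont : Tendsto (fun ε : ℂ => -(starRingEnd ℂ) ε) (𝓝 0) (𝓝 0) := by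
    have : Continuous fun ε : ℂ => -(starRingEnd ℂ) ε := by fun_prop
    simpa using this.tendsto 0
  rw [analyticAt_iff_eventually_differentiableAt]
  filter_upwards [hcont.eventually h1] with z hz
  have h2 : DifferentiableAt ℂ (fun ε => f (-ε)) ((starRingEnd ℂ) z) :=
    DifferentiableAt.comp (g := f) (f := fun ε : ℂ => -ε) _ hz differentiableAt_id.neg
  have h3 := DifferentiableAt.conj_conj h2
  rw [conj_conj] at h3
  exact h3

/-- The transformation law for `c < 0` is the complex conjugate of the law for the matrix with entries
`a, -b, -c, d`, because the coefficients are real. -/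
lemma SlashRelation.of_conj (hreal : ∀ n, (starRingEnd ℂ) (φ n) = φ n) {γ γ' : SL(2, ℤ)}
    (h00 : γ' 0 0 = γ 0 0) (h01 : γ' 0 1 = -γ 0 1) (h10 : γ' 1 0 = -γ 1 0) (h11 : γ' 1 1 = γ 1 1)
    (hc : γ 1 0 < 0) (hd : (4 : ℤ) ∣ γ 1 1 - 1) (h : SlashRelation (falseTheta p φ) γ') :
    SlashRelation (falseTheta p φ) γ := by
  obtain ⟨g, ⟨hg1, hg2⟩, hg⟩ := h
  have hslash : ∀ y : ℝ, slashFactor 1 γ y = (starRingEnd ℂ) (slashFactor 1 γ' (-y)) := by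
    intro y
    have hodd : Odd (γ 1 1) := by rw [Int.odd_iff]; omega
    have hsym : thetaSymbol (γ' 1 0) (γ' 1 1) = thetaSymbol (γ 1 0) (γ 1 1) := by
      rw [thetaSymbol, thetaSymbol, h10, h11, if_neg (by omega),
        show γ 1 0 = -1 * -γ 1 0 by ring, jacobiSym.mul_left, neg_mul, one_mul, neg_neg,
        jacobiSym.at_neg_one (Int.natAbs_odd.2 hodd)]
      split_ifs with h
      · rw [ZMod.χ₄_nat_three_mod_four (by omega)]; ring
      · rw [ZMod.χ₄_nat_one_mod_four (by omega)]; ring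
    rw [slashFactor, slashFactor, h11, ← h11, hsym, h11, thetaEps_of_dvd hd, h10]
    simp only [lowerSqrt]
    rw [if_neg (by omega), if_pos (by omega)]
    simp only [one_zpow, one_mul, map_mul, map_intCast, map_zpow₀, conj_conj]
    congr 4
    push_cast
    ring
  refine ⟨fun x => (starRingEnd ℂ) (g (-x)), ⟨?_, ?_⟩, fun x hx => ?_⟩
  · exact conjCLE.contDiff.comp (hg1.comp contDiff_neg)
  · intro x hx
    have h1 : AnalyticAt ℝ g (-x) := by
      refine hg2 _ ?_
      have : (γ 1 0 : ℝ) * x + (γ 1 1 : ℝ) ≠ 0 := hx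
      have e : (γ' 1 0 : ℝ) * (-x) + (γ' 1 1 : ℝ) = (γ 1 0 : ℝ) * x + (γ 1 1 : ℝ) := by
        rw [h10, h11]; push_cast; ring
      change (γ' 1 0 : ℝ) * (-x) + (γ' 1 1 : ℝ) ≠ 0
      rwa [e]
    have h2 : AnalyticAt ℝ (fun x : ℝ => g (-x)) x :=
      AnalyticAt.comp (g := g) (f := fun x : ℝ => -x) h1 analyticAt_id.neg
    exact (conjCLE.toContinuousLinearMap.analyticAt _).comp h2
  · have e : (γ' 1 0 : ℝ) * (-x) + (γ' 1 1 : ℝ) = (γ 1 0 : ℝ) * x + (γ 1 1 : ℝ) := by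
      rw [h10, h11]; push_cast; ring
    obtain ⟨J, H, hJ, hH, hJr, hHr, hrel⟩ := hg (-x) (by rwa [e])
    have hneg : Tendsto (fun ε : ℝ => -ε) (𝓝 0) (𝓝 0) := by
      simpa using (continuous_neg (G := ℝ)).tendsto 0
    refine ⟨_, _, analyticAt_conj_conj hJ, analyticAt_conj_conj hH, ?_, ?_, ?_⟩
    · filter_upwards [hneg.eventually hJr] with ε hε
      rw [hslash, conj_ofReal, ← ofReal_neg, hε]
      congr 2
      ring
    · filter_upwards [hneg.eventually hHr] with ε hε
      rw [conj_ofReal, ← ofReal_neg, hε]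
      congr 2
      ring
    · filter_upwards [hrel] with t ht
      have e1 : -(starRingEnd ℂ) (I * t) = I * t := by simp
      rw [e1, ← ht, map_sub, map_mul, conj_falseTheta hreal, conj_falseTheta hreal]
      congr 2
      · simp [add_comm]
      · congr 1
        simp only [moebius, h00, h01, h10, h11]
        simp only [map_div₀, map_add, map_mul, map_intCast, conj_ofReal, conj_I]
        rw [← neg_div]
        push_cast
        congr 1 <;> ring

/-- The transformation law for the false theta series with real coefficients. -/
theorem slashRelation (hp : 0 < p) (hj : 0 < j) (hodd : ∀ n, φ (-n) = -φ n)
    (hper : ∀ n, φ (n + (2 * p * j : ℕ)) = φ n) (hreal : ∀ n, (starRingEnd ℂ) (φ n) = φ n)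
    {γ : SL(2, ℤ)} (hγ : γ ∈ CongruenceSubgroup.Gamma (4 * p * j ^ 2)) :
    SlashRelation (falseTheta p φ) γ := by
  rcases lt_trichotomy (γ 1 0) 0 with hc | hc | hc
  · have hdet : γ 0 0 * γ 1 1 - γ 0 1 * γ 1 0 = 1 := by
      have := γ.det_coe
      rwa [Matrix.det_fin_two] at this
    obtain ⟨ha, hb, hcd, hd⟩ := mem_Gamma_coords hγ
    set γ' : SL(2, ℤ) := ⟨!![γ 0 0, -γ 0 1; -γ 1 0, γ 1 1], by
      rw [Matrix.det_fin_two_of]; linarith⟩ with hγ'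
    have hmem : γ' ∈ CongruenceSubgroup.Gamma (4 * p * j ^ 2) := by
      rw [CongruenceSubgroup.Gamma_mem] at hγ ⊢
      obtain ⟨h1, h2, h3, h4⟩ := hγ
      refine ⟨h1, ?_, ?_, h4⟩
      · change ((-γ 0 1 : ℤ) : ZMod (4 * p * j ^ 2)) = 0
        rw [Int.cast_neg, h2, neg_zero]
      · change ((-γ 1 0 : ℤ) : ZMod (4 * p * j ^ 2)) = 0
        rw [Int.cast_neg, h3, neg_zero]
    have h4 : (4 : ℤ) ∣ γ 1 1 - 1 := (by push_cast; exact ⟨p * j ^ 2, by ring⟩ :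
      (4 : ℤ) ∣ ((4 * p * j ^ 2 : ℕ) : ℤ)).trans hd
    refine SlashRelation.of_conj hreal (γ' := γ') rfl rfl rfl rfl hc h4 ?_
    refine slashRelation_of_pos hp hj hodd hper hmem ?_
    change 0 < -γ 1 0
    omega
  · exact slashRelation_of_zero hp hγ hc
  · exact slashRelation_of_pos hp hj hodd hper hγ hc

end

/-- An analytic function that is `O(t^N)` along the positive imaginary axis vanishes to order `N`. -/
lemma isBigO_of_isBigO_vertical {g : ℂ → ℂ} (hg : AnalyticAt ℂ g 0) (N : ℕ)
    (h : (fun t : ℝ => g (I * t)) =O[𝓝[>] (0 : ℝ)] fun t : ℝ => t ^ N) :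
    g =O[𝓝 0] fun ε => ε ^ N := by
  by_cases hN : (N : ℕ∞) ≤ analyticOrderAt g 0
  · obtain ⟨u, hu, heq⟩ := (natCast_le_analyticOrderAt hg).1 hN
    have h1 : (fun ε : ℂ => ε ^ N * u ε) =O[𝓝 0] fun ε => ε ^ N * (1 : ℂ) :=
      (isBigO_refl (fun ε : ℂ => ε ^ N) _).mul (hu.continuousAt.tendsto.isBigO_one ℂ)
    simp only [mul_one] at h1
    refine h1.congr' ?_ (Eventually.of_forall fun _ => rfl)
    filter_upwards [heq] with ε hε
    rw [hε, sub_zero, smul_eq_mul]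
  · exfalso
    push Not at hN
    obtain ⟨k, hk⟩ : ∃ k : ℕ, analyticOrderAt g 0 = k :=
      ⟨_, (ENat.natCast_toNat (ne_top_of_lt hN)).symm⟩
    have hkN : k < N := by rw [hk] at hN; exact_mod_cast hN
    obtain ⟨u, hu, hu0, heq⟩ := (hg.analyticOrderAt_eq_natCast).1 hk
    have hpath : Tendsto (fun t : ℝ => I * t) (𝓝[>] 0) (𝓝 0) := by
      have : Continuous fun t : ℝ => I * t := by fun_prop
      simpa using (this.tendsto 0).mono_left nhdsWithin_le_nhds
    obtain ⟨C, hC⟩ := h.bound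
    have hle : ∀ᶠ t : ℝ in 𝓝[>] 0, ‖u (I * t)‖ ≤ C * t ^ (N - k) := by
      filter_upwards [hC, hpath.eventually heq, self_mem_nhdsWithin] with t h1 h2 h3
      have ht : (0 : ℝ) < t := h3
      rw [h2, sub_zero, smul_eq_mul, norm_mul, norm_pow, norm_mul, norm_I, one_mul, norm_real,
        Real.norm_of_nonneg ht.le, Real.norm_of_nonneg (by positivity)] at h1
      have e : t ^ N = t ^ k * t ^ (N - k) := by rw [← pow_add]; congr 1; omega
      rw [e] at h1
      have := pow_pos ht k
      nlinarith
    have hlim1 : Tendsto (fun t : ℝ => ‖u (I * t)‖) (𝓝[>] 0) (𝓝 ‖u 0‖) :=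
      (hu.continuousAt.tendsto.comp hpath).norm
    have hlim2 : Tendsto (fun t : ℝ => C * t ^ (N - k)) (𝓝[>] 0) (𝓝 0) := by
      have : Continuous fun t : ℝ => C * t ^ (N - k) := by fun_prop
      have h0 := (this.tendsto 0).mono_left (nhdsWithin_le_nhds (s := Set.Ioi 0))
      rwa [zero_pow (by omega), mul_zero] at h0
    have := le_of_tendsto_of_tendsto hlim1 hlim2 hle
    exact hu0 (norm_le_zero_iff.1 this)

lemma moebius_add_sub {K : Type} [Field K] (γ : SL(2, ℤ)) {x ε : K}
    (h1 : (γ 1 0 : K) * x + (γ 1 1 : K) ≠ 0) (h2 : (γ 1 0 : K) * (x + ε) + (γ 1 1 : K) ≠ 0) :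
    moebius γ (x + ε) - moebius γ x =
      ε / (((γ 1 0 : K) * x + (γ 1 1 : K)) * ((γ 1 0 : K) * (x + ε) + (γ 1 1 : K))) := by
  have hdet : (γ 0 0 : K) * (γ 1 1 : K) - (γ 0 1 : K) * (γ 1 0 : K) = 1 := by
    have := γ.det_coe
    rw [Matrix.det_fin_two] at this
    exact_mod_cast congrArg (Int.cast : ℤ → K) this
  rw [moebius, moebius, div_sub_div _ _ h2 h1, mul_comm ((γ 1 0 : K) * x + (γ 1 1 : K))]
  congr 1
  linear_combination ε * hdet

lemma moebius_ofReal (γ : SL(2, ℤ)) (x : ℝ) : moebius γ (x : ℂ) = ((moebius γ x : ℝ) : ℂ) := by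
  simp [moebius]

lemma moebius_ratCast (γ : SL(2, ℤ)) (x : ℚ) : moebius γ (x : ℝ) = ((moebius γ x : ℚ) : ℝ) := by
  simp [moebius]

/-- A Möbius transformation maps a vertical path into the cone around the vertical direction. -/
lemma mem_cone_div {X c t : ℝ} (hX : X ≠ 0) (ht : 0 < t) (htc : |c| * t ≤ |X| / 2) :
    0 < (I * t / (X * (X + c * (I * t)))).im ∧
      |(I * t / (X * (X + c * (I * t)))).re| ≤ (I * t / (X * (X + c * (I * t)))).im / 2 ∧
      ‖I * t / (X * (X + c * (I * t)))‖ ≤ 2 / X ^ 2 * t := by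
  have hD : 0 < X ^ 2 + c ^ 2 * t ^ 2 := by positivity
  have hXC : (X : ℂ) ≠ 0 := ofReal_ne_zero.2 hX
  have hden : (X : ℂ) + c * (I * t) ≠ 0 := by
    intro h
    have := congrArg Complex.re h
    simp at this
    exact hX this
  have e : I * t / (X * (X + c * (I * t))) =
      ((c * t ^ 2 / (X * (X ^ 2 + c ^ 2 * t ^ 2)) : ℝ) : ℂ) +
        ((t / (X ^ 2 + c ^ 2 * t ^ 2) : ℝ) : ℂ) * I := by
    have hDC : (X : ℂ) ^ 2 + c ^ 2 * t ^ 2 ≠ 0 := by exact_mod_cast hD.ne'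
    have htC : (t : ℂ) ≠ 0 := ofReal_ne_zero.2 ht.ne'
    rw [div_eq_iff (mul_ne_zero hXC hden)]
    obtain ⟨D, hDdef⟩ : ∃ D : ℂ, D = (X : ℂ) ^ 2 + c ^ 2 * t ^ 2 := ⟨_, rfl⟩
    push_cast
    rw [← hDdef] at hDC ⊢
    field_simp
    rw [hDdef]
    linear_combination (-(c : ℂ) * X * t) * I_sq
  have hre : (I * t / (X * (X + c * (I * t)))).re = c * t ^ 2 / (X * (X ^ 2 + c ^ 2 * t ^ 2)) := by
    rw [e, add_re, ofReal_re, re_ofReal_mul, I_re, mul_zero, add_zero]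
  have him : (I * t / (X * (X + c * (I * t)))).im = t / (X ^ 2 + c ^ 2 * t ^ 2) := by
    rw [e, add_im, ofReal_im, im_ofReal_mul, I_im, mul_one, zero_add]
  have hXabs : 0 < |X| := abs_pos.2 hX
  have hle : |(I * t / (X * (X + c * (I * t)))).re| ≤ (I * t / (X * (X + c * (I * t)))).im / 2 := by
    rw [hre, him, abs_div, abs_mul, abs_mul, abs_of_pos hD, abs_of_pos (show 0 < t ^ 2 by positivity),
      div_div, div_le_div_iff₀ (by positivity) (by positivity)]
    have : |c| * t * (t * (X ^ 2 + c ^ 2 * t ^ 2)) ≤ |X| / 2 * (t * (X ^ 2 + c ^ 2 * t ^ 2)) :=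
      mul_le_mul_of_nonneg_right htc (by positivity)
    nlinarith
  refine ⟨by rw [him]; positivity, hle, ?_⟩
  have h1 := norm_le_abs_re_add_abs_im (I * t / (X * (X + c * (I * t))))
  have h2 : (I * t / (X * (X + c * (I * t)))).im ≤ t / X ^ 2 := by
    rw [him]
    exact div_le_div_of_nonneg_left ht.le (by positivity) (by nlinarith [sq_nonneg (c * t)])
  have h3 : 0 < (I * t / (X * (X + c * (I * t)))).im := by rw [him]; positivity
  rw [abs_of_pos h3] at h1
  have h4 : 2 / X ^ 2 * t = 2 * (t / X ^ 2) := by ring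
  rw [h4]
  linarith

lemma HasConeExpansion.isBigO_comp {F : ℂ → ℂ} {y : ℂ} {a : ℕ → ℂ} (h : HasConeExpansion F y a)
    {X c : ℝ} (hX : X ≠ 0) (N : ℕ) :
    (fun t : ℝ => F (y + I * t / (X * (X + c * (I * t)))) -
      truncEval a N (I * t / (X * (X + c * (I * t))))) =O[𝓝[>] (0 : ℝ)] fun t : ℝ => t ^ N := by
  obtain ⟨C, r, hr, hC⟩ := h N
  have hsmall : ∀ {f : ℝ → ℝ} {b : ℝ}, Continuous f → f 0 < b → ∀ᶠ t in 𝓝[>] (0 : ℝ), f t < b :=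
    fun hf h0 => (hf.continuousAt.eventually_lt continuousAt_const h0).filter_mono nhdsWithin_le_nhds
  refine IsBigO.of_bound (|C| * (2 / X ^ 2) ^ N) ?_
  filter_upwards [self_mem_nhdsWithin,
    hsmall (f := fun t => |c| * t) (b := |X| / 2) (by fun_prop) (by simpa using hX),
    hsmall (f := fun t => 2 / X ^ 2 * t) (b := r) (by fun_prop) (by simpa using hr)] with t ht h1 h2
  obtain ⟨g1, g2, g3⟩ := mem_cone_div hX ht h1.le
  refine (hC _ g1 g2 (g3.trans h2.le)).trans ?_
  have ht' : (0 : ℝ) < t := ht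
  calc C * ‖I * t / (X * (X + c * (I * t)))‖ ^ N ≤ |C| * (2 / X ^ 2 * t) ^ N :=
        mul_le_mul (le_abs_self C) (pow_le_pow_left₀ (norm_nonneg _) g3 N) (by positivity) (abs_nonneg C)
    _ = |C| * (2 / X ^ 2) ^ N * ‖t ^ N‖ := by
      rw [Real.norm_of_nonneg (by positivity), mul_pow]; ring

lemma HasConeExpansion.isBigO_vertical {F : ℂ → ℂ} {y : ℂ} {a : ℕ → ℂ} (h : HasConeExpansion F y a)
    (N : ℕ) :
    (fun t : ℝ => F (y + I * t) - truncEval a N (I * t)) =O[𝓝[>] (0 : ℝ)] fun t : ℝ => t ^ N := by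
  simpa using h.isBigO_comp (X := 1) (c := 0) one_ne_zero N

/-- The expansions at `x` and at `γx` differ, up to the slash factor, by the Taylor series of `h`. The
difference is analytic and small on a vertical path, hence small on the real line. -/
theorem isBigO_of_slashRelation {F : ℂ → ℂ} {γ : SL(2, ℤ)} {h : ℝ → ℂ} {x : ℝ} {a a' : ℕ → ℂ}
    (hx : (γ 1 0 : ℝ) * x + (γ 1 1 : ℝ) ≠ 0) (ha : HasConeExpansion F x a)
    (ha' : HasConeExpansion F ((moebius γ x : ℝ) : ℂ) a') {J H : ℂ → ℂ} (hJ : AnalyticAt ℂ J 0)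
    (hH : AnalyticAt ℂ H 0) (hJr : ∀ᶠ ε : ℝ in 𝓝 0, J ε = slashFactor 1 γ (x + ε))
    (hHr : ∀ᶠ ε : ℝ in 𝓝 0, H ε = h (x + ε))
    (hrel : ∀ᶠ t : ℝ in 𝓝[>] 0,
      F (x + I * t) - J (I * t) * F (moebius γ (x + I * t : ℂ)) = H (I * t)) (N : ℕ) :
    (fun ε : ℝ => truncEval a N ε - slashFactor 1 γ (x + ε) *
        truncEval a' N ((moebius γ (x + ε) - moebius γ x : ℝ) : ℂ) - h (x + ε))
      =O[𝓝 (0 : ℝ)] fun ε : ℝ => ε ^ N := by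
  set c : ℝ := (γ 1 0 : ℝ) with hc
  set X : ℝ := c * x + (γ 1 1 : ℝ) with hXdef
  set m : ℂ → ℂ := fun ε => ε / (X * (X + c * ε)) with hm
  have hXC : (X : ℂ) ≠ 0 := ofReal_ne_zero.2 hx
  have hman : AnalyticAt ℂ m 0 := by
    refine analyticAt_id.div (by fun_prop) ?_
    simpa using hXC
  have htan : ∀ (b : ℕ → ℂ) {f : ℂ → ℂ}, AnalyticAt ℂ f 0 →
      AnalyticAt ℂ (fun ε => truncEval b N (f ε)) 0 := by
    intro b f hf
    simp only [truncEval]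
    exact Finset.analyticAt_fun_sum _ fun r _ => analyticAt_const.mul (hf.pow r)
  have hden : ∀ ε : ℂ, ((γ 1 0 : ℤ) : ℂ) * (x + ε) + ((γ 1 1 : ℤ) : ℂ) = X + c * ε := by
    intro ε; rw [hXdef, hc]; push_cast; ring
  have hmoeb : ∀ ε : ℂ, (X : ℂ) + c * ε ≠ 0 →
      moebius γ (x + ε : ℂ) = ((moebius γ x : ℝ) : ℂ) + m ε := by
    intro ε hε
    have h0 := hden 0
    rw [add_zero, mul_zero, add_zero] at h0
    have := moebius_add_sub γ (x := (x : ℂ)) (ε := ε) (by rwa [h0]) (by rwa [hden])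
    rw [hden, h0, moebius_ofReal] at this
    rw [← sub_eq_iff_eq_add', this]
  have key : (fun ε : ℂ => truncEval a N ε - J ε * truncEval a' N (m ε) - H ε) =O[𝓝 0]
      fun ε => ε ^ N := by
    refine isBigO_of_isBigO_vertical
      (((htan a analyticAt_id).sub (hJ.mul (htan a' hman))).sub hH) N ?_
    have hpath : Tendsto (fun t : ℝ => I * t) (𝓝[>] 0) (𝓝 0) := by
      have : Continuous fun t : ℝ => I * t := by fun_prop
      simpa using (this.tendsto 0).mono_left nhdsWithin_le_nhds
    have h1 := (ha.isBigO_vertical N).neg_left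
    have h2 := ((hJ.continuousAt.tendsto.comp hpath).isBigO_one ℝ).mul (ha'.isBigO_comp (c := c) hx N)
    simp only [one_mul] at h2
    refine (h1.add h2).congr' ?_ (Eventually.of_forall fun _ => rfl)
    filter_upwards [hrel, self_mem_nhdsWithin] with t ht _
    have hne : (X : ℂ) + c * (I * t) ≠ 0 := by
      intro h0
      have := congrArg Complex.re h0
      simp at this
      exact hx this
    rw [hmoeb _ hne] at ht
    simp only [Function.comp]
    change _ = truncEval a N (I * t) - J (I * t) * truncEval a' N (m (I * t)) - H (I * t)
    rw [← ht]
    ring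
  have hofReal : Tendsto (fun ε : ℝ => (ε : ℂ)) (𝓝 0) (𝓝 0) := by
    simpa using continuous_ofReal.tendsto 0
  have key' : (fun ε : ℝ => truncEval a N ε - J ε * truncEval a' N (m ε) - H ε) =O[𝓝 (0 : ℝ)]
      fun ε : ℝ => ε ^ N := by
    refine (key.comp_tendsto hofReal).trans (IsBigO.of_bound 1 (Eventually.of_forall fun ε => ?_))
    simp
  have hne : ∀ᶠ ε : ℝ in 𝓝 0, X + c * ε ≠ 0 := by
    have : Continuous fun ε : ℝ => X + c * ε := by fun_prop
    exact this.continuousAt.eventually_ne (by simpa using hx)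
  refine key'.congr' ?_ (Eventually.of_forall fun _ => rfl)
  filter_upwards [hJr, hHr, hne] with ε h1 h2 h3
  have h4 := hmoeb ε (by exact_mod_cast h3)
  rw [← ofReal_add, moebius_ofReal] at h4
  rw [h1, h2, ofReal_sub, h4, add_sub_cancel_left]

/-- Quantum modularity of false theta series with real odd periodic coefficients. -/
theorem exists_quantumModularForm {p j : ℕ} {φ : ℤ → ℂ} (hp : 0 < p) (hj : 0 < j)
    (hodd : ∀ n, φ (-n) = -φ n) (hper : ∀ n, φ (n + (2 * p * j : ℕ)) = φ n)
    (hreal : ∀ n, (starRingEnd ℂ) (φ n) = φ n) :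
    ∃ (f : ℚ → ℂ) (a : ℚ → ℕ → ℂ),
      (∀ x : ℚ, Tendsto (fun t : ℝ => falseTheta p φ (x + I * t)) (𝓝[>] 0) (𝓝 (f x))) ∧
      IsQuantumModularForm 1 (fun _ => 1) (CongruenceSubgroup.Gamma (4 * p * j ^ 2)) f ∧
      (∀ x : ℚ, a x 0 = f x) ∧
      IsRadialExpansion (falseTheta p φ) a ∧
      IsStrongQuantumModularForm 1 (fun _ => 1) (CongruenceSubgroup.Gamma (4 * p * j ^ 2)) a := by
  choose a ha using exists_hasConeExpansion (p := p) (φ := φ) hp hj hodd hper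
  have hradial : IsRadialExpansion (falseTheta p φ) a := fun x N => (ha x).isBigO_vertical N
  have hstrong : ∀ γ ∈ CongruenceSubgroup.Gamma (4 * p * j ^ 2), ∃ h : ℝ → ℂ, IsNiceFor γ h ∧
      ∀ x : ℚ, (γ 1 0 : ℚ) * x + (γ 1 1 : ℚ) ≠ 0 → ContinuousAt h x ∧
        ∃ J H : ℂ → ℂ, AnalyticAt ℂ J 0 ∧ AnalyticAt ℂ H 0 ∧
          (∀ᶠ ε : ℝ in 𝓝 0, J ε = slashFactor 1 γ (x + ε)) ∧
          (∀ᶠ ε : ℝ in 𝓝 0, H ε = h (x + ε)) ∧ ∀ N : ℕ,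
        (fun ε : ℝ => truncEval (a x) N ε - slashFactor 1 γ (x + ε) * truncEval (a (moebius γ x)) N
          ((moebius γ ((x : ℝ) + ε) - moebius γ (x : ℝ) : ℝ) : ℂ) - h (x + ε))
          =O[𝓝 (0 : ℝ)] fun ε : ℝ => ε ^ N := by
    intro γ hγ
    obtain ⟨h, hnice, hrel⟩ := slashRelation hp hj hodd hper hreal hγ
    refine ⟨h, hnice, fun x hx => ?_⟩
    have hx' : (γ 1 0 : ℝ) * (x : ℝ) + (γ 1 1 : ℝ) ≠ 0 := by exact_mod_cast hx
    obtain ⟨J, H, hJ, hH, hJr, hHr, hr⟩ := hrel x hx'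
    refine ⟨hnice.1.continuous.continuousAt, J, H, hJ, hH, hJr, hHr, fun N => ?_⟩
    have h1 : HasConeExpansion (falseTheta p φ) ((x : ℝ) : ℂ) (a x) := by
      rw [ofReal_ratCast]; exact ha x
    have h2 : HasConeExpansion (falseTheta p φ) ((moebius γ (x : ℝ) : ℝ) : ℂ) (a (moebius γ x)) := by
      rw [moebius_ratCast, ofReal_ratCast]; exact ha _
    exact isBigO_of_slashRelation hx' h1 h2 hJ hH hJr hHr hr N
  refine ⟨fun x => a x 0, a, fun x => ?_, fun γ hγ => ?_, fun x => rfl, hradial, fun γ hγ => ?_⟩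
  · have h1 := hradial x 1
    simp only [pow_one, truncEval, Finset.sum_range_one, pow_zero, mul_one] at h1
    have h2 : Tendsto (fun t : ℝ => t) (𝓝[>] 0) (𝓝 0) := nhdsWithin_le_nhds
    have := (h1.trans_tendsto h2).add_const (a x 0)
    simpa using this
  · obtain ⟨h, hnice, hx⟩ := hstrong γ hγ
    refine ⟨h, hnice, fun x hne => ?_⟩
    obtain ⟨-, J, H, -, -, -, -, hN⟩ := hx x hne
    -- at `ε = 0` the estimate for `N = 1` is an equality
    have h0 := (hN 1).eq_zero_imp.self_of_nhds (by simp)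
    simp only [truncEval, Finset.sum_range_one, pow_zero, mul_one, add_zero] at h0
    simp only [map_one, one_mul]
    exact sub_eq_zero.1 h0
  · obtain ⟨h, hnice, hx⟩ := hstrong γ hγ
    refine ⟨h, hnice, fun x hne N => ?_⟩
    obtain ⟨-, J, H, -, -, -, -, hN⟩ := hx x hne
    simpa only [map_one, one_mul] using hN N

end FalseTheta

/-! ### The coefficients of the false theta series of a Brieskorn sphere -/

namespace FalseTheta

open Complex

section

variable {p : ℕ} {α c : ℤ} {ζ : ℂ} {j : ℕ}

lemma phiPart_add_period (hp : 0 < p) (hζ0 : ζ ≠ 0) (hζ : ζ ^ j = 1) (n : ℤ) :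
    phiPart p α c (n + (2 * p * j : ℕ)) ζ = phiPart p α c n ζ := by
  have hp2 : (2 * p : ℤ) ≠ 0 := by positivity
  have hmod : ∀ β : ℤ, n + (2 * p * j : ℕ) ≡ β [ZMOD 2 * p] ↔ n ≡ β [ZMOD 2 * p] := by
    intro β
    have : n + (2 * p * j : ℕ) ≡ n [ZMOD 2 * p] := by
      rw [Int.modEq_iff_dvd]
      exact ⟨-j, by push_cast; ring⟩
    exact ⟨fun h => this.symm.trans h, fun h => this.trans h⟩
  have hpow : ∀ k : ℤ, ζ ^ (k + j) = ζ ^ k := by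
    intro k
    rw [zpow_add₀ hζ0, zpow_natCast, hζ, mul_one]
  have hadd : ∀ k : ℤ, ζ ^ ((k + (2 * p * j : ℕ)) / (2 * p)) = ζ ^ (k / (2 * p)) := by
    intro k
    have : (k + (2 * p * j : ℕ)) / (2 * p) = k / (2 * p) + j := by
      rw [← Int.add_mul_ediv_right k j hp2]; congr 1; push_cast; ring
    rw [this, hpow]
  have hsub : ∀ k : ℤ, ζ ^ ((k - (2 * p * j : ℕ)) / (2 * p)) = ζ ^ (k / (2 * p)) := by
    intro k
    rw [← hadd (k - (2 * p * j : ℕ)), sub_add_cancel]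
  have e1 : ∀ n' : ℤ, n' + (2 * p * j : ℕ) - c = n' - c + (2 * p * j : ℕ) := fun _ => by ring
  have e2 : ∀ n' : ℤ, -(n' + (2 * p * j : ℕ)) + c = -n' + c - (2 * p * j : ℕ) := fun _ => by ring
  have e3 : ∀ n' : ℤ, n' + (2 * p * j : ℕ) + c = n' + c + (2 * p * j : ℕ) := fun _ => by ring
  have e4 : ∀ n' : ℤ, -(n' + (2 * p * j : ℕ)) - c = -n' - c - (2 * p * j : ℕ) := fun _ => by ring
  simp only [phiPart, hmod, e1, e2, e3, e4, hadd, hsub]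

lemma phiPart_neg (hp : ¬ (p : ℤ) ∣ α) (n : ℤ) :
    phiPart p α c (-n) ζ = -phiPart p α c n ζ := by
  have hnot : ∀ m : ℤ, m ≡ α [ZMOD 2 * p] → ¬ m ≡ -α [ZMOD 2 * p] := by
    intro m h1 h2
    obtain ⟨k, hk⟩ := Int.modEq_iff_dvd.1 (h2.symm.trans h1)
    exact hp ⟨k, by linarith⟩
  have hneg : ∀ m : ℤ, -m ≡ α [ZMOD 2 * p] ↔ m ≡ -α [ZMOD 2 * p] := fun m =>
    ⟨fun h => by simpa using h.neg, fun h => by simpa using h.neg⟩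
  have hneg' : ∀ m : ℤ, -m ≡ -α [ZMOD 2 * p] ↔ m ≡ α [ZMOD 2 * p] := fun m =>
    ⟨fun h => by simpa using h.neg, fun h => h.neg⟩
  simp only [phiPart, hneg, hneg', neg_neg]
  by_cases h1 : n ≡ α [ZMOD 2 * p]
  · rw [if_pos h1, if_neg (hnot n h1), if_pos h1]; ring
  · by_cases h2 : n ≡ -α [ZMOD 2 * p]
    · rw [if_pos h2, if_neg h1, if_pos h2]; ring
    · rw [if_neg h1, if_neg h1, if_neg h2, if_neg h2]; ring

/-- For `|ζ| = 1` complex conjugation exchanges the two powers of `ζ`. -/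
lemma conj_phiPart (hc : c ≡ α [ZMOD 2 * p]) (hζ : ‖ζ‖ = 1) (n : ℤ) :
    (starRingEnd ℂ) (phiPart p α c n ζ) = phiPart p α c n ζ := by
  have hconj : (starRingEnd ℂ) ζ = ζ⁻¹ := (inv_eq_conj hζ).symm
  have key : ∀ m : ℤ, (2 * p : ℤ) ∣ m →
      (starRingEnd ℂ) (ζ ^ (m / (2 * p)) + ζ ^ (-m / (2 * p))) =
        ζ ^ (m / (2 * p)) + ζ ^ (-m / (2 * p)) := by
    intro m hm
    rw [Int.neg_ediv_of_dvd hm, map_add, map_zpow₀, map_zpow₀, hconj, inv_zpow', inv_zpow', neg_neg,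
      add_comm]
  simp only [phiPart]
  split_ifs with h1 h2
  · have := key (-n + c) (by rw [neg_add_eq_sub]; exact Int.modEq_iff_dvd.1 (h1.trans hc.symm))
    rw [show -(-n + c) = n - c by ring] at this
    rw [map_mul, this, map_div₀, map_one, map_ofNat]
  · have h3 : n ≡ -c [ZMOD 2 * p] := h2.trans hc.neg.symm
    have := key (n + c) (by simpa using Int.modEq_iff_dvd.1 h3.symm)
    rw [show -(n + c) = -n - c by ring] at this
    rw [map_mul, this, map_neg, map_div₀, map_one, map_ofNat]
  · simp

end

section

variable {b : Fin 3 → ℕ} {ζ : ℂ} {j : ℕ}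

/-- The residues `α_k` are congruent to `- b₁ b₂` modulo `b₀`, hence not divisible by `p`. -/
lemma not_dvd_alpha (hb : 2 ≤ b 0) (h01 : (b 0).Coprime (b 1)) (h02 : (b 0).Coprime (b 2)) (α : ℤ)
    (h : (b 0 : ℤ) ∣ α + b 1 * b 2) : ¬ ((b 0 * b 1 * b 2 : ℕ) : ℤ) ∣ α := by
  intro hα
  have h1 : (b 0 : ℤ) ∣ α := by
    refine dvd_trans ?_ hα
    push_cast
    exact ⟨b 1 * b 2, by ring⟩
  have h2 : (b 0 : ℤ) ∣ b 1 * b 2 := (Int.dvd_add_right h1).1 h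
  have h3 : b 0 ∣ b 1 * b 2 := by exact_mod_cast h2
  have h4 := Nat.Coprime.eq_one_of_dvd (h01.mul_right h02) h3
  omega

lemma phi_neg (hb : 2 ≤ b 0) (h01 : (b 0).Coprime (b 1)) (h02 : (b 0).Coprime (b 2)) (n : ℤ) :
    phi b (-n) ζ = -phi b n ζ := by
  have h := not_dvd_alpha hb h01 h02
  simp only [phi]
  rw [phiPart_neg (h _ ⟨b 1 * b 2 + b 1 - b 2, by ring⟩),
    phiPart_neg (h _ ⟨b 1 * b 2 - b 1 + b 2, by ring⟩),
    phiPart_neg (h _ ⟨b 1 * b 2 - b 1 - b 2, by ring⟩),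
    phiPart_neg (h _ ⟨b 1 * b 2 + b 1 + b 2, by ring⟩)]
  ring

lemma phi_add_period (hp : 0 < b 0 * b 1 * b 2) (hj : 0 < j) (hζ : ζ ^ j = 1) (n : ℤ) :
    phi b (n + (2 * (b 0 * b 1 * b 2) * j : ℕ)) ζ = phi b n ζ := by
  have hζ0 : ζ ≠ 0 := by rintro rfl; rw [zero_pow hj.ne'] at hζ; exact zero_ne_one hζ
  simp only [phi]
  rw [phiPart_add_period hp hζ0 hζ, phiPart_add_period hp hζ0 hζ, phiPart_add_period hp hζ0 hζ,
    phiPart_add_period hp hζ0 hζ]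

lemma conj_phi (hζ : ‖ζ‖ = 1) (n : ℤ) : (starRingEnd ℂ) (phi b n ζ) = phi b n ζ := by
  simp only [phi, map_sub, map_add]
  rw [conj_phiPart (Int.ModEq.refl _) hζ, conj_phiPart (Int.ModEq.refl _) hζ,
    conj_phiPart (Int.modEq_iff_dvd.2 ⟨-1, by ring⟩) hζ,
    conj_phiPart (Int.modEq_iff_dvd.2 ⟨1, by ring⟩) hζ]

lemma ATerm_eq (τ : ℂ) (n : ℕ) :
    ATerm b ζ τ n = phi b n ζ * expi (n ^ 2 / (4 * (b 0 * b 1 * b 2 : ℕ)) * τ) := by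
  rw [ATerm, qpow, expi]
  congr 2
  push_cast
  ring

lemma ASeries_eq_falseTheta :
    ASeries b ζ = falseTheta (b 0 * b 1 * b 2) fun n => phi b n ζ := by
  funext τ
  exact tsum_congr fun n => ATerm_eq τ n

lemma summable_ATerm (hp : 0 < b 0 * b 1 * b 2) (hj : 0 < j) (hζ : ζ ^ j = 1) {τ : ℂ}
    (hτ : 0 < τ.im) : Summable (ATerm b ζ τ) := by
  obtain ⟨B, hB⟩ := exists_bound_of_periodic (f := fun n => phi b n ζ) (by positivity : 0 < 2 * (b 0 * b 1 * b 2) * j)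
    (phi_add_period (b := b) hp hj hζ)
  have hpR : (0 : ℝ) < (b 0 * b 1 * b 2 : ℕ) := by exact_mod_cast hp
  have := summable_eichler (κ := Real.pi / (2 * (b 0 * b 1 * b 2 : ℕ))) (s := -(I * τ))
    (ψ := fun n => phi b n ζ) (by have := Real.pi_pos; positivity) ⟨B, fun n => hB n⟩ (by simpa using hτ)
  refine this.congr fun n => ?_
  rw [ATerm_eq, expi]
  congr 2
  push_cast
  field_simp
  ring

end

end FalseTheta

/-! ### Linear chains and continued fractions -/

namespace FalseTheta

/-- The solution, normalized to be `1` at the last vertex and `0` beyond it, of the three-term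
recursion attached to a leg. Its value at `0` belongs to the vertex before the leg, and its value at
`a + 1` to the `a`-th vertex of the leg. -/
def chain : List ℤ → ℕ → ℤ
  | [], 0 => 1
  | [], _ + 1 => 0
  | m :: l, 0 => -m * chain l 0 - chain l 1
  | _ :: l, a + 1 => chain l a

/-- The value at the sequence `s` of the quadratic form of a leg, including the interaction with the
vertex before the leg, which has the coordinate `s 0`. -/
def legForm {R : Type*} [CommRing R] : List ℤ → (ℕ → R) → R
  | [], _ => 0
  | m :: l, s => m * s 1 ^ 2 + 2 * s 0 * s 1 + legForm l fun a => s (a + 1)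

/-- The solutions of the recursion that vanish beyond the end are the multiples of `chain`. -/
lemma eq_chain_smul {N : Type*} [AddCommGroup N] (l : List ℤ) (f : ℕ → N)
    (hrec : ∀ (a : ℕ) (h : a < l.length), f a + l[a] • f (a + 1) + f (a + 2) = 0)
    (hend : f (l.length + 1) = 0) (a : ℕ) (ha : a ≤ l.length + 1) :
    f a = chain l a • f l.length := by
  induction l generalizing f a with
  | nil =>
    match a, ha with
    | 0, _ => simp [chain]
    | 1, _ => simpa [chain] using hend
  | cons m l ih =>
    have key : ∀ a, a ≤ l.length + 1 → f (a + 1) = chain l a • f (l.length + 1) :=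
      ih (fun a => f (a + 1)) (fun a h => hrec (a + 1) (by simpa using h)) hend
    match a with
    | a + 1 =>
      rw [key a (by simpa using ha)]
      rfl
    | 0 =>
      have h0 := hrec 0 (by simp)
      have h1 := key 0 (by omega)
      have h2 := key 1 (by omega)
      simp only [List.getElem_cons_zero, zero_add] at h0 h1 h2
      change f 2 = _ at h2
      rw [h1, h2, smul_smul] at h0
      rw [List.length_cons, chain, sub_smul, neg_mul, neg_smul]
      have : f 0 = -((m * chain l 0) • f (l.length + 1)) - chain l 1 • f (l.length + 1) := by
        rw [eq_sub_iff_add_eq, eq_neg_iff_add_eq_zero, ← h0]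
        abel
      exact this

/-- The form of a leg in terms of its rows. The first summand is the contribution of the leg to the row of
the preceding vertex. -/
lemma sum_chain_eq_legForm {R : Type*} [CommRing R] (l : List ℤ) (s : ℕ → R)
    (hend : s (l.length + 1) = 0) :
    s 0 * s 1 + ∑ a : Fin l.length, s (a + 1) * (s a + l[a] • s (a + 1) + s (a + 2)) = legForm l s := by
  induction l generalizing s with
  | nil =>
    have : s 1 = 0 := hend
    simp [legForm, this]
  | cons m l ih =>
    rw [legForm, ← ih (fun a => s (a + 1)) hend]
    simp only [List.length_cons, Fin.sum_univ_succ]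
    simp
    ring

lemma legForm_congr {R : Type*} [CommRing R] (l : List ℤ) {s s' : ℕ → R}
    (h : ∀ a ≤ l.length, s a = s' a) : legForm l s = legForm l s' := by
  induction l generalizing s s' with
  | nil => rfl
  | cons m l ih =>
    rw [legForm, legForm, h 0 (by simp), h 1 (by simp),
      ih fun a ha => h (a + 1) (by simpa using ha)]

lemma legForm_zero {R : Type*} [CommRing R] (l : List ℤ) : legForm l (fun _ => (0 : R)) = 0 := by
  induction l with
  | nil => rfl
  | cons m l ih => simp [legForm, ih]

lemma legForm_chain (l : List ℤ) : legForm l (chain l) = chain l 0 * chain l 1 := by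
  induction l with
  | nil => simp [legForm, chain]
  | cons m l ih =>
    have : (fun a => chain (m :: l) (a + 1)) = chain l := rfl
    rw [legForm, this, ih]
    simp only [chain]
    push_cast
    ring

/-- On a negative definite leg the sequence `chain` is positive. -/
lemma chain_pos {l : List ℤ} (h : ∀ s : ℕ → ℤ, s 0 = 0 → (∃ a < l.length, s (a + 1) ≠ 0) →
    legForm l s < 0) (a : ℕ) (ha : a ≤ l.length) : 0 < chain l a := by
  induction l generalizing a with
  | nil =>
    obtain rfl : a = 0 := by simpa using ha
    simp [chain]
  | cons m l ih =>
    have hl : ∀ s : ℕ → ℤ, s 0 = 0 → (∃ a < l.length, s (a + 1) ≠ 0) → legForm l s < 0 := by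
      intro s hs ⟨a, ha, hne⟩
      have := h (fun a => match a with | 0 => 0 | a + 1 => s a) rfl
        ⟨a + 1, by simpa using ha, hne⟩
      simpa [legForm, hs] using this
    match a with
    | a + 1 => exact ih hl a (by simpa using ha)
    | 0 =>
      have h0 := ih hl 0 (by omega)
      have := h (fun a => match a with | 0 => 0 | a + 1 => chain l a) rfl ⟨0, by simp, h0.ne'⟩
      simp only [legForm, mul_zero, zero_mul, add_zero] at this
      rw [show (fun a => chain l a) = chain l from rfl, legForm_chain] at this
      have h1 : chain (m :: l) 0 = -m * chain l 0 - chain l 1 := rfl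
      rw [h1]
      push_cast at this
      nlinarith

lemma isCoprime_chain (l : List ℤ) : IsCoprime (chain l 0) (chain l 1) := by
  induction l with
  | nil => exact isCoprime_one_left
  | cons m l ih =>
    obtain ⟨u, v, huv⟩ := ih
    refine ⟨-v, u - m * v, ?_⟩
    simp only [chain]
    linear_combination huv

/-- The continued fraction of a leg is a quotient of two consecutive values of `chain`. -/
lemma negContFrac_eq {l : List ℤ} (h : ∀ a ≤ l.length, 0 < chain l a) :
    negContFrac l = -((chain l 0 : ℚ) / chain l 1) := by
  induction l with
  | nil => simp [negContFrac, chain]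
  | cons m l ih =>
    have h' : ∀ a ≤ l.length, 0 < chain l a := fun a ha => h (a + 1) (by simpa using ha)
    have h0 : (chain l 0 : ℚ) ≠ 0 := by exact_mod_cast (h' 0 (by omega)).ne'
    rw [negContFrac, ih h']
    simp only [chain]
    push_cast
    rw [inv_neg, inv_div]
    field_simp
    ring

/-- All tails of the list have a negative continued fraction. -/
def IsNegLeg : List ℤ → Prop
  | [] => True
  | m :: l => negContFrac (m :: l) < 0 ∧ IsNegLeg l

/-- Completing the square along a leg. -/
lemma legForm_le {l : List ℤ} (h : IsNegLeg l) (s : ℕ → ℝ) :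
    legForm l s ≤ -((negContFrac l : ℚ) : ℝ)⁻¹ * s 0 ^ 2 ∧
      (s 0 = 0 → 0 ≤ legForm l s → ∀ a < l.length, s (a + 1) = 0) := by
  induction l generalizing s with
  | nil => simp [legForm, negContFrac]
  | cons m l ih =>
    obtain ⟨hκ, hl⟩ := h
    obtain ⟨h1, h2⟩ := ih hl fun a => s (a + 1)
    have hκR : ((negContFrac (m :: l) : ℚ) : ℝ) < 0 := by exact_mod_cast hκ
    have hκeq : ((negContFrac (m :: l) : ℚ) : ℝ) = m - ((negContFrac l : ℚ) : ℝ)⁻¹ := by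
      rw [negContFrac]; push_cast; rfl
    set κ : ℝ := ((negContFrac (m :: l) : ℚ) : ℝ) with hκdef
    have hκ0 : κ ≠ 0 := hκR.ne
    simp only [legForm, zero_add] at h1 h2 ⊢
    have hm : (m : ℝ) = κ + ((negContFrac l : ℚ) : ℝ)⁻¹ := by rw [hκeq]; ring
    constructor
    · have hsq : κ * (s 1 + s 0 / κ) ^ 2 ≤ 0 := mul_nonpos_of_nonpos_of_nonneg hκR.le (sq_nonneg _)
      have e : κ * (s 1 + s 0 / κ) ^ 2 = κ * s 1 ^ 2 + 2 * s 0 * s 1 + κ⁻¹ * s 0 ^ 2 := by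
        field_simp
        ring
      rw [hm]
      linarith
    · intro hs0 hnn a ha
      rw [hs0, hm] at hnn
      have h3 : s 1 = 0 := by
        by_contra hne
        have : 0 < s 1 ^ 2 := by positivity
        nlinarith
      have h4 : 0 ≤ legForm l fun a => s (a + 1) := by
        rw [h3] at hnn
        linarith
      match a with
      | 0 => exact h3
      | a + 1 => exact h2 h3 h4 a (by simpa using ha)

/-- Expansion of `-b/w` in a negative continued fraction: `b/w = ⌈b/w⌉ - w'/w` with `0 ≤ w' < w`. -/
lemma exists_leg (b w : ℕ) (hw : 0 < w) (hwb : w < b) (hcop : b.Coprime w) :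
    ∃ l : List ℤ, negContFrac l = -((b : ℚ) / w) ∧ IsNegLeg l := by
  induction w using Nat.strong_induction_on generalizing b with
  | _ w ih =>
    have hwQ : (0 : ℚ) < w := by exact_mod_cast hw
    have hbQ : (0 : ℚ) < b := by exact_mod_cast hw.trans hwb
    have hneg : -((b : ℚ) / w) < 0 := by
      rw [neg_lt_zero]; positivity
    rcases Nat.eq_or_lt_of_le (Nat.succ_le_of_lt hw) with h1 | h1
    · have h1' : w = 1 := h1.symm
      subst h1'
      have e : negContFrac [-(b : ℤ)] = -((b : ℚ) / (1 : ℕ)) := by simp [negContFrac]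
      exact ⟨[-(b : ℤ)], e, by rw [e]; exact hneg, trivial⟩
    · have hr : 0 < b % w := by
        refine Nat.pos_of_ne_zero fun h0 => ?_
        have := Nat.Coprime.eq_one_of_dvd hcop.symm (Nat.dvd_of_mod_eq_zero h0)
        omega
      have hrw : b % w < w := Nat.mod_lt _ hw
      have hdiv := Nat.mod_add_div b w
      have hcop' : w.Coprime (w - b % w) := by
        rw [Nat.coprime_self_sub_right hrw.le, Nat.coprime_comm, Nat.Coprime, ← Nat.gcd_rec]
        exact hcop.symm
      obtain ⟨l, hl, hneg'⟩ := ih (w - b % w) (by omega) w (by omega) (by omega) hcop'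
      -- the first weight is `-⌈b/w⌉ = -(q + 1)`, as `w` does not divide `b`
      obtain ⟨q, hq⟩ : ∃ q, q = b / w := ⟨_, rfl⟩
      rw [← hq] at hdiv
      have hsub : ((w - b % w : ℕ) : ℚ) = w - (b % w : ℕ) := by
        rw [Nat.cast_sub hrw.le]
      have e : negContFrac (-((q + 1 : ℕ) : ℤ) :: l) = -((b : ℚ) / w) := by
        have hb : (b : ℚ) = (b % w : ℕ) + w * q := by exact_mod_cast hdiv.symm
        rw [negContFrac, hl, inv_neg, inv_div, hsub, hb]
        push_cast
        field_simp
        ring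
      exact ⟨_, e, by rw [e]; exact hneg, hneg'⟩

end FalseTheta

/-! ### The plumbing matrix of a star -/

namespace FalseTheta

open Matrix

section General

variable {V : Type} (Γ : PlumbingGraph V)

lemma matrix_symm (v w : V) : Γ.matrix v w = Γ.matrix w v := by
  classical
  simp only [PlumbingGraph.matrix, of_apply, Γ.graph.adj_comm v w]
  by_cases h : v = w
  · subst h; simp
  · rw [if_neg h, if_neg (Ne.symm h)]

lemma matrix_transpose : Γ.matrixᵀ = Γ.matrix := by
  ext v w
  exact matrix_symm Γ w v

lemma dotProduct_mulVec_comm [Fintype V] (x y : V → ℤ) :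
    (Γ.matrix *ᵥ x) ⬝ᵥ y = x ⬝ᵥ (Γ.matrix *ᵥ y) := by
  rw [dotProduct_mulVec, ← mulVec_transpose, matrix_transpose]

lemma mulVec_one_eq [Fintype V] (v : V) : (Γ.matrix *ᵥ 1) v = Γ.weight v + Γ.deg v := by
  classical
  have hdeg : (Γ.deg v : ℤ) = ∑ w, if Γ.graph.Adj v w then 1 else 0 := by
    rw [Finset.sum_boole, PlumbingGraph.deg, Set.ncard_eq_toFinset_card']
    congr 2
    ext w
    simp
  have : ∀ w, Γ.matrix v w = (if v = w then Γ.weight v else 0) +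
      (if Γ.graph.Adj v w then 1 else 0) := by
    intro w
    simp only [PlumbingGraph.matrix, of_apply]
    by_cases h : v = w
    · subst h; simp
    · simp [h]
  rw [mulVec, dotProduct, hdeg]
  simp only [this, Pi.one_apply, mul_one, Finset.sum_add_distrib, Finset.sum_ite_eq, Finset.mem_univ,
    if_true]

lemma form_neg_of_isNegDef [Fintype V] (h : Γ.IsNegDef) {y : V → ℤ} (hy : y ≠ 0) :
    y ⬝ᵥ (Γ.matrix *ᵥ y) < 0 := by
  have hne : (fun v => (y v : ℝ)) ≠ 0 := by
    intro h0
    exact hy (funext fun v => by simpa using congrFun h0 v)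
  have := h.dotProduct_mulVec_pos hne
  have e : star (fun v => (y v : ℝ)) ⬝ᵥ ((-(Γ.matrix.map (Int.cast : ℤ → ℝ))) *ᵥ fun v => (y v : ℝ)) =
      ((-(y ⬝ᵥ (Γ.matrix *ᵥ y)) : ℤ) : ℝ) := by
    simp only [star_trivial, neg_mulVec, dotProduct_neg]
    simp [dotProduct, mulVec]
  rw [e] at this
  have : 0 < -(y ⬝ᵥ (Γ.matrix *ᵥ y)) := by exact_mod_cast this
  linarith

lemma mulVec_injective_of_isNegDef [Fintype V] (h : Γ.IsNegDef) :
    Function.Injective fun x : V → ℤ => Γ.matrix *ᵥ x := by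
  intro x y hxy
  by_contra hne
  have h1 := form_neg_of_isNegDef Γ h (sub_ne_zero.2 hne)
  have h2 : Γ.matrix *ᵥ (x - y) = 0 := by
    rw [mulVec_sub]; exact sub_eq_zero.2 hxy
  rw [h2, dotProduct_zero] at h1
  exact lt_irrefl _ h1

end General

section Star

variable (P : StarPlumbing)

/-- The values of `y` along the `i`-th leg, preceded by the value at the centre and followed by zeros. -/
def legSeq {N : Type*} [Zero N] (y : P.Vertex → N) (i : Fin 3) : ℕ → N
  | 0 => y none
  | a + 1 => if h : a < (P.leg i).length then y (some ⟨i, a, h⟩) else 0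

/-- The `a`-th vertex of the `i`-th leg. -/
abbrev legVertex (i : Fin 3) (a : ℕ) (h : a < (P.leg i).length) : P.Vertex := some ⟨i, a, h⟩

variable {P}

lemma matrix_none_none : P.toGraph.matrix none none = P.center := by
  simp [PlumbingGraph.matrix, StarPlumbing.toGraph]

lemma matrix_none_some (v : Σ i : Fin 3, Fin (P.leg i).length) :
    P.toGraph.matrix none (some v) = if (v.2 : ℕ) = 0 then 1 else 0 := by
  by_cases h : (v.2 : ℕ) = 0 <;>
    simp [PlumbingGraph.matrix, StarPlumbing.toGraph, StarPlumbing.Adj, h]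

lemma matrix_some_some_of_ne {i i' : Fin 3} (h : i ≠ i') (a : Fin (P.leg i).length)
    (a' : Fin (P.leg i').length) : P.toGraph.matrix (some ⟨i, a⟩) (some ⟨i', a'⟩) = 0 := by
  classical
  simp [PlumbingGraph.matrix, StarPlumbing.toGraph, StarPlumbing.Adj, h]

lemma matrix_some_some (i : Fin 3) (a a' : Fin (P.leg i).length) :
    P.toGraph.matrix (some ⟨i, a⟩) (some ⟨i, a'⟩) =
      (if (a' : ℕ) = a then (P.leg i)[a] else 0) + (if (a' : ℕ) + 1 = a then 1 else 0) +
        (if (a' : ℕ) = a + 1 then 1 else 0) := by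
  classical
  simp only [PlumbingGraph.matrix, StarPlumbing.toGraph, StarPlumbing.Adj, of_apply, Option.some.injEq,
    Sigma.mk.injEq, heq_eq_eq, true_and, Fin.ext_iff]
  by_cases h : (a : ℕ) = a'
  · simp [h]
  · rw [if_neg h, if_neg (Ne.symm h), zero_add]
    by_cases h1 : (a' : ℕ) + 1 = a
    · rw [if_pos h1, if_pos (Or.inr h1), if_neg (by omega)]; rfl
    · by_cases h2 : (a : ℕ) + 1 = a'
      · rw [if_pos (Or.inl h2), if_neg h1, if_pos h2.symm]; rfl
      · rw [if_neg (by tauto), if_neg h1, if_neg (by omega)]; rfl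

section Rows

variable {N : Type*} [AddCommGroup N] (y : P.Vertex → N)

lemma sum_fin_ite {n : ℕ} (f : ℕ → N) (k : ℕ) :
    ∑ a : Fin n, (if (a : ℕ) = k then f a else 0) = if k < n then f k else 0 := by
  rw [Fin.sum_univ_eq_sum_range (fun a => if a = k then f a else 0), Finset.sum_ite_eq']
  simp

lemma legSeq_succ (i : Fin 3) (a : Fin (P.leg i).length) : legSeq P y i (a + 1) = y (some ⟨i, a⟩) := by
  simp [legSeq]

/-- The row of the centre. -/
lemma sum_matrix_none : ∑ w, P.toGraph.matrix none w • y w =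
    P.center • y none + ∑ i, legSeq P y i 1 := by
  rw [Fintype.sum_option, matrix_none_none, Fintype.sum_sigma]
  congr 1
  refine Finset.sum_congr rfl fun i _ => ?_
  have := sum_fin_ite (n := (P.leg i).length) (fun a => legSeq P y i (a + 1)) 0
  have e : ∀ a : Fin (P.leg i).length, P.toGraph.matrix none (some ⟨i, a⟩) • y (some ⟨i, a⟩) =
      if (a : ℕ) = 0 then legSeq P y i (a + 1) else 0 := by
    intro a
    rw [matrix_none_some, legSeq_succ]
    split_ifs <;> simp
  simp only [e, this]
  split_ifs with h
  · rfl
  · simp [legSeq, h]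

/-- The row of a vertex of a leg. -/
lemma sum_matrix_some (i : Fin 3) (a : ℕ) (h : a < (P.leg i).length) :
    ∑ w, P.toGraph.matrix (legVertex P i a h) w • y w =
      legSeq P y i a + (P.leg i)[a] • legSeq P y i (a + 1) + legSeq P y i (a + 2) := by
  rw [Fintype.sum_option, Fintype.sum_sigma, Finset.sum_eq_single i]
  rotate_left
  · intro i' _ hi'
    exact Finset.sum_eq_zero fun a' _ => by rw [matrix_some_some_of_ne (Ne.symm hi'), zero_smul]
  · simp
  have e : ∀ a' : Fin (P.leg i).length, P.toGraph.matrix (legVertex P i a h) (some ⟨i, a'⟩) •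
      y (some ⟨i, a'⟩) = (if (a' : ℕ) = a then (P.leg i)[a] • legSeq P y i (a' + 1) else 0) +
        (if (a' : ℕ) + 1 = a then legSeq P y i (a' + 1) else 0) +
        (if (a' : ℕ) = a + 1 then legSeq P y i (a' + 1) else 0) := by
    intro a'
    rw [matrix_some_some, legSeq_succ, add_smul, add_smul]
    congr 1
    · congr 1
      · split_ifs <;> simp
      · split_ifs <;> simp
    · split_ifs <;> simp
  simp only [e, Finset.sum_add_distrib]
  rw [sum_fin_ite (fun a' => (P.leg i)[a] • legSeq P y i (a' + 1)), if_pos h,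
    sum_fin_ite (fun a' => legSeq P y i (a' + 1)), matrix_symm, matrix_none_some]
  have h3 : (if a + 1 < (P.leg i).length then legSeq P y i (a + 1 + 1) else 0) = legSeq P y i (a + 2) := by
    split_ifs with h'
    · rfl
    · simp [legSeq, h']
  rw [h3, ← add_assoc, ← add_assoc, add_right_comm _ _ (∑ a' : Fin _, _)]
  congr 2
  rcases a with _ | k
  · simp [legSeq]
  · have : ∀ a' : Fin (P.leg i).length, ((a' : ℕ) + 1 = k + 1) = ((a' : ℕ) = k) := by
      intro a'; simp
    simp only [this]
    rw [sum_fin_ite (fun a' => legSeq P y i (a' + 1)), if_neg (by simp), if_pos (by omega), zero_smul,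
      zero_add]

end Rows

lemma mulVec_none (y : P.Vertex → ℤ) : (P.toGraph.matrix *ᵥ y) none =
    P.center * y none + ∑ i, legSeq P y i 1 := by
  have := sum_matrix_none y
  simp only [smul_eq_mul] at this
  exact this

lemma mulVec_some (y : P.Vertex → ℤ) (i : Fin 3) (a : ℕ) (h : a < (P.leg i).length) :
    (P.toGraph.matrix *ᵥ y) (legVertex P i a h) =
      legSeq P y i a + (P.leg i)[a] * legSeq P y i (a + 1) + legSeq P y i (a + 2) := by
  have := sum_matrix_some y i a h
  simp only [smul_eq_mul] at this
  exact this

end Star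

end FalseTheta

/-! ### The inverse of the plumbing matrix -/

namespace FalseTheta

open Matrix

section General

variable {V : Type} [Fintype V] (Γ : PlumbingGraph V)

/-- If the plumbing matrix is unimodular, then the first homology of the manifold without the vertex
`t` is cyclic: the map `x ↦ ∑ z_v x_v`, where `z` is the column of the inverse matrix at `t`, identifies it
with the integers modulo `z_t`. -/
lemma cardH1_restrict_ne [DecidableEq V] (hsurj : ∀ ℓ : V → ℤ, ∃ x, Γ.matrix *ᵥ x = ℓ) {t : V} {z : V → ℤ}
    (hz : Γ.matrix *ᵥ z = Pi.single t 1) {s : Set V} [Fintype s] (hs : ∀ v, v ∈ s ↔ v ≠ t) :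
    (Γ.restrict s).cardH1 = (z t).natAbs := by
  classical
  have hsum : ∀ f : V → ℤ, ∑ v, f v = f t + ∑ v : s, f v := by
    intro f
    rw [← Finset.add_sum_erase _ f (Finset.mem_univ t)]
    congr 1
    refine (Finset.sum_subtype _ (fun v => ?_) f)
    simp [hs]
  have hmat : ∀ v w : s, (Γ.restrict s).matrix v w = Γ.matrix v w := by
    intro v w
    simp [PlumbingGraph.matrix, PlumbingGraph.restrict, Subtype.ext_iff]
  set f : (s → ℤ) →ₗ[ℤ] ZMod (z t).natAbs :=
    (Int.castAddHom (ZMod (z t).natAbs)).toIntLinearMap.comp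
      (∑ v : s, z v • LinearMap.proj v) with hf
  have hfapp : ∀ x : s → ℤ, f x = ((∑ v : s, z v * x v : ℤ) : ZMod (z t).natAbs) := by
    intro x
    simp [hf]
  have hfsurj : Function.Surjective f := by
    have h1 : f (fun v => Γ.matrix t v) = 1 := by
      have h2 : ∑ v, Γ.matrix t v * z v = 1 := by
        have := congrFun hz t
        rwa [Pi.single_eq_same] at this
      rw [hsum] at h2
      rw [hfapp]
      have h3 : ∑ v : s, z v * Γ.matrix t v = 1 - Γ.matrix t t * z t := by
        rw [← h2, add_sub_cancel_left]
        exact Finset.sum_congr rfl fun v _ => mul_comm _ _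
      rw [h3]
      have h4 : ((z t : ℤ) : ZMod (z t).natAbs) = 0 := by
        rw [ZMod.intCast_zmod_eq_zero_iff_dvd]
        exact Int.natAbs_dvd.2 dvd_rfl
      push_cast
      rw [h4]
      ring
    intro y
    obtain ⟨k, rfl⟩ := ZMod.intCast_surjective y
    refine ⟨k • (fun v : s => Γ.matrix t v), ?_⟩
    rw [map_smul, h1]
    simp
  have hker : LinearMap.ker f = LinearMap.range (Γ.restrict s).matrix.mulVecLin := by
    ext x
    rw [LinearMap.mem_ker, hfapp, ZMod.intCast_zmod_eq_zero_iff_dvd, Int.natAbs_dvd]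
    constructor
    · rintro ⟨k, hk⟩
      set ℓ : V → ℤ := fun v => if h : v ∈ s then x ⟨v, h⟩ else -k with hℓ
      have hℓs : ∀ v : s, ℓ v = x v := fun v => by simp [hℓ]
      have hℓt : ℓ t = -k := by
        rw [hℓ]
        simp [hs]
      obtain ⟨y, hy⟩ := hsurj ℓ
      have hyt : y t = 0 := by
        have h1 : y t = ∑ v, z v * ℓ v := by
          have := dotProduct_mulVec_comm Γ z y
          rw [hz, hy, single_one_dotProduct] at this
          exact this
        rw [h1, hsum, hℓt]
        simp only [hℓs]
        rw [hk]
        ring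
      refine ⟨fun v => y v, ?_⟩
      funext v
      rw [mulVecLin_apply, mulVec, dotProduct, ← hℓs, ← hy, mulVec, dotProduct, hsum, hyt]
      simp [hmat]
    · rintro ⟨y, rfl⟩
      set y' : V → ℤ := fun v => if h : v ∈ s then y ⟨v, h⟩ else 0 with hy'
      have hys : ∀ v : s, y' v = y v := fun v => by simp [hy']
      have hyt : y' t = 0 := by
        rw [hy']
        simp [hs]
      have h1 : ∀ v : s, ((Γ.restrict s).matrix *ᵥ y) v = (Γ.matrix *ᵥ y') v := by
        intro v
        rw [mulVec, dotProduct, mulVec, dotProduct, hsum, hyt]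
        simp [hmat, hys]
      have h2 := dotProduct_mulVec_comm Γ z y'
      rw [hz, single_one_dotProduct, hyt, dotProduct, hsum] at h2
      simp only [mulVecLin_apply, h1]
      exact ⟨-(Γ.matrix *ᵥ y') t, by linarith⟩
  rw [PlumbingGraph.cardH1, ← hker, Nat.card_congr (f.quotKerEquivOfSurjective hfsurj).toEquiv,
    Nat.card_zmod]

end General

section Star

variable {P : StarPlumbing}

lemma legSeq_end {N : Type*} [Zero N] (y : P.Vertex → N) (i : Fin 3) :
    legSeq P y i ((P.leg i).length + 1) = 0 := by
  simp [legSeq]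

/-- The quadratic form of the star as a sum over the legs. -/
lemma form_eq_sum_legForm {R : Type*} [CommRing R] (y : P.Vertex → R) :
    ∑ v, y v * ∑ w, P.toGraph.matrix v w • y w =
      P.center • y none ^ 2 + ∑ i, legForm (P.leg i) (legSeq P y i) := by
  rw [Fintype.sum_option, Fintype.sum_sigma, sum_matrix_none, mul_add, Finset.mul_sum, add_assoc,
    ← Finset.sum_add_distrib]
  congr 1
  · rw [mul_smul_comm, sq]
  · refine Finset.sum_congr rfl fun i _ => ?_
    rw [← sum_chain_eq_legForm _ _ (legSeq_end y i)]
    congr 1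
    refine Finset.sum_congr rfl fun a _ => ?_
    rw [legSeq_succ y i a]
    congr 1
    exact (sum_matrix_some y i a a.2).trans (by rw [legSeq_succ y i a]; rfl)

lemma chain_leg_pos (h : P.toGraph.IsNegDef) (i : Fin 3) (a : ℕ) (ha : a ≤ (P.leg i).length) :
    0 < chain (P.leg i) a := by
  classical
  refine chain_pos (fun s hs0 ⟨a, ha, hne⟩ => ?_) a ha
  set y : P.Vertex → ℤ := fun v => match v with
    | none => 0
    | some v => if v.1 = i then s (v.2 + 1) else 0 with hy
  have hyne : y ≠ 0 := by
    intro h0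
    have := congrFun h0 (legVertex P i a ha)
    simp [hy] at this
    exact hne this
  have h1 := form_neg_of_isNegDef _ h hyne
  have h2 := form_eq_sum_legForm y
  have h3 : ∑ v, y v * ∑ w, P.toGraph.matrix v w • y w = y ⬝ᵥ (P.toGraph.matrix *ᵥ y) := rfl
  have h4 : ∀ i', i' ≠ i → legForm (P.leg i') (legSeq P y i') = 0 := by
    intro i' hi'
    rw [legForm_congr (s' := fun _ => 0) _ fun k _ => ?_, legForm_zero]
    rcases k with _ | k
    · rfl
    · simp only [legSeq]
      split_ifs <;> simp [hy, hi']
  have h5 : legForm (P.leg i) (legSeq P y i) = legForm (P.leg i) s := by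
    refine legForm_congr _ fun k hk => ?_
    rcases k with _ | k
    · exact hs0.symm
    · simp only [legSeq]
      rw [dif_pos (by omega)]
      simp [hy]
  rw [Finset.sum_eq_single i (fun i' _ hi' => h4 i' hi') (by simp), h5, h3] at h2
  rw [h2] at h1
  simpa [hy] using h1

variable {b : Fin 3 → ℕ}

/-- The numerical data of the star: the recursion along the `i`-th leg starts with `b i`, and the
central vertex closes up. -/
lemma IsPlumbingOf.chain_eq (hb : ∀ i, 0 < b i) (hP : P.IsPlumbingOf b) :
    (∀ i, chain (P.leg i) 0 = b i) ∧
      P.center * (b 0 * b 1 * b 2) + chain (P.leg 0) 1 * (b 1 * b 2) + chain (P.leg 1) 1 * (b 0 * b 2) +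
        chain (P.leg 2) 1 * (b 0 * b 1) = -1 := by
  obtain ⟨hneg, w, hw, hcf, hsum⟩ := hP
  have hbQ : ∀ i, (b i : ℚ) ≠ 0 := fun i => by exact_mod_cast (hb i).ne'
  have hint : P.center * (b 0 * b 1 * b 2) + w 0 * (b 1 * b 2) + w 1 * (b 0 * b 2) +
      w 2 * (b 0 * b 1) = -1 := by
    rw [Fin.sum_univ_three] at hsum
    have h0 := hbQ 0
    have h1 := hbQ 1
    have h2 := hbQ 2
    field_simp at hsum
    have : ((P.center * (b 0 * b 1 * b 2) + w 0 * (b 1 * b 2) + w 1 * (b 0 * b 2) +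
      w 2 * (b 0 * b 1) : ℤ) : ℚ) = ((-1 : ℤ) : ℚ) := by
      push_cast
      linear_combination hsum
    exact_mod_cast this
  -- the equation for the centre is a Bézout identity
  have hcop : ∀ i, IsCoprime (b i : ℤ) (w i) := by
    intro i
    fin_cases i
    · exact ⟨-(P.center * (b 1 * b 2) + w 1 * b 2 + w 2 * b 1), -(b 1 * b 2), by
        simp only [Fin.zero_eta]; linear_combination -hint⟩
    · exact ⟨-(P.center * (b 0 * b 2) + w 0 * b 2 + w 2 * b 0), -(b 0 * b 2), by
        simp only [Fin.mk_one]; linear_combination -hint⟩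
    · exact ⟨-(P.center * (b 0 * b 1) + w 0 * b 1 + w 1 * b 0), -(b 0 * b 1), by
        simp only [Fin.reduceFinMk]; linear_combination -hint⟩
  -- two reduced fractions with equal values
  have hkey : ∀ i, chain (P.leg i) 0 = b i ∧ chain (P.leg i) 1 = w i := by
    intro i
    have hpos := chain_leg_pos hneg i
    have hc0 := hpos 0 (by omega)
    have hcfi := hcf i
    rw [negContFrac_eq hpos, neg_inj] at hcfi
    have hwQ : (w i : ℚ) ≠ 0 := by exact_mod_cast (hw i).ne'
    have hc1 : (chain (P.leg i) 1 : ℚ) ≠ 0 := by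
      intro h0
      rw [h0, div_zero] at hcfi
      exact div_ne_zero (hbQ i) hwQ hcfi.symm
    rw [div_eq_div_iff hc1 hwQ] at hcfi
    have hcfi' : chain (P.leg i) 0 * w i = b i * chain (P.leg i) 1 := by exact_mod_cast hcfi
    have d1 : (b i : ℤ) ∣ chain (P.leg i) 0 :=
      (hcop i).dvd_of_dvd_mul_right ⟨_, hcfi'⟩
    have d2 : chain (P.leg i) 0 ∣ b i :=
      (isCoprime_chain (P.leg i)).dvd_of_dvd_mul_right ⟨_, hcfi'.symm⟩
    have e : chain (P.leg i) 0 = b i :=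
      Int.dvd_antisymm hc0.le (by positivity) d2 d1
    refine ⟨e, ?_⟩
    rw [e] at hcfi'
    exact (mul_left_cancel₀ (by exact_mod_cast (hb i).ne') hcfi').symm
  refine ⟨fun i => (hkey i).1, ?_⟩
  rw [(hkey 0).2, (hkey 1).2, (hkey 2).2]
  exact hint

lemma IsPlumbingOf.length_pos (hb : ∀ i, 2 ≤ b i) (hP : P.IsPlumbingOf b) (i : Fin 3) :
    0 < (P.leg i).length := by
  have h := (IsPlumbingOf.chain_eq (fun i => by have := hb i; omega) hP).1 i
  by_contra hcon
  rw [List.eq_nil_of_length_eq_zero (l := P.leg i) (by omega)] at h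
  have := hb i
  simp only [chain] at h
  omega

/-- The values along a leg whose rows are homogeneous are determined by the value at the tip. -/
lemma leg_values {N : Type*} [AddCommGroup N] {y : P.Vertex → N} {i : Fin 3}
    (h : ∀ (a : ℕ) (ha : a < (P.leg i).length),
      ∑ w, P.toGraph.matrix (legVertex P i a ha) w • y w = 0) :
    y none = chain (P.leg i) 0 • legSeq P y i (P.leg i).length ∧
      legSeq P y i 1 = chain (P.leg i) 1 • legSeq P y i (P.leg i).length ∧
      ∀ a ≤ (P.leg i).length, legSeq P y i a = chain (P.leg i) a • legSeq P y i (P.leg i).length := by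
  have := eq_chain_smul (P.leg i) (legSeq P y i)
    (fun a ha => by rw [← sum_matrix_some]; exact h a ha) (legSeq_end y i)
  exact ⟨this 0 (by omega), this 1 (by omega), fun a ha => this a (by omega)⟩

lemma eq_zero_of_legSeq {N : Type*} [AddCommGroup N] {y : P.Vertex → N} (h0 : y none = 0)
    (h : ∀ i, ∀ a ≤ (P.leg i).length, legSeq P y i a = 0) (v : P.Vertex) : y v = 0 := by
  rcases v with _ | ⟨i, a⟩
  · exact h0
  · rw [← legSeq_succ y i a]
    exact h i (a + 1) a.2

/-- The plumbed manifold is a homology sphere. -/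
lemma mulVec_surjective (hb : ∀ i, 0 < b i) (hP : P.IsPlumbingOf b) (ℓ : P.Vertex → ℤ) :
    ∃ x, P.toGraph.matrix *ᵥ x = ℓ := by
  classical
  obtain ⟨hc, hcen⟩ := IsPlumbingOf.chain_eq hb hP
  set R := LinearMap.range P.toGraph.matrix.mulVecLin
  -- the classes of the unit vectors in the cokernel satisfy the rows of the matrix; it is enough
  -- that they vanish
  set y : P.Vertex → (P.Vertex → ℤ) ⧸ R := fun v => R.mkQ (Pi.single v 1) with hy
  have hrow : ∀ v, ∑ w, P.toGraph.matrix v w • y w = 0 := by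
    intro v
    have : ∑ w, P.toGraph.matrix v w • y w = R.mkQ (P.toGraph.matrix *ᵥ Pi.single v 1) := by
      simp only [hy, ← map_smul, ← map_sum]
      congr 1
      funext u
      rw [mulVec_single_one]
      simp [Finset.sum_apply, Pi.single_apply, matrix_symm _ v]
    rw [this]
    exact (Submodule.Quotient.mk_eq_zero R).2 ⟨_, rfl⟩
  have hleg := fun i => leg_values (y := y) (i := i) fun a ha => hrow _
  have hnone := hrow none
  rw [sum_matrix_none, Fin.sum_univ_three] at hnone
  obtain ⟨c0, w0, -⟩ := hleg 0
  obtain ⟨c1, w1, -⟩ := hleg 1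
  obtain ⟨c2, w2, -⟩ := hleg 2
  rw [hc] at c0 c1 c2
  rw [w0, w1, w2] at hnone
  have hone : ∀ t : (P.Vertex → ℤ) ⧸ R, (P.center * (b 0 * b 1 * b 2) + chain (P.leg 0) 1 * (b 1 * b 2) +
      chain (P.leg 1) 1 * (b 0 * b 2) + chain (P.leg 2) 1 * (b 0 * b 1)) • t = 0 → t = 0 := by
    intro t ht
    rw [hcen] at ht
    simpa using ht
  have t2 : legSeq P y 2 (P.leg 2).length = 0 := by
    refine hone _ ?_
    linear_combination (norm := module) ((b 0 * b 1 : ℤ)) • hnone - (P.center * (b 0 * b 1)) • c2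
      - (chain (P.leg 0) 1 * b 1) • c2 + (chain (P.leg 0) 1 * b 1) • c0
      - (chain (P.leg 1) 1 * b 0) • c2 + (chain (P.leg 1) 1 * b 0) • c1
  have hn : y none = 0 := by rw [c2, t2, smul_zero]
  have t0 : legSeq P y 0 (P.leg 0).length = 0 := by
    refine hone _ ?_
    linear_combination (norm := module) ((b 1 * b 2 : ℤ)) • hnone - (P.center * (b 1 * b 2)) • c0
      - (chain (P.leg 1) 1 * b 2) • c0 + (chain (P.leg 1) 1 * b 2) • c1
      - (chain (P.leg 2) 1 * b 1) • c0 + (chain (P.leg 2) 1 * b 1) • c2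
  have t1 : legSeq P y 1 (P.leg 1).length = 0 := by
    refine hone _ ?_
    linear_combination (norm := module) ((b 0 * b 2 : ℤ)) • hnone - (P.center * (b 0 * b 2)) • c1
      - (chain (P.leg 0) 1 * b 2) • c1 + (chain (P.leg 0) 1 * b 2) • c0
      - (chain (P.leg 2) 1 * b 0) • c1 + (chain (P.leg 2) 1 * b 0) • c2
  have ht : ∀ i, legSeq P y i (P.leg i).length = 0 := by
    intro i; fin_cases i
    · exact t0
    · exact t1
    · exact t2
  have hzero : ∀ v, y v = 0 := eq_zero_of_legSeq hn fun i a ha => by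
    rw [(hleg i).2.2 a ha, ht, smul_zero]
  have : R.mkQ ℓ = 0 := by
    have e : ℓ = ∑ v, ℓ v • (Pi.single v 1 : P.Vertex → ℤ) := by
      funext u
      simp [Finset.sum_apply, Pi.single_apply]
    rw [e, map_sum]
    exact Finset.sum_eq_zero fun v _ => by rw [map_smul]; exact (congrArg _ (hzero v)).trans (smul_zero _)
  exact (Submodule.Quotient.mk_eq_zero R).1 this

end Star

end FalseTheta

/-! ### The quadratic form on the vectors supported on the centre and the tips -/

namespace FalseTheta

open Matrix

section Star

/-- The vector with the value `r` at the centre, `e i` at the tip of the `i`-th leg, and `0` elsewhere. -/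
def tipVec (P : StarPlumbing) (r : ℤ) (e : Fin 3 → ℤ) : P.Vertex → ℤ
  | none => r
  | some v => if (v.2 : ℕ) + 1 = (P.leg v.1).length then e v.1 else 0

variable {P : StarPlumbing} {b : Fin 3 → ℕ}

lemma tipVec_dotProduct (hlen : ∀ i, 0 < (P.leg i).length) (r : ℤ) (e : Fin 3 → ℤ) (z : P.Vertex → ℤ) :
    tipVec P r e ⬝ᵥ z = r * z none + ∑ i, e i * legSeq P z i (P.leg i).length := by
  rw [dotProduct, Fintype.sum_option, Fintype.sum_sigma]
  congr 1
  refine Finset.sum_congr rfl fun i _ => ?_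
  have := sum_fin_ite (n := (P.leg i).length) (fun a => e i * legSeq P z i (a + 1)) ((P.leg i).length - 1)
  rw [if_pos (Nat.sub_lt (hlen i) one_pos), Nat.sub_add_cancel (hlen i)] at this
  rw [← this]
  refine Finset.sum_congr rfl fun a _ => ?_
  have hl := hlen i
  have ha := a.2
  simp only [tipVec]
  rw [legSeq_succ z i a]
  by_cases h : (a : ℕ) + 1 = (P.leg i).length
  · rw [if_pos h, if_pos (by omega)]
  · rw [if_neg h, if_neg (by omega), zero_mul]

lemma tipVec_single (hlen : ∀ i, 0 < (P.leg i).length) (i : Fin 3) [DecidableEq P.Vertex] :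
    tipVec P 0 (Pi.single i 1) =
      Pi.single (legVertex P i ((P.leg i).length - 1) (Nat.sub_lt (hlen i) one_pos)) 1 := by
  funext v
  have hl := hlen i
  rcases v with _ | ⟨i', a⟩
  · simp [tipVec]
  · simp only [tipVec]
    by_cases hi : i' = i
    · subst hi
      have ha := a.2
      by_cases h : (a : ℕ) + 1 = (P.leg i').length
      · have : a = ⟨(P.leg i').length - 1, Nat.sub_lt (hlen i') one_pos⟩ := Fin.ext (by simp; omega)
        rw [if_pos h, this, Pi.single_eq_same, Pi.single_eq_same]
      · rw [if_neg h, Pi.single_eq_of_ne]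
        intro h'
        simp only [Option.some.injEq, Sigma.mk.injEq, heq_eq_eq, true_and, Fin.ext_iff] at h'
        omega
    · rw [Pi.single_eq_of_ne hi, Pi.single_eq_of_ne]
      · simp
      · intro h'
        simp only [Option.some.injEq, Sigma.mk.injEq] at h'
        exact hi h'.1

lemma legSeq_tip {z : P.Vertex → ℤ} (hlen : ∀ i, 0 < (P.leg i).length) (i : Fin 3) :
    legSeq P z i (P.leg i).length =
      z (legVertex P i ((P.leg i).length - 1) (Nat.sub_lt (hlen i) one_pos)) := by
  rw [← legSeq_succ z i ⟨(P.leg i).length - 1, Nat.sub_lt (hlen i) one_pos⟩]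
  exact congrArg _ (Nat.sub_add_cancel (hlen i)).symm

/-- The number `h i` is the negative of a diagonal entry of the inverse matrix. -/
lemma h_eq_neg (hb : ∀ i, 2 ≤ b i) (hP : P.IsPlumbingOf b) {i : Fin 3} {z : P.Vertex → ℤ}
    (hz : P.toGraph.matrix *ᵥ z = tipVec P 0 (Pi.single i 1)) :
    legSeq P z i (P.leg i).length = -(P.h i : ℤ) := by
  classical
  have hlen := IsPlumbingOf.length_pos hb hP
  set t := legVertex P i ((P.leg i).length - 1) (Nat.sub_lt (hlen i) one_pos) with ht
  rw [tipVec_single hlen] at hz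
  have hs : ∀ v, v ∈ P.withoutTip i ↔ v ≠ t := by
    intro v
    constructor
    · intro h
      exact h ⟨(P.leg i).length - 1, Nat.sub_lt (hlen i) one_pos⟩ (Nat.sub_add_cancel (hlen i))
    · intro h a ha hva
      refine h ?_
      rw [hva, ht]
      have : a = ⟨(P.leg i).length - 1, Nat.sub_lt (hlen i) one_pos⟩ := Fin.ext (by simp; omega)
      rw [this]
  have hcard := cardH1_restrict_ne P.toGraph
    (mulVec_surjective (fun i => by have := hb i; omega) hP) hz hs
  have hneg : z t ≤ 0 := by
    have hne : z ≠ 0 := by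
      rintro rfl
      have := congrFun hz t
      rw [mulVec_zero, ← ht, Pi.single_eq_same] at this
      exact zero_ne_one this
    have h1 := form_neg_of_isNegDef _ hP.1 hne
    rw [hz] at h1
    simpa using h1.le
  rw [legSeq_tip hlen, ← ht]
  have : (P.h i : ℤ) = (z t).natAbs := by
    rw [← hcard, StarPlumbing.h]
  rw [this]
  omega

/-- The entries of the inverse matrix at the centre and at the tips, as values of the inverse form. -/
lemma tipVec_dotProduct_solution (hb : ∀ i, 2 ≤ b i) (hP : P.IsPlumbingOf b) {r : ℤ} {e : Fin 3 → ℤ}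
    {z : P.Vertex → ℤ} (hz : P.toGraph.matrix *ᵥ z = tipVec P r e) :
    tipVec P r e ⬝ᵥ z = -(r ^ 2 * (b 0 * b 1 * b 2) +
      2 * r * (e 0 * (b 1 * b 2) + e 1 * (b 0 * b 2) + e 2 * (b 0 * b 1)) +
      2 * (e 0 * e 1 * b 2 + e 0 * e 2 * b 1 + e 1 * e 2 * b 0) + ∑ i, e i ^ 2 * P.h i) := by
  classical
  have hlen := IsPlumbingOf.length_pos hb hP
  have hb0 : ∀ i, 0 < b i := fun i => by have := hb i; omega
  have hbZ : ∀ i, (b i : ℤ) ≠ 0 := fun i => by exact_mod_cast (hb0 i).ne'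
  obtain ⟨hc, hcen⟩ := IsPlumbingOf.chain_eq hb0 hP
  have hsurj := mulVec_surjective hb0 hP
  obtain ⟨c, hc'⟩ := hsurj (tipVec P 1 0)
  choose t ht using fun i => hsurj (tipVec P 0 (Pi.single i 1))
  have hbal : ∀ {y : P.Vertex → ℤ} {r : ℤ} {e : Fin 3 → ℤ} (i : Fin 3),
      P.toGraph.matrix *ᵥ y = tipVec P r e → e i = 0 →
      y none = b i * legSeq P y i (P.leg i).length ∧
        legSeq P y i 1 = chain (P.leg i) 1 * legSeq P y i (P.leg i).length := by
    intro y r e i hy hei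
    have := leg_values (y := y) (i := i) fun a ha => by
      have h1 := congrFun hy (legVertex P i a ha)
      simp only [tipVec, hei, ite_self] at h1
      exact h1
    rw [hc i] at this
    exact ⟨this.1, this.2.1⟩
  -- the column at the centre
  have hcb : ∀ i, c none = b i * legSeq P c i (P.leg i).length := fun i => (hbal i hc' rfl).1
  have hcn : c none = -(b 0 * b 1 * b 2) := by
    have h1 := congrFun hc' none
    rw [mulVec_none, Fin.sum_univ_three, (hbal 0 hc' rfl).2, (hbal 1 hc' rfl).2, (hbal 2 hc' rfl).2] at h1
    simp only [tipVec] at h1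
    have e0 := hcb 0
    have e1 := hcb 1
    have e2 := hcb 2
    linear_combination (-(b 0 * b 1 * b 2 : ℤ)) * h1 + (c none) * hcen
      - chain (P.leg 0) 1 * (b 1 * b 2) * e0 - chain (P.leg 1) 1 * (b 0 * b 2) * e1
      - chain (P.leg 2) 1 * (b 0 * b 1) * e2
  have hct0 : legSeq P c 0 (P.leg 0).length = -(b 1 * b 2) :=
    mul_left_cancel₀ (hbZ 0) (by rw [← hcb 0, hcn]; ring)
  have hct1 : legSeq P c 1 (P.leg 1).length = -(b 0 * b 2) :=
    mul_left_cancel₀ (hbZ 1) (by rw [← hcb 1, hcn]; ring)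
  have hct2 : legSeq P c 2 (P.leg 2).length = -(b 0 * b 1) :=
    mul_left_cancel₀ (hbZ 2) (by rw [← hcb 2, hcn]; ring)
  -- the columns at the tips
  have htn : ∀ i, t i none = legSeq P c i (P.leg i).length := by
    intro i
    have := dotProduct_mulVec_comm P.toGraph c (t i)
    rw [hc', ht, dotProduct_comm c, tipVec_dotProduct hlen, tipVec_dotProduct hlen] at this
    simpa [Pi.single_apply] using this
  have htt : ∀ i j, i ≠ j → t i none = b j * legSeq P (t i) j (P.leg j).length := fun i j hij =>
    (hbal j (ht i) (Pi.single_eq_of_ne hij.symm _)).1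
  have htd : ∀ i, legSeq P (t i) i (P.leg i).length = -(P.h i : ℤ) := fun i => h_eq_neg hb hP (ht i)
  have t01 : legSeq P (t 0) 1 (P.leg 1).length = -b 2 :=
    mul_left_cancel₀ (hbZ 1) (by rw [← htt 0 1 (by decide), htn, hct0]; ring)
  have t02 : legSeq P (t 0) 2 (P.leg 2).length = -b 1 :=
    mul_left_cancel₀ (hbZ 2) (by rw [← htt 0 2 (by decide), htn, hct0]; ring)
  have t10 : legSeq P (t 1) 0 (P.leg 0).length = -b 2 :=
    mul_left_cancel₀ (hbZ 0) (by rw [← htt 1 0 (by decide), htn, hct1]; ring)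
  have t12 : legSeq P (t 1) 2 (P.leg 2).length = -b 0 :=
    mul_left_cancel₀ (hbZ 2) (by rw [← htt 1 2 (by decide), htn, hct1]; ring)
  have t20 : legSeq P (t 2) 0 (P.leg 0).length = -b 1 :=
    mul_left_cancel₀ (hbZ 0) (by rw [← htt 2 0 (by decide), htn, hct2]; ring)
  have t21 : legSeq P (t 2) 1 (P.leg 1).length = -b 0 :=
    mul_left_cancel₀ (hbZ 1) (by rw [← htt 2 1 (by decide), htn, hct2]; ring)
  -- the solution `z` through the symmetry of the form
  have hzn : z none = r * c none + ∑ i, e i * legSeq P c i (P.leg i).length := by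
    have := dotProduct_mulVec_comm P.toGraph c z
    rw [hc', hz, dotProduct_comm c, tipVec_dotProduct hlen, tipVec_dotProduct hlen] at this
    simpa using this
  have hzt : ∀ i, legSeq P z i (P.leg i).length =
      r * t i none + ∑ j, e j * legSeq P (t i) j (P.leg j).length := by
    intro i
    have := dotProduct_mulVec_comm P.toGraph (t i) z
    rw [ht, hz, dotProduct_comm (t i), tipVec_dotProduct hlen, tipVec_dotProduct hlen] at this
    simpa [Pi.single_apply] using this
  rw [tipVec_dotProduct hlen, hzn]
  simp only [Fin.sum_univ_three, hzt, htn, hct0, hct1, hct2, t01, t02, t10, t12, t20, t21, htd, hcn]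
  ring

lemma deg_eq (hlen : ∀ i, 0 < (P.leg i).length) :
    P.toGraph.deg none = 3 ∧ ∀ (i : Fin 3) (a : Fin (P.leg i).length), P.toGraph.deg (some ⟨i, a⟩) =
      if (a : ℕ) + 1 = (P.leg i).length then 1 else 2 := by
  have hseq : ∀ i a, a ≤ (P.leg i).length → legSeq P (1 : P.Vertex → ℤ) i a = 1 := by
    intro i a ha
    rcases a with _ | a
    · rfl
    · simp only [legSeq]
      rw [dif_pos (by omega)]
      rfl
  constructor
  · have h1 := mulVec_one_eq P.toGraph none
    have h2 := mulVec_none (P := P) 1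
    rw [h1, Fin.sum_univ_three, hseq 0 1 (hlen 0), hseq 1 1 (hlen 1), hseq 2 1 (hlen 2)] at h2
    have h3 : P.toGraph.weight none = P.center := rfl
    rw [h3] at h2
    simp only [Pi.one_apply] at h2
    omega
  · intro i a
    have h1 := mulVec_one_eq P.toGraph (some ⟨i, a⟩)
    have h2 := mulVec_some (P := P) 1 i a a.2
    have h3 : P.toGraph.weight (some ⟨i, a⟩) = (P.leg i)[(a : ℕ)] := rfl
    have ha := a.2
    rw [hseq i a ha.le, hseq i (a + 1) ha] at h2
    have h4 := h1.symm.trans h2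
    rw [h3] at h4
    split_ifs with h
    · have h5 : legSeq P (1 : P.Vertex → ℤ) i (a + 2) = 0 := by
        rw [show (a : ℕ) + 2 = (P.leg i).length + 1 by omega, legSeq_end]
      rw [h5] at h4
      omega
    · rw [hseq i (a + 2) (by omega)] at h4
      omega

lemma Fhat_three {r : ℤ} (hr : Odd r) : Fhat 3 r = (r.sign : ℚ) / 2 := by
  have h1 : 1 ≤ r.natAbs := by
    rcases hr with ⟨k, rfl⟩
    omega
  have h2 : r ≡ 3 [ZMOD 2] := by
    rcases hr with ⟨k, rfl⟩
    exact Int.modEq_iff_dvd.2 ⟨1 - k, by ring⟩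
  change (if 0 + 1 ≤ r.natAbs ∧ r ≡ ((0 + 3 : ℕ) : ℤ) [ZMOD 2] then
    1 / 2 * (r.sign : ℚ) ^ (0 + 3) * (((0 + 3 + r.natAbs) / 2 - 2).choose 0 : ℚ) else 0) = _
  rw [if_pos ⟨by omega, by exact_mod_cast h2⟩]
  rcases lt_trichotomy r 0 with h | h | h
  · rw [Int.sign_eq_neg_one_of_neg h]; norm_num
  · omega
  · rw [Int.sign_eq_one_of_pos h]; norm_num

lemma Fhat_one_unit (e : ℤˣ) : Fhat 1 e = -(e : ℤ) := by
  rcases Int.units_eq_one_or e with rfl | rfl <;> simp [Fhat]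

/-- The coefficients of the series at the vectors in the support. -/
lemma prod_Fhat_tipVec (hlen : ∀ i, 0 < (P.leg i).length) {r : ℤ} (hr : Odd r) (e : Fin 3 → ℤˣ) :
    ∏ v, Fhat (P.toGraph.deg v) (tipVec P r (fun i => e i) v) =
      -((r.sign : ℚ) / 2 * ((e 0 : ℤ) * (e 1 : ℤ) * (e 2 : ℤ) : ℤ)) := by
  obtain ⟨h0, h1⟩ := deg_eq hlen
  rw [Fintype.prod_option, Fintype.prod_sigma, h0]
  have : ∀ i, ∏ a : Fin (P.leg i).length, Fhat (P.toGraph.deg (some ⟨i, a⟩))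
      (tipVec P r (fun i => e i) (some ⟨i, a⟩)) = -(e i : ℤ) := by
    intro i
    have hk : ((⟨(P.leg i).length - 1, Nat.sub_lt (hlen i) one_pos⟩ : Fin (P.leg i).length) : ℕ) + 1 =
        (P.leg i).length := Nat.sub_add_cancel (hlen i)
    rw [Finset.prod_eq_single ⟨(P.leg i).length - 1, Nat.sub_lt (hlen i) one_pos⟩]
    · rw [h1, if_pos hk]
      simp only [tipVec]
      rw [if_pos hk, Fhat_one_unit]
    · intro a _ ha
      have : ¬ (a : ℕ) + 1 = (P.leg i).length := fun h => ha (Fin.ext (by simp; omega))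
      rw [h1, if_neg this]
      simp only [tipVec]
      rw [if_neg this]
      rfl
    · simp
  simp only [this, Fin.prod_univ_three]
  change Fhat 3 r * _ = _
  rw [Fhat_three hr]
  push_cast
  ring

/-- The support of the coefficients. -/
lemma exists_eq_tipVec (hlen : ∀ i, 0 < (P.leg i).length) {ℓ : P.Vertex → ℤ}
    (h : ∏ v, Fhat (P.toGraph.deg v) (ℓ v) ≠ 0) :
    ∃ (r : ℤ) (e : Fin 3 → ℤˣ), Odd r ∧ ℓ = tipVec P r fun i => e i := by
  obtain ⟨h0, h1⟩ := deg_eq hlen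
  have hne : ∀ v, Fhat (P.toGraph.deg v) (ℓ v) ≠ 0 := fun v =>
    (Finset.prod_ne_zero_iff.1 h) v (Finset.mem_univ v)
  have hodd : Odd (ℓ none) := by
    have := hne none
    rw [h0] at this
    by_contra hev
    refine this (if_neg ?_)
    rintro ⟨-, h2⟩
    obtain ⟨k, hk⟩ := Int.modEq_iff_dvd.1 h2
    refine hev ⟨1 - k, ?_⟩
    push_cast at hk
    linarith
  have htip : ∀ i, ∃ e : ℤˣ,
      ℓ (legVertex P i ((P.leg i).length - 1) (Nat.sub_lt (hlen i) one_pos)) = e := by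
    intro i
    have := hne (legVertex P i ((P.leg i).length - 1) (Nat.sub_lt (hlen i) one_pos))
    have hk : ((⟨(P.leg i).length - 1, Nat.sub_lt (hlen i) one_pos⟩ : Fin (P.leg i).length) : ℕ) + 1 =
        (P.leg i).length := Nat.sub_add_cancel (hlen i)
    rw [h1, if_pos hk] at this
    simp only [Fhat] at this
    split_ifs at this with h2 h3
    · exact ⟨1, h2⟩
    · exact ⟨-1, h3⟩
    · exact absurd rfl this
  choose e he using htip
  refine ⟨ℓ none, e, hodd, ?_⟩
  funext v
  rcases v with _ | ⟨i, a⟩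
  · rfl
  · simp only [tipVec]
    split_ifs with ha
    · rw [← he]
      have : a = ⟨(P.leg i).length - 1, Nat.sub_lt (hlen i) one_pos⟩ :=
        Fin.ext (Nat.eq_sub_of_add_eq ha)
      rw [this]
    · have := hne (some ⟨i, a⟩)
      rw [h1, if_neg ha] at this
      simp only [Fhat] at this
      by_contra h2
      rw [if_neg h2] at this
      exact this rfl

end Star

end FalseTheta

/-! ### The terms of the two-variable series -/

namespace FalseTheta

open Matrix Complex

section General

variable {V : Type} [Fintype V] (Γ : PlumbingGraph V)

/-- The argument `2 M x + k - M u` of the coefficients. -/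
noncomputable def coeffVec (k x : V → ℤ) : V → ℤ := 2 • Γ.matrix.mulVec x + k - Γ.matrix.mulVec 1

lemma invSq_mulVec (hsurj : ∀ ℓ : V → ℤ, ∃ x, Γ.matrix *ᵥ x = ℓ) (w : V → ℤ) :
    Γ.invSq (Γ.matrix *ᵥ w) = ((w ⬝ᵥ (Γ.matrix *ᵥ w) : ℤ) : ℚ) := by
  classical
  have hunit : IsUnit Γ.matrix := mulVec_surjective_iff_isUnit.1 hsurj
  have hunit' : IsUnit (Γ.matrix.map (Int.cast : ℤ → ℚ)) := hunit.map (Int.castRingHom ℚ).mapMatrix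
  have hcast : (fun v => ((Γ.matrix *ᵥ w) v : ℚ)) =
      Γ.matrix.map (Int.cast : ℤ → ℚ) *ᵥ fun v => (w v : ℚ) := by
    funext v
    simp [mulVec, dotProduct]
  have e : (Γ.matrix.map (Int.cast : ℤ → ℚ))⁻¹ *ᵥ (fun v => ((Γ.matrix *ᵥ w) v : ℚ)) =
      fun v => (w v : ℚ) := by
    rw [hcast, mulVec_mulVec, nonsing_inv_mul _ ((isUnit_iff_isUnit_det _).1 hunit'), one_mulVec]
  have h2 : Γ.invSq (Γ.matrix *ᵥ w) =
      (fun v => ((Γ.matrix *ᵥ w) v : ℚ)) ⬝ᵥ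
        ((Γ.matrix.map (Int.cast : ℤ → ℚ))⁻¹ *ᵥ (fun v => ((Γ.matrix *ᵥ w) v : ℚ))) := by
    rw [PlumbingGraph.invSq]
  rw [h2, e, dotProduct_comm]
  simp [dotProduct]

/-- The exponent of `q` is a multiple of the value of the inverse form at `2 M x + k - M u`. -/
lemma eps_eq (hsurj : ∀ ℓ : V → ℤ, ∃ x, Γ.matrix *ᵥ x = ℓ) (k x : V → ℤ) :
    ∃ z, Γ.matrix *ᵥ z = coeffVec Γ k x ∧ Γ.eps k x =
      -(((coeffVec Γ k x ⬝ᵥ z : ℤ) : ℚ) + 3 * Fintype.card V + ((∑ v, Γ.weight v : ℤ) : ℚ)) / 4 := by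
  obtain ⟨w, hw⟩ := hsurj (k - Γ.matrix *ᵥ 1)
  have hℓ : coeffVec Γ k x = Γ.matrix *ᵥ (2 • x + w) := by
    rw [coeffVec, mulVec_add, hw, mulVec_smul, add_sub_assoc]
  refine ⟨2 • x + w, hℓ.symm, ?_⟩
  have hsym := dotProduct_mulVec_comm Γ
  have e1 : (Γ.matrix *ᵥ (2 • x + w)) ⬝ᵥ (2 • x + w) =
      4 * (x ⬝ᵥ Γ.matrix *ᵥ x) + 4 * ((k ⬝ᵥ x) - x ⬝ᵥ Γ.matrix *ᵥ 1) + w ⬝ᵥ Γ.matrix *ᵥ w := by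
    have h1 : w ⬝ᵥ Γ.matrix *ᵥ x = k ⬝ᵥ x - x ⬝ᵥ Γ.matrix *ᵥ 1 := by
      rw [← hsym, hw, sub_dotProduct, dotProduct_comm x]
    have h2 : x ⬝ᵥ Γ.matrix *ᵥ w = k ⬝ᵥ x - x ⬝ᵥ Γ.matrix *ᵥ 1 := by
      rw [← h1, ← hsym, dotProduct_comm]
    rw [hsym]
    simp only [mulVec_add, mulVec_smul, add_dotProduct, dotProduct_add, smul_dotProduct, dotProduct_smul,
      h1, h2]
    simp only [nsmul_eq_mul]
    push_cast
    ring
  rw [PlumbingGraph.eps, ← hw, invSq_mulVec Γ hsurj, PlumbingGraph.chi, PlumbingGraph.form,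
    PlumbingGraph.form, hℓ, e1]
  push_cast
  ring

/-- The exponent of `t` is half of the sum of the entries of `2 M x + k - M u`. -/
lemma theta_add_form (k x : V → ℤ) :
    Γ.theta k + Γ.form x 1 = (coeffVec Γ k x ⬝ᵥ 1) / 2 := by
  have h1 : coeffVec Γ k x ⬝ᵥ 1 = (k ⬝ᵥ 1 - Γ.form 1 1) + Γ.form x 1 * 2 := by
    have := dotProduct_mulVec_comm Γ
    simp only [coeffVec, PlumbingGraph.form, sub_dotProduct, add_dotProduct, smul_dotProduct, this]
    simp only [nsmul_eq_mul]
    push_cast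
    ring
  rw [h1, Int.add_mul_ediv_right _ _ two_ne_zero, PlumbingGraph.theta]

end General

lemma qpow_add (r s : ℚ) (τ : ℂ) : qpow (r + s) τ = qpow r τ * qpow s τ := by
  rw [qpow, qpow, qpow, ← Complex.exp_add]
  congr 1
  push_cast
  ring

section Star

variable {P : StarPlumbing} {b : Fin 3 → ℕ}

/-- The residue `α` with the signs `e₁, e₂`. -/
def alpha (b : Fin 3 → ℕ) (e₁ e₂ : ℤ) : ℤ :=
  b 0 * b 1 * b 2 - b 1 * b 2 + e₁ * (b 0 * b 2) + e₂ * (b 0 * b 1)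

/-- The signs at the tips. By the symmetry `x ↦ -x` of the sum they are normalized, up to a common sign
`s`, to be `-1` at the first leg. -/
def signs (e₁ e₂ s : ℤˣ) : Fin 3 → ℤˣ := ![-s, s * e₁, s * e₂]

/-- Every vector with an odd entry at the centre, `±1` at the tips, and `0` elsewhere occurs: it has the parity of
`2 M x + k - M u`, and `M` is invertible over the integers. -/
lemma exists_coeffVec_eq (hb : ∀ i, 2 ≤ b i) (hP : P.IsPlumbingOf b) {k : P.Vertex → ℤ}
    (hk : P.toGraph.IsSpinc k) {r : ℤ} (hr : Odd r) (e : Fin 3 → ℤˣ) :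
    ∃ x, coeffVec P.toGraph k x = tipVec P r fun i => e i := by
  obtain ⟨h0, h1⟩ := deg_eq (IsPlumbingOf.length_pos hb hP)
  have hunit : ∀ e : ℤˣ, Odd (e : ℤ) := fun e => by
    rcases Int.units_eq_one_or e with rfl | rfl <;> decide
  have hpar : ∀ v, (2 : ℤ) ∣ tipVec P r (fun i => e i) v - P.toGraph.deg v := by
    intro v
    rcases v with _ | ⟨i, a⟩
    · rw [h0]
      obtain ⟨u, hu⟩ := hr
      exact ⟨u - 1, by simp only [tipVec]; push_cast; linarith⟩
    · rw [h1]
      simp only [tipVec]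
      split_ifs
      · obtain ⟨u, hu⟩ := hunit (e i)
        exact ⟨u, by push_cast; linarith⟩
      · norm_num
  have hdvd : ∀ v, (2 : ℤ) ∣ tipVec P r (fun i => e i) v - (k v - (P.toGraph.matrix *ᵥ 1) v) := by
    intro v
    have h2 := Int.modEq_iff_dvd.1 (hk v)
    have h3 := hpar v
    rw [mulVec_one_eq]
    have e : tipVec P r (fun i => e i) v - (k v - (P.toGraph.weight v + P.toGraph.deg v)) =
        (tipVec P r (fun i => e i) v - P.toGraph.deg v) + (P.toGraph.weight v - k v) +
          2 * P.toGraph.deg v := by ring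
    rw [e]
    exact ((h3.add h2).add (dvd_mul_right _ _))
  choose y hy using hdvd
  obtain ⟨x, hx⟩ := mulVec_surjective (fun i => by have := hb i; omega) hP y
  refine ⟨x, ?_⟩
  funext v
  have := hy v
  simp only [coeffVec, hx, Pi.add_apply, Pi.sub_apply, Pi.smul_apply]
  simp only [nsmul_eq_mul]
  push_cast
  linarith

lemma tipVec_dotProduct_one (hlen : ∀ i, 0 < (P.leg i).length) (r : ℤ) (e : Fin 3 → ℤ) :
    tipVec P r e ⬝ᵥ 1 = r + ∑ i, e i := by
  rw [tipVec_dotProduct hlen]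
  congr 1
  · simp
  · refine Finset.sum_congr rfl fun i _ => ?_
    rw [legSeq_tip hlen]
    simp

/-- The terms of the series in the support of the coefficients. -/
lemma zhhTerm_eq (hb : ∀ i, 2 ≤ b i) (hP : P.IsPlumbingOf b) {k x : P.Vertex → ℤ} {t τ : ℂ} {u : ℤ}
    {e₁ e₂ s : ℤˣ}
    (hx : coeffVec P.toGraph k x = tipVec P (s * (2 * u + 1)) fun i => signs e₁ e₂ s i) :
    P.toGraph.zhhTerm k t τ x = qpow (P.Delta b) τ * ((e₁ * e₂ : ℤ) *
      ((2 * u + 1).sign / 2 * t ^ ((s : ℤ) * (u + (e₁ + e₂) / 2)) *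
        qpow (((alpha b e₁ e₂ + 2 * (b 0 * b 1 * b 2 : ℕ) * u : ℤ) : ℚ) ^ 2 /
          (4 * (b 0 * b 1 * b 2 : ℕ))) τ)) := by
  have hlen := IsPlumbingOf.length_pos hb hP
  have hb0 : ∀ i, 0 < b i := fun i => by have := hb i; omega
  have hbQ : ∀ i, (b i : ℚ) ≠ 0 := fun i => by exact_mod_cast (hb0 i).ne'
  have hodd : Odd ((s : ℤ) * (2 * u + 1)) := by
    refine Odd.mul ?_ ⟨u, rfl⟩
    rcases Int.units_eq_one_or s with rfl | rfl <;> decide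
  have hsq : ∀ e : ℤˣ, (e : ℤ) * e = 1 := fun e => by
    rcases Int.units_eq_one_or e with rfl | rfl <;> rfl
  have hprod := prod_Fhat_tipVec hlen hodd (signs e₁ e₂ s)
  obtain ⟨z, hz, heps⟩ := eps_eq P.toGraph (mulVec_surjective hb0 hP) k x
  rw [hx] at hz heps
  rw [tipVec_dotProduct_solution hb hP hz] at heps
  have hth := theta_add_form P.toGraph k x
  rw [hx, tipVec_dotProduct_one hlen, Fin.sum_univ_three] at hth
  have hs0 : ((signs e₁ e₂ s 0 : ℤˣ) : ℤ) = -s := by simp [signs]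
  have hs1 : ((signs e₁ e₂ s 1 : ℤˣ) : ℤ) = s * e₁ := by simp [signs]
  have hs2 : ((signs e₁ e₂ s 2 : ℤˣ) : ℤ) = s * e₂ := by simp [signs]
  rw [hs0, hs1, hs2] at hth hprod
  simp only [Fin.sum_univ_three, hs0, hs1, hs2] at heps
  have hs := hsq s
  have hexp : P.toGraph.theta k + P.toGraph.form x 1 = (s : ℤ) * (u + (e₁ + e₂) / 2) := by
    rw [hth]
    rcases Int.units_eq_one_or e₁ with rfl | rfl <;> rcases Int.units_eq_one_or e₂ with rfl | rfl <;>
    rcases Int.units_eq_one_or s with rfl | rfl <;> push_cast <;> omega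
  have hsign : (((s : ℤ) * (2 * u + 1)).sign : ℤ) = s * (2 * u + 1).sign := by
    rw [Int.sign_mul]
    rcases Int.units_eq_one_or s with rfl | rfl <;> simp
  have hΔ : P.toGraph.eps k x = P.Delta b +
      ((alpha b e₁ e₂ + 2 * (b 0 * b 1 * b 2 : ℕ) * u : ℤ) : ℚ) ^ 2 / (4 * (b 0 * b 1 * b 2 : ℕ)) := by
    have hb0 := hbQ 0
    have hb1 := hbQ 1
    have hb2 := hbQ 2
    rw [heps, StarPlumbing.Delta, alpha, Fin.sum_univ_three]
    rcases Int.units_eq_one_or e₁ with rfl | rfl <;> rcases Int.units_eq_one_or e₂ with rfl | rfl <;>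
    rcases Int.units_eq_one_or s with rfl | rfl <;> push_cast <;> field_simp <;> ring
  rw [PlumbingGraph.zhhTerm, hexp, hΔ, qpow_add]
  have hprod' : ∏ v, Fhat (P.toGraph.deg v) ((2 • P.toGraph.matrix.mulVec x + k -
      P.toGraph.matrix.mulVec 1) v) = (e₁ * e₂ : ℤ) * ((2 * u + 1).sign / 2 : ℚ) := by
    change ∏ v, Fhat (P.toGraph.deg v) (coeffVec P.toGraph k x v) = _
    rw [hx, hprod, hsign]
    have hsQ : ((s : ℤ) : ℚ) * (s : ℤ) = 1 := by exact_mod_cast hs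
    push_cast
    linear_combination (((2 * u + 1).sign : ℚ) * (e₁ : ℤ) * (e₂ : ℤ) / 2 * ((s : ℤ) * (s : ℤ) + 1)) * hsQ
  rw [hprod']
  push_cast
  ring

end Star

end FalseTheta

/-! ### Summation over the lattice -/

namespace FalseTheta

open Complex

lemma sum_units_int {M : Type*} [AddCommMonoid M] (f : ℤˣ → M) : ∑ e, f e = f 1 + f (-1) := by
  rw [UnitsInt.univ, Finset.sum_pair (by decide)]

section

variable {b : Fin 3 → ℕ} {ζ : ℂ} {j : ℕ}

lemma phi_eq_sum (b : Fin 3 → ℕ) (n : ℤ) (ζ : ℂ) : phi b n ζ =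
    ∑ e₁ : ℤˣ, ∑ e₂ : ℤˣ, -((e₁ * e₂ : ℤ) : ℂ) * phiPart (b 0 * b 1 * b 2) (alpha b e₁ e₂)
      (alpha b e₁ e₂ - (b 0 * b 1 * b 2 : ℕ) * (e₁ + e₂)) n ζ := by
  simp only [sum_units_int, phi]
  have a1 : alpha b (-1 : ℤˣ) (-1 : ℤˣ) = b 0 * b 1 * b 2 - b 0 * b 1 - b 0 * b 2 - b 1 * b 2 := by
    simp only [alpha]; push_cast; ring
  have a2 : alpha b (-1 : ℤˣ) (1 : ℤˣ) = b 0 * b 1 * b 2 + b 0 * b 1 - b 0 * b 2 - b 1 * b 2 := by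
    simp only [alpha]; push_cast; ring
  have a3 : alpha b (1 : ℤˣ) (-1 : ℤˣ) = b 0 * b 1 * b 2 - b 0 * b 1 + b 0 * b 2 - b 1 * b 2 := by
    simp only [alpha]; push_cast; ring
  have a4 : alpha b (1 : ℤˣ) (1 : ℤˣ) = b 0 * b 1 * b 2 + b 0 * b 1 + b 0 * b 2 - b 1 * b 2 := by
    simp only [alpha]; push_cast; ring
  rw [a1, a2, a3, a4]
  have s1 : ∀ α : ℤ, α - (b 0 * b 1 * b 2 : ℕ) * (((1 : ℤˣ) : ℤ) + ((1 : ℤˣ) : ℤ)) =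
      α - 2 * (b 0 * b 1 * b 2 : ℕ) := fun α => by push_cast; ring
  have s2 : ∀ α : ℤ, α - (b 0 * b 1 * b 2 : ℕ) * (((-1 : ℤˣ) : ℤ) + ((-1 : ℤˣ) : ℤ)) =
      α + 2 * (b 0 * b 1 * b 2 : ℕ) := fun α => by push_cast; ring
  have s3 : ∀ α : ℤ, α - (b 0 * b 1 * b 2 : ℕ) * (((1 : ℤˣ) : ℤ) + ((-1 : ℤˣ) : ℤ)) = α :=
    fun α => by push_cast; ring
  have s4 : ∀ α : ℤ, α - (b 0 * b 1 * b 2 : ℕ) * (((-1 : ℤˣ) : ℤ) + ((1 : ℤˣ) : ℤ)) = α :=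
    fun α => by push_cast; ring
  rw [s1, s2, s3, s4]
  push_cast
  ring

lemma not_dvd_alpha_signs (hb : 2 ≤ b 0) (h01 : (b 0).Coprime (b 1)) (h02 : (b 0).Coprime (b 2))
    (e₁ e₂ : ℤ) : ¬ ((b 0 * b 1 * b 2 : ℕ) : ℤ) ∣ alpha b e₁ e₂ :=
  not_dvd_alpha hb h01 h02 _ ⟨b 1 * b 2 + e₁ * b 2 + e₂ * b 1, by rw [alpha]; ring⟩

section OneClass

variable {p : ℕ} {α w : ℤ}

lemma natAbs_class_injective (hp : 0 < p) (hα : ¬ (p : ℤ) ∣ α) :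
    Function.Injective fun u : ℤ => (α + 2 * p * u).natAbs := by
  intro u v huv
  have hpZ : (p : ℤ) ≠ 0 := by exact_mod_cast hp.ne'
  rcases Int.natAbs_eq_natAbs_iff.1 huv with h | h
  · have : (2 * p : ℤ) * u = 2 * p * v := by linarith
    exact mul_left_cancel₀ (mul_ne_zero two_ne_zero hpZ) this
  · exact absurd ⟨-(u + v), by linarith⟩ hα

/-- The value of the coefficient function on the class of `α`, up to sign. -/
lemma phiPart_natAbs (hp : 0 < p) (hα : ¬ (p : ℤ) ∣ α) (u : ℤ) :
    phiPart p α (α - 2 * p * w) (α + 2 * p * u).natAbs ζ =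
      ((α + 2 * p * u).sign : ℂ) / 2 * (ζ ^ (u + w) + ζ ^ (-(u + w))) := by
  have hp2 : (2 * p : ℤ) ≠ 0 := by positivity
  have hne : α + 2 * p * u ≠ 0 := fun h => hα ⟨-2 * u, by linarith⟩
  have hpos : phiPart p α (α - 2 * p * w) (α + 2 * p * u) ζ =
      1 / 2 * (ζ ^ (u + w) + ζ ^ (-(u + w))) := by
    rw [phiPart, if_pos (Int.modEq_iff_dvd.2 ⟨-u, by ring⟩),
      show -(α + 2 * p * u) + (α - 2 * p * w) = 2 * p * (-(u + w)) by ring,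
      show α + 2 * p * u - (α - 2 * p * w) = 2 * p * (u + w) by ring,
      Int.mul_ediv_cancel_left _ hp2, Int.mul_ediv_cancel_left _ hp2]
    ring
  rcases lt_or_gt_of_ne hne with h | h
  · rw [Int.ofNat_natAbs_of_nonpos h.le, phiPart_neg hα, hpos, Int.sign_eq_neg_one_of_neg h]
    push_cast
    ring
  · rw [Int.natAbs_of_nonneg h.le, hpos, Int.sign_eq_one_of_pos h]
    push_cast
    ring

/-- The part of a false theta series that belongs to one residue class, as a sum over the class. -/
lemma hasSum_class (hp : 0 < p) (hα : ¬ (p : ℤ) ∣ α) {g : ℕ → ℂ} {a : ℂ}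
    (h : HasSum (fun n : ℕ => phiPart p α (α - 2 * p * w) n ζ * g n) a) :
    HasSum (fun u : ℤ => ((α + 2 * p * u).sign : ℂ) / 2 * (ζ ^ (u + w) + ζ ^ (-(u + w))) *
      g (α + 2 * p * u).natAbs) a := by
  rw [← (natAbs_class_injective hp hα).hasSum_iff] at h
  · refine h.congr_fun ?_
    intro u
    simp only [Function.comp]
    rw [← phiPart_natAbs hp hα]
  · intro n hn
    have h1 : ¬ (n : ℤ) ≡ α [ZMOD 2 * p] := by
      intro h1
      obtain ⟨k, hk⟩ := Int.modEq_iff_dvd.1 h1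
      refine hn ⟨-k, ?_⟩
      simp only
      rw [show α + 2 * p * -k = n by linarith, Int.natAbs_natCast]
    have h2 : ¬ (n : ℤ) ≡ -α [ZMOD 2 * p] := by
      intro h2
      obtain ⟨k, hk⟩ := Int.modEq_iff_dvd.1 h2
      refine hn ⟨k, ?_⟩
      simp only
      rw [show α + 2 * p * k = -n by linarith, Int.natAbs_neg, Int.natAbs_natCast]
    rw [phiPart, if_neg h1, if_neg h2, zero_mul]

end OneClass

section Sign

lemma pos_alpha (hb : 2 ≤ b 0) (h01 : b 0 < b 1) (h12 : b 1 < b 2) (e₁ e₂ : ℤˣ)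
    (he : ¬ (e₁ = -1 ∧ e₂ = -1)) : 0 < alpha b e₁ e₂ := by
  obtain ⟨x, hx⟩ : ∃ x : ℤ, (b 0 : ℤ) = x := ⟨_, rfl⟩
  obtain ⟨y, hy⟩ : ∃ y : ℤ, (b 1 : ℤ) = y := ⟨_, rfl⟩
  obtain ⟨z, hz⟩ : ∃ z : ℤ, (b 2 : ℤ) = z := ⟨_, rfl⟩
  have h1 : 2 ≤ x := by omega
  have h2 : x + 1 ≤ y := by omega
  have h3 : y + 1 ≤ z := by omega
  rw [alpha, hx, hy, hz]
  -- the smallest case is `(x, y, z) = (2, 3, 4)`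
  have hxy : 0 ≤ (x - 2) * (y - 3) := mul_nonneg (by omega) (by omega)
  have hxz : 0 ≤ (x - 2) * (z - 4) := mul_nonneg (by omega) (by omega)
  rcases Int.units_eq_one_or e₁ with rfl | rfl <;> rcases Int.units_eq_one_or e₂ with rfl | rfl
  · push_cast; nlinarith [mul_pos (show 0 < y by omega) (show 0 < z by omega)]
  · push_cast
    -- `y (x z - z - x) + x z > 0`
    have : 0 < y * (x * z - z - x) := mul_pos (by omega) (by nlinarith)
    nlinarith
  · push_cast
    have : 0 < z * (x * y - y - x) := mul_pos (by omega) (by nlinarith)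
    nlinarith
  · exact absurd ⟨rfl, rfl⟩ he

/-- The exceptional triple is the only one with `1/b₀ + 1/b₁ + 1/b₂ ≥ 1`. -/
lemma pos_alpha_neg_neg (hb : 2 ≤ b 0) (h01 : b 0 < b 1) (h12 : b 1 < b 2)
    (h02c : (b 0).Coprime (b 2)) (h12c : (b 1).Coprime (b 2)) (h01c : (b 0).Coprime (b 1))
    (hne : ¬ (b 0 = 2 ∧ b 1 = 3 ∧ b 2 = 5)) : 0 < alpha b (-1) (-1) := by
  rw [alpha]
  generalize b 0 = x at *
  generalize b 1 = y at *
  generalize b 2 = z at *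
  have key : ∀ x' y' z' : ℤ, 0 < z' * (x' * y' - x' - y') - x' * y' →
      0 < x' * y' * z' - y' * z' + -1 * (x' * z') + -1 * (x' * y') := by
    intro x' y' z' h; linarith
  refine key _ _ _ ?_
  rcases Nat.lt_or_ge x 3 with hx3 | hx3
  · obtain rfl : x = 2 := by omega
    rcases Nat.lt_or_ge y 5 with hy5 | hy5
    · have : y = 3 ∨ y = 4 := by omega
      rcases this with rfl | rfl
      · have hz7 : 7 ≤ z := by
          by_contra hcon
          have : z = 4 ∨ z = 5 ∨ z = 6 := by omega
          rcases this with rfl | rfl | rfl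
          · norm_num at h02c
          · exact hne ⟨rfl, rfl, rfl⟩
          · norm_num at h02c
        push_cast
        omega
      · norm_num at h01c
    · push_cast
      have h1 : (5 : ℤ) ≤ y := by exact_mod_cast hy5
      have h2 : (y : ℤ) + 1 ≤ z := by exact_mod_cast h12
      nlinarith
  · have h1 : (3 : ℤ) ≤ x := by exact_mod_cast hx3
    have h2 : (x : ℤ) + 1 ≤ y := by exact_mod_cast h01
    have h3 : (y : ℤ) + 1 ≤ z := by exact_mod_cast h12
    -- `x y ≥ 2 (x + y) - 2`, and so `x y - x - y ≥ (x y - 2) / 2`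
    have h4 : 0 ≤ ((x : ℤ) - 3) * (y - 4) := mul_nonneg (by omega) (by omega)
    have h5 : 5 * (x * y - x - y : ℤ) ≤ z * (x * y - x - y) :=
      mul_le_mul_of_nonneg_right (by omega) (by nlinarith)
    nlinarith

lemma alpha_lt (hb : 2 ≤ b 0) (h01 : b 0 < b 1) (h12 : b 1 < b 2) (e₁ e₂ : ℤˣ) :
    alpha b e₁ e₂ < 2 * (b 0 * b 1 * b 2 : ℕ) := by
  obtain ⟨x, hx⟩ : ∃ x : ℤ, (b 0 : ℤ) = x := ⟨_, rfl⟩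
  obtain ⟨y, hy⟩ : ∃ y : ℤ, (b 1 : ℤ) = y := ⟨_, rfl⟩
  obtain ⟨z, hz⟩ : ∃ z : ℤ, (b 2 : ℤ) = z := ⟨_, rfl⟩
  have h1 : 2 ≤ x := by omega
  have h2 : 3 ≤ y := by omega
  have h3 : 4 ≤ z := by omega
  push_cast
  rw [alpha, hx, hy, hz]
  have hyz : 0 < x * (y * z - y - z) := mul_pos (by omega) (by nlinarith)
  have p1 : 0 < y * z := mul_pos (by omega) (by omega)
  have p2 : 0 < x * z := mul_pos (by omega) (by omega)
  have p3 : 0 < x * y := mul_pos (by omega) (by omega)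
  rcases Int.units_eq_one_or e₁ with rfl | rfl <;> rcases Int.units_eq_one_or e₂ with rfl | rfl <;>
    push_cast <;> nlinarith

lemma sign_add_mul {p : ℕ} {α : ℤ} (h0 : 0 < α) (h1 : α < 2 * p) (u : ℤ) :
    (α + 2 * p * u).sign = (2 * u + 1).sign := by
  rcases lt_or_ge u 0 with hu | hu
  · have : (2 * p : ℤ) * u ≤ 2 * p * (-1) := mul_le_mul_of_nonneg_left (by omega) (by positivity)
    rw [Int.sign_eq_neg_one_of_neg (by linarith), Int.sign_eq_neg_one_of_neg (by omega)]
  · have : 0 ≤ (2 * p : ℤ) * u := by positivity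
    rw [Int.sign_eq_one_of_pos (by linarith), Int.sign_eq_one_of_pos (by omega)]

end Sign

end

end FalseTheta

/-! ### Evaluation of the two-variable series at roots of unity -/

namespace FalseTheta

open Matrix Complex

section

variable {b : Fin 3 → ℕ} {ζ τ : ℂ} {j : ℕ}

lemma qpow_sq_div (p : ℕ) (N : ℤ) :
    qpow ((N : ℚ) ^ 2 / (4 * p)) τ = expi ((N.natAbs : ℂ) ^ 2 / (4 * p) * τ) := by
  have : ((N.natAbs : ℤ) : ℂ) ^ 2 = (N : ℂ) ^ 2 := by
    exact_mod_cast congrArg (Int.cast : ℤ → ℂ) (Int.natAbs_sq N)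
  rw [Int.cast_natCast] at this
  rw [qpow, expi, this]
  congr 1
  push_cast
  ring

lemma summable_mul_expi {p : ℕ} (hp : 0 < p) (hτ : 0 < τ.im) {ψ : ℕ → ℂ} (hψ : ∃ B, ∀ n, ‖ψ n‖ ≤ B) :
    Summable fun n : ℕ => ψ n * expi ((n : ℂ) ^ 2 / (4 * p) * τ) := by
  have hpR : (0 : ℝ) < p := by exact_mod_cast hp
  have := summable_eichler (κ := Real.pi / (2 * p)) (s := -(I * τ))
    (by have := Real.pi_pos; positivity) hψ (by simpa using hτ)
  refine this.congr fun n => ?_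
  rw [expi]
  congr 2
  push_cast
  field_simp
  ring

lemma summable_phiPart_mul_expi {p : ℕ} (hp : 0 < p) (hj : 0 < j) (hζ : ζ ^ j = 1) (hτ : 0 < τ.im)
    (α c : ℤ) : Summable fun n : ℕ => phiPart p α c n ζ * expi ((n : ℂ) ^ 2 / (4 * p) * τ) := by
  have hζ0 : ζ ≠ 0 := by rintro rfl; rw [zero_pow hj.ne'] at hζ; exact zero_ne_one hζ
  obtain ⟨B, hB⟩ := exists_bound_of_periodic (f := fun n => phiPart p α c n ζ)
    (by positivity : 0 < 2 * p * j) fun n => phiPart_add_period hp hζ0 hζ n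
  exact summable_mul_expi hp hτ ⟨B, fun n => hB n⟩

/-- For all triples but `(2, 3, 5)` the signs of `2 u + 1` and of `α + 2 p u` agree. For `(2, 3, 5)` they
differ for `α = -1` and `u = 0` only, which is the origin of the correction term. -/
lemma hasSum_signed (hb : 2 ≤ b 0) (h01 : b 0 < b 1) (h12 : b 1 < b 2)
    (hc01 : (b 0).Coprime (b 1)) (hc02 : (b 0).Coprime (b 2)) (hc12 : (b 1).Coprime (b 2))
    (hj : 0 < j) (hζ : ζ ^ j = 1) (hτ : 0 < τ.im) (e₁ e₂ : ℤˣ) :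
    HasSum (fun u : ℤ => ((2 * u + 1).sign : ℂ) / 2 *
        (ζ ^ (u + (e₁ + e₂) / 2 : ℤ) + ζ ^ (-(u + (e₁ + e₂) / 2) : ℤ)) *
        expi (((alpha b e₁ e₂ + 2 * (b 0 * b 1 * b 2 : ℕ) * u).natAbs : ℂ) ^ 2 /
          (4 * (b 0 * b 1 * b 2 : ℕ)) * τ))
      ((∑' n : ℕ, phiPart (b 0 * b 1 * b 2) (alpha b e₁ e₂)
        (alpha b e₁ e₂ - (b 0 * b 1 * b 2 : ℕ) * (e₁ + e₂)) n ζ *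
          expi ((n : ℂ) ^ 2 / (4 * (b 0 * b 1 * b 2 : ℕ)) * τ)) +
        if e₁ = -1 ∧ e₂ = -1 then CTerm b ζ τ else 0) := by
  have hp : 0 < b 0 * b 1 * b 2 := by
    have h1 : 0 < b 1 := by omega
    have h2 : 0 < b 2 := by omega
    positivity
  have hα := not_dvd_alpha_signs hb hc01 hc02 (e₁ : ℤ) (e₂ : ℤ)
  have hw : (b 0 * b 1 * b 2 : ℕ) * ((e₁ : ℤ) + e₂) = 2 * (b 0 * b 1 * b 2 : ℕ) * (((e₁ : ℤ) + e₂) / 2) := by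
    rcases Int.units_eq_one_or e₁ with rfl | rfl <;> rcases Int.units_eq_one_or e₂ with rfl | rfl <;>
      norm_num <;> ring
  rw [hw]
  set w : ℤ := ((e₁ : ℤ) + e₂) / 2 with hwdef
  have hsum : Summable fun n : ℕ => phiPart (b 0 * b 1 * b 2) (alpha b e₁ e₂)
      (alpha b e₁ e₂ - 2 * (b 0 * b 1 * b 2 : ℕ) * w) n ζ *
        expi ((n : ℂ) ^ 2 / (4 * (b 0 * b 1 * b 2 : ℕ)) * τ) :=
    summable_phiPart_mul_expi hp hj hζ hτ _ _
  have hmain := hasSum_class (ζ := ζ) (w := w) hp hα hsum.hasSum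
  by_cases hex : (e₁ = -1 ∧ e₂ = -1) ∧ (b 0 = 2 ∧ b 1 = 3 ∧ b 2 = 5)
  · obtain ⟨⟨rfl, rfl⟩, h0, h1, h2⟩ := hex
    have hα1 : alpha b (-1 : ℤˣ) (-1 : ℤˣ) = -1 := by
      rw [alpha, h0, h1, h2]; norm_num
    have hw1 : w = -1 := by rw [hwdef]; norm_num
    have hC : CTerm b ζ τ = qpow (1 / 120) τ * (ζ + ζ⁻¹) := if_pos ⟨h0, h1, h2⟩
    rw [if_pos ⟨rfl, rfl⟩]
    refine (hmain.add (hasSum_ite_eq (0 : ℤ) (CTerm b ζ τ))).congr_fun ?_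
    intro u
    rw [hα1, hw1, hC, h0, h1, h2]
    by_cases hu : u = 0
    · subst hu
      rw [if_pos rfl]
      have e1 : qpow (1 / 120) τ = expi (1 / 120 * τ) := by
        rw [qpow, expi]; push_cast; congr 1; ring
      rw [e1]
      norm_num
      ring
    · rw [if_neg hu, add_zero]
      congr 3
      norm_num
      rcases lt_or_gt_of_ne hu with h | h
      · rw [Int.sign_eq_neg_one_of_neg (by omega), Int.sign_eq_neg_one_of_neg (by omega)]
      · rw [Int.sign_eq_one_of_pos (by omega), Int.sign_eq_one_of_pos (by omega)]
  · have hpos : 0 < alpha b e₁ e₂ := by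
      by_cases he : e₁ = -1 ∧ e₂ = -1
      · obtain ⟨rfl, rfl⟩ := he
        exact pos_alpha_neg_neg hb h01 h12 hc02 hc12 hc01 fun h => hex ⟨⟨rfl, rfl⟩, h⟩
      · exact pos_alpha hb h01 h12 e₁ e₂ he
    have hC : (if e₁ = -1 ∧ e₂ = -1 then CTerm b ζ τ else 0) = 0 := by
      split_ifs with he
      · rw [CTerm, if_neg fun h => hex ⟨he, h⟩]
      · rfl
    rw [hC, add_zero]
    refine hmain.congr_fun ?_
    intro u
    rw [sign_add_mul hpos (alpha_lt hb h01 h12 e₁ e₂)]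

/-- The four classes `±α_k` are indexed by two signs. -/
lemma hasSum_ASeries (hb : 2 ≤ b 0) (h01 : b 0 < b 1) (h12 : b 1 < b 2)
    (hj : 0 < j) (hζ : ζ ^ j = 1) (hτ : 0 < τ.im) :
    ASeries b ζ τ = ∑ e₁ : ℤˣ, ∑ e₂ : ℤˣ, -((e₁ * e₂ : ℤ) : ℂ) *
      ∑' n : ℕ, phiPart (b 0 * b 1 * b 2) (alpha b e₁ e₂)
        (alpha b e₁ e₂ - (b 0 * b 1 * b 2 : ℕ) * (e₁ + e₂)) n ζ *
          expi ((n : ℂ) ^ 2 / (4 * (b 0 * b 1 * b 2 : ℕ)) * τ) := by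
  have hp : 0 < b 0 * b 1 * b 2 := by
    have h1 : 0 < b 1 := by omega
    have h2 : 0 < b 2 := by omega
    positivity
  have hsum : ∀ e₁ e₂ : ℤˣ, Summable fun n : ℕ => phiPart (b 0 * b 1 * b 2) (alpha b e₁ e₂)
      (alpha b e₁ e₂ - (b 0 * b 1 * b 2 : ℕ) * (e₁ + e₂)) n ζ *
        expi ((n : ℂ) ^ 2 / (4 * (b 0 * b 1 * b 2 : ℕ)) * τ) :=
    fun e₁ e₂ => summable_phiPart_mul_expi hp hj hζ hτ _ _
  have := hasSum_sum (s := Finset.univ) fun (e₁ : ℤˣ) _ => hasSum_sum (s := Finset.univ)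
    fun (e₂ : ℤˣ) _ => (hsum e₁ e₂).hasSum.mul_left (-((e₁ * e₂ : ℤ) : ℂ))
  rw [← this.tsum_eq, ASeries]
  refine tsum_congr fun n => ?_
  rw [ATerm_eq, phi_eq_sum, Finset.sum_mul]
  refine Finset.sum_congr rfl fun e₁ _ => ?_
  rw [Finset.sum_mul]
  exact Finset.sum_congr rfl fun e₂ _ => by ring

variable {P : StarPlumbing}

lemma coeffVec_injective (hP : P.IsPlumbingOf b) (k : P.Vertex → ℤ) :
    Function.Injective (coeffVec P.toGraph k) := by
  intro x y hxy
  refine mulVec_injective_of_isNegDef _ hP.1 ?_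
  funext v
  have := congrFun hxy v
  simp only [coeffVec, Pi.add_apply, Pi.sub_apply, Pi.smul_apply] at this
  simp only [nsmul_eq_mul] at this
  push_cast at this
  linarith

lemma tipVec_legVertex (hlen : ∀ i, 0 < (P.leg i).length) (r : ℤ) (e : Fin 3 → ℤ) (i : Fin 3) :
    tipVec P r e (legVertex P i ((P.leg i).length - 1) (Nat.sub_lt (hlen i) one_pos)) = e i :=
  if_pos (Nat.sub_add_cancel (hlen i))

/-- The value of the two-variable series at a root of unity. -/
theorem zhh_eq (hb : 2 ≤ b 0) (h01 : b 0 < b 1) (h12 : b 1 < b 2)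
    (hc01 : (b 0).Coprime (b 1)) (hc02 : (b 0).Coprime (b 2)) (hc12 : (b 1).Coprime (b 2))
    (hj : 0 < j) (hζ : ζ ^ j = 1) (hτ : 0 < τ.im) (hP : P.IsPlumbingOf b) {k : P.Vertex → ℤ}
    (hk : P.toGraph.IsSpinc k) :
    Summable (P.toGraph.zhhTerm k ζ τ) ∧
      P.toGraph.zhh k ζ τ = qpow (P.Delta b) τ * (CTerm b ζ τ - ASeries b ζ τ) := by
  have hball : ∀ i, 2 ≤ b i := by
    intro i; fin_cases i
    · exact hb
    · exact (by omega : 2 ≤ b 1)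
    · exact (by omega : 2 ≤ b 2)
  have hlen := IsPlumbingOf.length_pos hball hP
  have hp : 0 < b 0 * b 1 * b 2 := by
    have h1 : 0 < b 1 := by omega
    have h2 : 0 < b 2 := by omega
    positivity
  have hζn : ‖ζ‖ = 1 := Complex.norm_eq_one_of_pow_eq_one hζ hj.ne'
  have hoddu : ∀ (s : ℤˣ) (u : ℤ), Odd ((s : ℤ) * (2 * u + 1)) := fun s u => by
    refine Odd.mul ?_ ⟨u, rfl⟩
    rcases Int.units_eq_one_or s with rfl | rfl <;> decide
  have hunit : ∀ s : ℤˣ, (s : ℤ) * s = 1 := fun s => by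
    rcases Int.units_eq_one_or s with rfl | rfl <;> rfl
  -- the support of the series is parametrized by the signs at the tips, where `s` is the common sign
  -- of `signs`, and by the value `s (2 u + 1)` at the centre
  choose X hX using fun q : (ℤˣ × ℤˣ × ℤˣ) × ℤ =>
    exists_coeffVec_eq hball hP hk (hoddu q.1.2.2 q.2) (signs q.1.1 q.1.2.1 q.1.2.2)
  have hXinj : Function.Injective X := by
    rintro ⟨⟨e₁, e₂, s⟩, u⟩ ⟨⟨e₁', e₂', s'⟩, u'⟩ hxx
    have h := (hX ⟨⟨e₁, e₂, s⟩, u⟩).symm.trans ((congrArg _ hxx).trans (hX ⟨⟨e₁', e₂', s'⟩, u'⟩))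
    simp only at h
    have ht : ∀ i, signs e₁ e₂ s i = signs e₁' e₂' s' i := by
      intro i
      have := congrFun h (legVertex P i ((P.leg i).length - 1) (Nat.sub_lt (hlen i) one_pos))
      rw [tipVec_legVertex hlen, tipVec_legVertex hlen] at this
      exact Units.ext this
    have hs : s = s' := neg_injective (ht 0)
    subst hs
    have h1 : e₁ = e₁' := mul_left_cancel (ht 1)
    have h2 : e₂ = e₂' := mul_left_cancel (ht 2)
    have h3 : (s : ℤ) * (2 * u + 1) = s * (2 * u' + 1) := congrFun h none
    have h4 : 2 * u + 1 = 2 * u' + 1 := mul_left_cancel₀ s.ne_zero h3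
    rw [h1, h2, show u = u' by omega]
  have hsupp : ∀ x ∉ Set.range X, P.toGraph.zhhTerm k ζ τ x = 0 := by
    intro x hx
    by_contra hne
    have hprod : ∏ v, Fhat (P.toGraph.deg v) (coeffVec P.toGraph k x v) ≠ 0 := by
      intro h0
      refine hne ?_
      rw [PlumbingGraph.zhhTerm]
      change ((∏ v, Fhat (P.toGraph.deg v) (coeffVec P.toGraph k x v) : ℚ) : ℂ) * _ * _ = 0
      rw [h0]
      simp
    obtain ⟨r, e, hr, hxe⟩ := exists_eq_tipVec hlen hprod
    obtain ⟨s, hs⟩ : ∃ s : ℤˣ, e 0 = -s := ⟨-e 0, by simp⟩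
    obtain ⟨u, hu⟩ : Odd ((s : ℤ) * r) := by
      refine Odd.mul ?_ hr
      rcases Int.units_eq_one_or s with rfl | rfl <;> decide
    have hsu : s * s = 1 := Units.ext (hunit s)
    refine hx ⟨⟨⟨s * e 1, s * e 2, s⟩, u⟩, coeffVec_injective hP k ?_⟩
    rw [hX, hxe]
    congr 1
    · simp only
      rw [← hu, ← mul_assoc, hunit, one_mul]
    · have : signs (s * e 1) (s * e 2) s = e := by
        funext i
        fin_cases i
        · exact hs.symm
        · change s * (s * e 1) = e 1
          rw [← mul_assoc, hsu, one_mul]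
        · change s * (s * e 2) = e 2
          rw [← mul_assoc, hsu, one_mul]
      simp only [this]
  have hterm : ∀ e₁ e₂ s u, P.toGraph.zhhTerm k ζ τ (X ⟨⟨e₁, e₂, s⟩, u⟩) =
      qpow (P.Delta b) τ * ((e₁ * e₂ : ℤ) *
        ((2 * u + 1).sign / 2 * ζ ^ ((s : ℤ) * (u + (e₁ + e₂) / 2)) *
          expi (((alpha b e₁ e₂ + 2 * (b 0 * b 1 * b 2 : ℕ) * u).natAbs : ℂ) ^ 2 /
          (4 * (b 0 * b 1 * b 2 : ℕ)) * τ))) := by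
    intro e₁ e₂ s u
    rw [zhhTerm_eq hball hP (hX ⟨⟨e₁, e₂, s⟩, u⟩), qpow_sq_div]
  have hfib : ∀ e₁ e₂ s, Summable fun u => P.toGraph.zhhTerm k ζ τ (X ⟨⟨e₁, e₂, s⟩, u⟩) := by
    intro e₁ e₂ s
    simp only [hterm]
    refine (Summable.mul_left _ ?_).mul_left _
    have h1 := (summable_mul_expi (ψ := fun _ => 1) hp hτ ⟨1, by simp⟩).norm
    have h2 := h1.comp_injective (natAbs_class_injective hp
      (not_dvd_alpha_signs hb hc01 hc02 (e₁ : ℤ) (e₂ : ℤ)))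
    refine Summable.of_norm_bounded h2 fun u => ?_
    have h3 : ‖((2 * u + 1).sign : ℂ) / 2‖ ≤ 1 := by
      rcases lt_trichotomy (2 * u + 1) 0 with h | h | h
      · rw [Int.sign_eq_neg_one_of_neg h]; norm_num
      · omega
      · rw [Int.sign_eq_one_of_pos h]; norm_num
    simp only [Function.comp, one_mul]
    rw [norm_mul, norm_mul, norm_zpow, hζn, _root_.one_zpow, mul_one]
    exact mul_le_of_le_one_left (norm_nonneg _) h3
  have hsumX : Summable fun q => P.toGraph.zhhTerm k ζ τ (X q) := by
    refine Summable.of_norm ?_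
    refine (summable_prod_of_nonneg fun _ => norm_nonneg _).2 ⟨?_, (hasSum_fintype _).summable⟩
    rintro ⟨e₁, e₂, s⟩
    exact (hfib e₁ e₂ s).norm
  have hHas : HasSum (P.toGraph.zhhTerm k ζ τ) (∑' q, P.toGraph.zhhTerm k ζ τ (X q)) := by
    rw [← hXinj.hasSum_iff hsupp]
    exact hsumX.hasSum
  refine ⟨hHas.summable, ?_⟩
  have hfin := (hsumX.hasSum.prod_fiberwise fun q => (hfib q.1 q.2.1 q.2.2).hasSum).unique
    (hasSum_fintype _)
  rw [PlumbingGraph.zhh, hHas.tsum_eq, hfin, Fintype.sum_prod_type]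
  -- the terms for `s = 1` and `s = -1` combine to the two powers of `ζ` in the definition of `φ`
  have hpair : ∀ e₁ e₂ : ℤˣ, ∑ s : ℤˣ, ∑' u, P.toGraph.zhhTerm k ζ τ (X ⟨⟨e₁, e₂, s⟩, u⟩) =
      qpow (P.Delta b) τ * ((e₁ * e₂ : ℤ) *
        ((∑' n : ℕ, phiPart (b 0 * b 1 * b 2) (alpha b e₁ e₂)
          (alpha b e₁ e₂ - (b 0 * b 1 * b 2 : ℕ) * (e₁ + e₂)) n ζ *
            expi ((n : ℂ) ^ 2 / (4 * (b 0 * b 1 * b 2 : ℕ)) * τ)) +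
          if e₁ = -1 ∧ e₂ = -1 then CTerm b ζ τ else 0)) := by
    intro e₁ e₂
    rw [sum_units_int]
    have h1 := ((hfib e₁ e₂ 1).hasSum.add (hfib e₁ e₂ (-1)).hasSum)
    have h2 := ((hasSum_signed hb h01 h12 hc01 hc02 hc12 hj hζ hτ e₁ e₂).mul_left
      ((e₁ * e₂ : ℤ) : ℂ)).mul_left (qpow (P.Delta b) τ)
    refine h1.unique (h2.congr_fun ?_)
    intro u
    rw [hterm, hterm]
    push_cast
    rw [one_mul, neg_one_mul]
    ring
  simp only [Fintype.sum_prod_type, hpair]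
  rw [hasSum_ASeries hb h01 h12 hj hζ hτ]
  simp only [sum_units_int]
  have hne : ¬ ((1 : ℤˣ) = -1) := by decide
  simp only [hne, false_and, and_false, if_false, and_self, if_true]
  push_cast
  ring

end

end FalseTheta

/-! ### Existence of the plumbing -/

namespace FalseTheta

open Matrix

/-- A star whose legs have negative continued fractions is negative definite as soon as the number that
remains at the centre after completing the squares along the legs is negative. -/
lemma isNegDef_of_isNegLeg {P : StarPlumbing} (hleg : ∀ i, IsNegLeg (P.leg i))
    (hneg : (P.center : ℚ) - ∑ i, (negContFrac (P.leg i))⁻¹ < 0) : P.toGraph.IsNegDef := by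
  classical
  set c : ℝ := P.center - ∑ i, ((negContFrac (P.leg i) : ℚ) : ℝ)⁻¹ with hc
  have hcneg : c < 0 := by rw [hc]; exact_mod_cast hneg
  refine Matrix.PosDef.of_dotProduct_mulVec_pos ?_ fun y hy => ?_
  · ext v w
    change -((P.toGraph.matrix w v : ℤ) : ℝ) = -((P.toGraph.matrix v w : ℤ) : ℝ)
    rw [matrix_symm]
  have hform : star y ⬝ᵥ (-(P.toGraph.matrix.map (Int.cast : ℤ → ℝ)) *ᵥ y) =
      -(P.center * y none ^ 2 + ∑ i, legForm (P.leg i) (legSeq P y i)) := by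
    have h1 := form_eq_sum_legForm y
    rw [zsmul_eq_mul] at h1
    rw [← h1, neg_mulVec, dotProduct_neg]
    simp [dotProduct, mulVec, zsmul_eq_mul]
  rw [hform, neg_pos]
  have hle : ∀ i, legForm (P.leg i) (legSeq P y i) ≤
      -((negContFrac (P.leg i) : ℚ) : ℝ)⁻¹ * y none ^ 2 := fun i => (legForm_le (hleg i) _).1
  have hsum : P.center * y none ^ 2 + ∑ i, legForm (P.leg i) (legSeq P y i) ≤ c * y none ^ 2 := by
    have := Finset.sum_le_sum fun i (_ : i ∈ Finset.univ) => hle i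
    rw [← Finset.sum_mul, Finset.sum_neg_distrib] at this
    rw [hc]
    linarith
  by_contra! h0
  have hy0 : y none = 0 := by
    by_contra hne
    have : 0 < y none ^ 2 := by positivity
    nlinarith
  have hle0 : ∀ i ∈ Finset.univ, legForm (P.leg i) (legSeq P y i) ≤ 0 := fun i _ => by
    have := hle i
    rwa [hy0, zero_pow two_ne_zero, mul_zero] at this
  rw [hy0, zero_pow two_ne_zero, mul_zero, zero_add] at h0
  have hz := (Finset.sum_eq_zero_iff_of_nonpos hle0).1 (le_antisymm (Finset.sum_nonpos hle0) h0)
  refine hy ?_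
  funext v
  rcases v with _ | ⟨i, a⟩
  · exact hy0
  · have := (legForm_le (hleg i) (legSeq P y i)).2 hy0 (hz i (Finset.mem_univ i)).ge a a.2
    simpa [legSeq] using this

/-- The numerator of the Seifert invariant of a fibre of multiplicity `b`, where `d` is the product of the
other multiplicities. -/
lemma exists_seifert_numerator {b d : ℕ} (hb : 2 ≤ b) (hcop : b.Coprime d) :
    ∃ w : ℕ, 0 < w ∧ w < b ∧ b.Coprime w ∧ b ∣ 1 + w * d := by
  have : NeZero b := ⟨by omega⟩
  obtain ⟨u, hu⟩ := (ZMod.isUnit_iff_coprime d b).2 hcop.symm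
  refine ⟨(-(u⁻¹ : (ZMod b)ˣ) : ZMod b).val, ?_⟩
  set w := (-(u⁻¹ : (ZMod b)ˣ) : ZMod b).val with hw
  have hdvd : b ∣ 1 + w * d := by
    rw [← ZMod.natCast_eq_zero_iff]
    push_cast
    rw [hw, ZMod.natCast_zmod_val, ← hu]
    simp
  have hco : b.Coprime w := by
    refine Nat.Coprime.symm (Nat.Coprime.coprime_dvd_right hdvd ?_)
    exact (Nat.coprime_add_mul_left_right _ _ _).2 (Nat.coprime_one_right _)
  refine ⟨Nat.pos_of_ne_zero fun h0 => ?_, ZMod.val_lt _, hco, hdvd⟩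
  rw [h0, Nat.coprime_zero_right] at hco
  omega

/-- Every Brieskorn sphere has a star-shaped plumbing. -/
theorem exists_isPlumbingOf {b : Fin 3 → ℕ} (hb : ∀ i, 2 ≤ b i) (hc01 : (b 0).Coprime (b 1))
    (hc02 : (b 0).Coprime (b 2)) (hc12 : (b 1).Coprime (b 2)) :
    ∃ P : StarPlumbing, P.IsPlumbingOf b := by
  have hbQ : ∀ i, (0 : ℚ) < b i := fun i => by
    have := hb i
    exact_mod_cast (by omega : 0 < b i)
  obtain ⟨w0, hw0, hl0, hco0, hd0⟩ := exists_seifert_numerator (hb 0) (hc01.mul_right hc02)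
  obtain ⟨w1, hw1, hl1, hco1, hd1⟩ := exists_seifert_numerator (hb 1) (hc01.symm.mul_right hc12)
  obtain ⟨w2, hw2, hl2, hco2, hd2⟩ :=
    exists_seifert_numerator (hb 2) (hc02.symm.mul_right hc12.symm)
  obtain ⟨l0, he0, hn0⟩ := exists_leg (b 0) w0 hw0 hl0 hco0
  obtain ⟨l1, he1, hn1⟩ := exists_leg (b 1) w1 hw1 hl1 hco1
  obtain ⟨l2, he2, hn2⟩ := exists_leg (b 2) w2 hw2 hl2 hco2
  -- divisibility by each of the coprime factors
  have hdvd : b 0 * b 1 * b 2 ∣ 1 + w0 * (b 1 * b 2) + w1 * (b 0 * b 2) + w2 * (b 0 * b 1) := by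
    refine Nat.Coprime.mul_dvd_of_dvd_of_dvd (hc02.mul_left hc12)
      (Nat.Coprime.mul_dvd_of_dvd_of_dvd hc01 ?_ ?_) ?_
    · have : b 0 ∣ w1 * (b 0 * b 2) + w2 * (b 0 * b 1) := ⟨w1 * b 2 + w2 * b 1, by ring⟩
      simpa only [add_assoc] using hd0.add this
    · have : b 1 ∣ w0 * (b 1 * b 2) + w2 * (b 0 * b 1) := ⟨w0 * b 2 + w2 * b 0, by ring⟩
      rw [show 1 + w0 * (b 1 * b 2) + w1 * (b 0 * b 2) + w2 * (b 0 * b 1) =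
        (1 + w1 * (b 0 * b 2)) + (w0 * (b 1 * b 2) + w2 * (b 0 * b 1)) by ring]
      exact hd1.add this
    · have : b 2 ∣ w0 * (b 1 * b 2) + w1 * (b 0 * b 2) := ⟨w0 * b 1 + w1 * b 0, by ring⟩
      rw [show 1 + w0 * (b 1 * b 2) + w1 * (b 0 * b 2) + w2 * (b 0 * b 1) =
        (1 + w2 * (b 0 * b 1)) + (w0 * (b 1 * b 2) + w1 * (b 0 * b 2)) by ring]
      exact hd2.add this
  obtain ⟨m, hm⟩ := hdvd
  have hmQ : (1 : ℚ) + w0 * (b 1 * b 2) + w1 * (b 0 * b 2) + w2 * (b 0 * b 1) =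
      b 0 * b 1 * b 2 * m := by exact_mod_cast hm
  have hcenter : ((-(m : ℤ) : ℤ) : ℚ) + (w0 / b 0 + w1 / b 1 + w2 / b 2) =
      -(1 / (b 0 * b 1 * b 2 : ℚ)) := by
    have h0 := (hbQ 0).ne'
    have h1 := (hbQ 1).ne'
    have h2 := (hbQ 2).ne'
    push_cast
    field_simp
    linear_combination hmQ
  have hp : (0 : ℚ) < 1 / (b 0 * b 1 * b 2 : ℚ) := by
    have h0 := hbQ 0
    have h1 := hbQ 1
    have h2 := hbQ 2
    positivity
  refine ⟨⟨-m, ![l0, l1, l2]⟩, isNegDef_of_isNegLeg ?_ ?_, ![(w0 : ℤ), w1, w2], ?_, ?_, ?_⟩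
  · intro i
    fin_cases i
    · exact hn0
    · exact hn1
    · exact hn2
  · simp only [Fin.sum_univ_three]
    change ((-(m : ℤ) : ℤ) : ℚ) -
      ((negContFrac l0)⁻¹ + (negContFrac l1)⁻¹ + (negContFrac l2)⁻¹) < 0
    rw [he0, he1, he2, inv_neg, inv_neg, inv_neg, inv_div, inv_div, inv_div]
    linarith
  · intro i
    fin_cases i
    · exact Int.natCast_pos.2 hw0
    · exact Int.natCast_pos.2 hw1
    · exact Int.natCast_pos.2 hw2
  · intro i
    fin_cases i
    · exact he0
    · exact he1
    · exact he2
  · rw [Fin.sum_univ_three]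
    exact hcenter

end FalseTheta

theorem theorem1p2 (b : Fin 3 → ℕ) (hb : 2 ≤ b 0) (h01 : b 0 < b 1) (h12 : b 1 < b 2)
    (hcop : ∀ i i' : Fin 3, i ≠ i' → Nat.Coprime (b i) (b i'))
    (j : ℕ) (hj : 0 < j) (ζ : ℂ) (hζ : ζ ^ j = 1) :
    -- the Brieskorn sphere has a plumbing, and the series is as claimed for every plumbing
    (∃ P : StarPlumbing, P.IsPlumbingOf b) ∧
    (∀ P : StarPlumbing, P.IsPlumbingOf b →
      ∀ k : P.Vertex → ℤ, P.toGraph.IsSpinc k → ∀ τ : ℂ, 0 < τ.im →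
        Summable (P.toGraph.zhhTerm k ζ τ) ∧ Summable (ATerm b ζ τ) ∧
        P.toGraph.zhh k ζ τ = qpow (P.Delta b) τ * (CTerm b ζ τ - ASeries b ζ τ)) ∧
    -- the radial limits and the asymptotic expansions of `A_ζ` at the rational numbers
    -- form a (strong) quantum modular form
    (∃ (f : ℚ → ℂ) (a : ℚ → ℕ → ℂ),
      (∀ x : ℚ, Tendsto (fun t : ℝ => ASeries b ζ (x + Complex.I * t)) (𝓝[>] 0) (𝓝 (f x))) ∧
      IsQuantumModularForm 1 (fun _ => 1)
        (CongruenceSubgroup.Gamma (4 * (b 0 * b 1 * b 2) * j ^ 2)) f ∧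
      (∀ x : ℚ, a x 0 = f x) ∧
      IsRadialExpansion (ASeries b ζ) a ∧
      IsStrongQuantumModularForm 1 (fun _ => 1)
        (CongruenceSubgroup.Gamma (4 * (b 0 * b 1 * b 2) * j ^ 2)) a) := by
  have hc01 : (b 0).Coprime (b 1) := hcop 0 1 (by decide)
  have hc02 : (b 0).Coprime (b 2) := hcop 0 2 (by decide)
  have hc12 : (b 1).Coprime (b 2) := hcop 1 2 (by decide)
  have hball : ∀ i, 2 ≤ b i := by
    intro i
    fin_cases i
    · exact hb
    · exact (by omega : 2 ≤ b 1)
    · exact (by omega : 2 ≤ b 2)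
  have hp : 0 < b 0 * b 1 * b 2 :=
    Nat.mul_pos (Nat.mul_pos (by omega) (by omega)) (by omega)
  refine ⟨FalseTheta.exists_isPlumbingOf hball hc01 hc02 hc12, fun P hP k hk τ hτ => ?_, ?_⟩
  · obtain ⟨h1, h2⟩ := FalseTheta.zhh_eq hb h01 h12 hc01 hc02 hc12 hj hζ hτ hP hk
    exact ⟨h1, FalseTheta.summable_ATerm hp hj hζ hτ, h2⟩
  · rw [FalseTheta.ASeries_eq_falseTheta]
    exact FalseTheta.exists_quantumModularForm hp hj (FalseTheta.phi_neg hb hc01 hc02)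
      (FalseTheta.phi_add_period hp hj hζ)
      (FalseTheta.conj_phi (Complex.norm_eq_one_of_pow_eq_one hζ hj.ne'))
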